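/- **Setting.** Function spaces are real. Let $N\ge 1$ and let $\{\phi_p\}_{p\in\Lambda}\subset H^1(\mathbb R^3)$ be an $L^2$-orthonormal family indexed by a countable (finite or infinite) linearly ordered set $\Lambda$, $K=|\Lambda|$. Let $S$ be the set of $N$-element subsets of $\Lambda$. For $\alpha=\{\alpha_1<\dots<\alpha_N\}\in S$ let $\Phi_\alpha(x_1,\dots,x_N)=N!^{-1/2}\det(\phi_{\alpha_i}(x_j))$. Let $\mathfrak H^1$ be the space of antisymmetric functions in $H^1(\mathbb R^{3N})$ with the $H^1$-norm, and let $\mathfrak H^1_K$ be the subspace spanned by all $\Phi_\alpha$ (the $H^1$-closed span if $K=\infty$). We write $\langle\cdot,\cdot\rangle$ for the $L^2$ inner product and for the pairing of $(\mathfrak H^1_K)^*$ with $\mathfrak H^1_K$; the map $\Psi\mapsto\langle\Psi,\cdot\rangle$ embeds $\mathfrak H^1_K$ densely into $(\mathfrak H^1_K)^*$. Fix a reference state $0\in S$ all of whose elements are smaller than all elements of $\Lambda\setminus 0$, and let $\Phi_0$ be its (normalized) Slater determinant. For $\alpha,\beta\in S$ put $$\alpha\vee\beta=(\alpha\cap\beta\cap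 0)\cup(\alpha\setminus 0)\cup(\beta\setminus 0).$$ For $0\ne\alpha\in S$ the excitation operator $X_\alpha$ is the bounded linear operator on $\mathfrak H^1_K$ with $X_\alpha\Phi_\beta=\sigma(\alpha,\beta)\,\Phi_{\alpha\vee\beta}$ if $|(\alpha\cup\beta)\cap 0|=N$ and $\alpha\cap\beta\subset 0$, and $X_\alpha\Phi_\beta=0$ otherwise. Here $$\sigma(\alpha,\beta)=\operatorname{sgn}(\beta\setminus0,\ \alpha\setminus 0)\;\varepsilon(0\setminus\alpha,\ 0\setminus\beta),$$ $\operatorname{sgn}(A,B)$ is the sign of the permutation that sorts the tuple consisting of the elements of $A$ in increasing order followed by the elements of $B$ in increasing order, and $\varepsilon$ is any fixed $\{\pm1\}$-valued function with $\varepsilon(I,\emptyset)=1$, which encodes the sign convention for the vacated orbitals ($\varepsilon\equiv 1$ is allowed; $\varepsilon=\operatorname{sgn}$ gives the commuting excitation operators of second quantization, normalized by $X_\alpha\Phi_0=\Phi_\alpha$). The amplitude space $\mathbb V$ consists of all $t=(t_\alpha)_{0\ne\alpha\in S}\in\ell^2$ with $\sum_\alpha t_\alpha\Phi_\alpha\in\mathfrak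 H^1_K$ (sum in $L^2$). To $t\in\mathbb V$ belongs the cluster operator $T=\sum_\alpha t_\alpha X_\alpha$, an element of the operator-norm closure of $\operatorname{span}\{X_\alpha:\alpha\neq0\}$ in the bounded operators on $\mathfrak H^1_K$ (the sum, evaluated on Slater determinants, converges in $L^2$); the operators belonging to $s$, $c$, $t_*$, $c_*$ are denoted $S$, $C$, $T_*$, $C_*$. Each $e^{-T}$ is also regarded, by continuous extension, as a bounded operator on $(\mathfrak H^1_K)^*$. **Theorem.** Let $\mathcal H:\mathfrak H^1_K\to(\mathfrak H^1_K)^*$ be a bounded linear operator, let $\Psi\in\mathfrak H^1_K$ with $\langle\Psi,\Phi_0\rangle=1$, and let $\mathcal E\in\mathbb R$. The following are equivalent. 1. $\langle\mathcal H\Psi,\Phi\rangle=\mathcal E\langle\Psi,\Phi\rangle$ for all $\Phi\in\mathfrak H^1_K$. 2. (Full CC) $\Psi=e^{T_*}\Phi_0$ for some $t_*\in\mathbb V$ such that $\langle e^{-T_*}\mathcal He^{T_*}\Phi_0,S\Phi_0\rangle=0$ for all $s\in\mathbb V$, and $\mathcal E=\langle e^{-T_*}\mathcal He^{T_*}\Phi_0,\Phi_0\rangle$.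 3. (Full CI) $\Psi=(I+C_*)\Phi_0$ for some $c_*\in\mathbb V$ such that $\langle\mathcal H(I+C_*)\Phi_0,S\Phi_0\rangle=\mathcal E_{\mathrm{CI}}\langle(I+C_*)\Phi_0,S\Phi_0\rangle$ for all $s\in\mathbb V$, where $\mathcal E_{\mathrm{CI}}=\langle\mathcal H(I+C_*)\Phi_0,\Phi_0\rangle$, and $\mathcal E=\mathcal E_{\mathrm{CI}}$. In (2) and (3) it is part of the claim that the bounded operators $T_*$, $C_*$, $S$ and the extension of $e^{-T_*}$ exist. -/

import Mathlib

open MeasureTheory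
open scoped ContDiff ENNReal

noncomputable section

namespace CoupledCluster

/-! ### Real Sobolev spaces of first order, through weak derivatives -/

section Sobolev

variable {E : Type*} [NormedAddCommGroup E] [NormedSpace ℝ E] [MeasureSpace E] [BorelSpace E]
  [IsFiniteMeasureOnCompacts (volume : Measure E)]

set_option linter.unusedSectionVars false

/-- The real Hilbert space `L²(E)`. -/
abbrev L2 (E : Type*) [MeasureSpace E] : Type _ := Lp ℝ 2 (volume : Measure E)

/-- `w` is the distributional derivative of `u` in the direction `v`. -/
def HasWeakDeriv (u w : L2 E) (v : E) : Prop :=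
  ∀ ψ : E → ℝ, ContDiff ℝ ∞ ψ → HasCompactSupport ψ →
    ∫ x, u x * fderiv ℝ ψ x v = - ∫ x, w x * ψ x

theorem integrable_mul_test (u : L2 E) {ψ : E → ℝ} (hψ : Continuous ψ)
    (hc : HasCompactSupport ψ) : Integrable (fun x => u x * ψ x) :=
  MemLp.integrable_mul (p := 2) (q := 2) (Lp.memLp u) (hψ.memLp_of_hasCompactSupport hc)

theorem integrable_mul_fderiv (u : L2 E) {ψ : E → ℝ} (hψ : ContDiff ℝ ∞ ψ)
    (hc : HasCompactSupport ψ) (v : E) : Integrable (fun x => u x * fderiv ℝ ψ x v) :=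
  integrable_mul_test u
    ((hψ.continuous_fderiv (by simp)).clm_apply continuous_const)
    ((hc.fderiv (𝕜 := ℝ)).comp_left (g := fun L : E →L[ℝ] ℝ => L v) rfl)

theorem HasWeakDeriv.add {u u' w w' : L2 E} {v : E} (h : HasWeakDeriv u w v)
    (h' : HasWeakDeriv u' w' v) : HasWeakDeriv (u + u') (w + w') v := by
  intro ψ hψ hc
  have e1 : ∫ x, (u + u') x * fderiv ℝ ψ x v
      = ∫ x, (u x * fderiv ℝ ψ x v + u' x * fderiv ℝ ψ x v) := by
    refine integral_congr_ae ?_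
    filter_upwards [Lp.coeFn_add u u'] with x hx
    rw [hx, Pi.add_apply, add_mul]
  have e2 : ∫ x, (w + w') x * ψ x = ∫ x, (w x * ψ x + w' x * ψ x) := by
    refine integral_congr_ae ?_
    filter_upwards [Lp.coeFn_add w w'] with x hx
    rw [hx, Pi.add_apply, add_mul]
  rw [e1, e2, integral_add (integrable_mul_fderiv u hψ hc v) (integrable_mul_fderiv u' hψ hc v),
    integral_add (integrable_mul_test w hψ.continuous hc)
      (integrable_mul_test w' hψ.continuous hc), h ψ hψ hc, h' ψ hψ hc]
  ring

theorem HasWeakDeriv.smul {u w : L2 E} {v : E} (r : ℝ) (h : HasWeakDeriv u w v) :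
    HasWeakDeriv (r • u) (r • w) v := by
  intro ψ hψ hc
  have e1 : ∫ x, (r • u) x * fderiv ℝ ψ x v = ∫ x, r * (u x * fderiv ℝ ψ x v) := by
    refine integral_congr_ae ?_
    filter_upwards [Lp.coeFn_smul r u] with x hx
    rw [hx, Pi.smul_apply, smul_eq_mul, mul_assoc]
  have e2 : ∫ x, (r • w) x * ψ x = ∫ x, r * (w x * ψ x) := by
    refine integral_congr_ae ?_
    filter_upwards [Lp.coeFn_smul r w] with x hx
    rw [hx, Pi.smul_apply, smul_eq_mul, mul_assoc]
  rw [e1, e2, integral_const_mul, integral_const_mul, h ψ hψ hc]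
  ring

theorem HasWeakDeriv.zero (v : E) : HasWeakDeriv (0 : L2 E) 0 v := by
  intro ψ _ _
  have e1 : ∫ x, (0 : L2 E) x * fderiv ℝ ψ x v = 0 := by
    rw [integral_eq_zero_of_ae]
    filter_upwards [Lp.coeFn_zero ℝ 2 (volume : Measure E)] with x hx
    rw [hx, Pi.zero_apply, zero_mul]
  have e2 : ∫ x, (0 : L2 E) x * ψ x = 0 := by
    rw [integral_eq_zero_of_ae]
    filter_upwards [Lp.coeFn_zero ℝ 2 (volume : Measure E)] with x hx
    rw [hx, Pi.zero_apply, zero_mul]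
  rw [e1, e2, neg_zero]

/-- The first order Sobolev space with respect to a finite family `d` of directions. A function
`u` is stored together with its weak derivatives, as `U none = u` and `U (some i) = ∂_{d i} u`;
these derivatives are determined by `u`. The inner product inherited from the Hilbert sum is
`⟨u, u'⟩ + ∑ i, ⟨∂_{d i} u, ∂_{d i} u'⟩`. -/
def sobolev {ι : Type*} [Fintype ι] (d : ι → E) :
    Submodule ℝ (PiLp 2 (fun _ : Option ι => L2 E)) where
  carrier := {U | ∀ i, HasWeakDeriv (U none) (U (some i)) (d i)}
  add_mem' hU hV i := (hU i).add (hV i)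
  zero_mem' i := HasWeakDeriv.zero (d i)
  smul_mem' r _ hU i := (hU i).smul r

end Sobolev

/-! ### One-particle and `N`-particle spaces -/

/-- The one-particle configuration space. -/
abbrev R3 : Type := EuclideanSpace ℝ (Fin 3)

/-- The `N`-particle configuration space `ℝ^{3N}`; a point is `X = (x_1, …, x_N)`. -/
abbrev Config (N : ℕ) : Type := Fin N → R3

/-- The unit vectors of `ℝ³`. -/
def axis (c : Fin 3) : R3 := EuclideanSpace.single c 1

/-- The unit vectors of `ℝ^{3N}`: coordinate `c` of the particle `k`. -/
def configAxis (N : ℕ) (kc : Fin N × Fin 3) : Config N := Pi.single kc.1 (axis kc.2)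

/-- The real Sobolev space `H¹(ℝ³)`. -/
abbrev OneH1 : Type := sobolev axis

/-- The underlying `L²` function of an element of `H¹(ℝ³)`. -/
def OneH1.fn (f : OneH1) : L2 R3 := f.1 none

/-- `u(x_{σ 1}, …, x_{σ N}) = sgn(σ) u(x_1, …, x_N)` for all permutations `σ`. -/
def IsAntisymm {N : ℕ} (u : L2 (Config N)) : Prop :=
  ∀ σ : Equiv.Perm (Fin N), ∀ᵐ X : Config N, u (X ∘ σ) = ((Equiv.Perm.sign σ : ℤ) : ℝ) * u X

theorem quasiMeasurePreserving_perm {N : ℕ} (σ : Equiv.Perm (Fin N)) :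
    Measure.QuasiMeasurePreserving (fun X : Config N => X ∘ σ) volume volume := by
  have h := (volume_measurePreserving_piCongrLeft (fun _ : Fin N => R3) σ⁻¹).quasiMeasurePreserving
  convert h using 1
  funext X
  funext i
  have := MeasurableEquiv.piCongrLeft_apply_apply (β := fun _ : Fin N => R3) σ⁻¹ X (σ i)
  simpa using this.symm

theorem IsAntisymm.add {N : ℕ} {u v : L2 (Config N)} (hu : IsAntisymm u) (hv : IsAntisymm v) :
    IsAntisymm (u + v) := by
  intro σ
  filter_upwards [hu σ, hv σ, Lp.coeFn_add u v,
    (quasiMeasurePreserving_perm σ).ae (Lp.coeFn_add u v)] with X h1 h2 h3 h4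
  rw [h4, h3, Pi.add_apply, Pi.add_apply, h1, h2, mul_add]

theorem IsAntisymm.smul {N : ℕ} {u : L2 (Config N)} (r : ℝ) (hu : IsAntisymm u) :
    IsAntisymm (r • u) := by
  intro σ
  filter_upwards [hu σ, Lp.coeFn_smul r u,
    (quasiMeasurePreserving_perm σ).ae (Lp.coeFn_smul r u)] with X h1 h3 h4
  rw [h4, h3, Pi.smul_apply, Pi.smul_apply, h1, smul_eq_mul, smul_eq_mul]
  ring

theorem IsAntisymm.zero {N : ℕ} : IsAntisymm (0 : L2 (Config N)) := by
  intro σ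
  filter_upwards [Lp.coeFn_zero ℝ 2 (volume : Measure (Config N)),
    (quasiMeasurePreserving_perm σ).ae (Lp.coeFn_zero ℝ 2 (volume : Measure (Config N)))]
    with X h3 h4
  rw [h4, h3]
  simp

/-- The fermionic Sobolev space `(⋀ᴺ L²(ℝ³)) ∩ H¹(ℝ^{3N})`, as a subspace of the Hilbert sum that
contains the functions and their weak derivatives. -/
def fermiSubmodule (N : ℕ) : Submodule ℝ (PiLp 2 (fun _ : Option (Fin N × Fin 3) => L2 (Config N))) where
  carrier := {U | U ∈ sobolev (configAxis N) ∧ IsAntisymm (U none)}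
  add_mem' hU hV := ⟨add_mem hU.1 hV.1, hU.2.add hV.2⟩
  zero_mem' := ⟨zero_mem _, IsAntisymm.zero⟩
  smul_mem' r _ hU := ⟨Submodule.smul_mem _ r hU.1, hU.2.smul r⟩

/-- The fermionic Sobolev space `𝔥¹ = (⋀ᴺ L²(ℝ³)) ∩ H¹(ℝ^{3N})`. -/
def FermiH1 (N : ℕ) : Type := fermiSubmodule N

instance (N : ℕ) : NormedAddCommGroup (FermiH1 N) :=
  inferInstanceAs (NormedAddCommGroup (fermiSubmodule N))

/-- The `H¹` inner product. -/
instance (N : ℕ) : InnerProductSpace ℝ (FermiH1 N) :=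
  inferInstanceAs (InnerProductSpace ℝ (fermiSubmodule N))

/-- The embedding `𝔥¹ → L²(ℝ^{3N})`. -/
def FermiH1.toL2 (N : ℕ) : FermiH1 N →L[ℝ] L2 (Config N) :=
  (PiLp.proj 2 (fun _ : Option (Fin N × Fin 3) => L2 (Config N)) none).comp
    (fermiSubmodule N).subtypeL

/-! ### Slater determinants -/

theorem memLp_tensor {N : ℕ} (f : Fin N → L2 R3) :
    MemLp (fun X : Config N => ∏ j, f j (X j)) 2 volume := by
  have hm : AEStronglyMeasurable (fun X : Config N => ∏ j, f j (X j)) volume := by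
    refine (Finset.stronglyMeasurable_fun_prod _ fun j _ => ?_).aestronglyMeasurable
    exact (Lp.stronglyMeasurable (f j)).comp_measurable (measurable_pi_apply j)
  rw [memLp_two_iff_integrable_sq hm]
  have h := Integrable.fintype_prod (ι := Fin N) (μ := fun _ => (volume : Measure R3))
    (f := fun j x => (f j x) ^ 2) (fun j => (Lp.memLp (f j)).integrable_sq)
  simp only [Finset.prod_pow] at h
  exact h

/-- The product function `X ↦ f_1(x_1) ⋯ f_N(x_N)`. -/
def tensor {N : ℕ} (f : Fin N → L2 R3) : L2 (Config N) := (memLp_tensor f).toLp _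

theorem tensor_coe {N : ℕ} (f : Fin N → L2 R3) :
    tensor f =ᵐ[volume] fun X : Config N => ∏ j, f j (X j) := (memLp_tensor f).coeFn_toLp

theorem insertNth_slice {n : ℕ} (k : Fin (n + 1)) (y : Config n) {ψ : Config (n + 1) → ℝ}
    (hψ : ContDiff ℝ ∞ ψ) (hc : HasCompactSupport ψ) :
    ContDiff ℝ ∞ (fun x : R3 => ψ (k.insertNth (α := fun _ => R3) x y)) ∧
    HasCompactSupport (fun x : R3 => ψ (k.insertNth (α := fun _ => R3) x y)) ∧
    ∀ x v : R3, fderiv ℝ (fun x : R3 => ψ (k.insertNth (α := fun _ => R3) x y)) x v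
      = fderiv ℝ ψ (k.insertNth (α := fun _ => R3) x y) (Pi.single k v) := by
  have hupd : ∀ x : R3, k.insertNth (α := fun _ => R3) x y
      = ContinuousLinearMap.single ℝ (fun _ : Fin (n + 1) => R3) k x
        + k.insertNth (α := fun _ => R3) 0 y := by
    intro x
    funext i
    refine Fin.succAboveCases k ?_ (fun j => ?_) i
    · simp
    · simp
  have hfd : ∀ x : R3, HasFDerivAt (fun x : R3 => k.insertNth (α := fun _ => R3) x y)
      (ContinuousLinearMap.single ℝ (fun _ : Fin (n + 1) => R3) k) x := by
    intro x
    have h0 := (ContinuousLinearMap.single ℝ (fun _ : Fin (n + 1) => R3) k).hasFDerivAt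
      (x := x) |>.add_const (k.insertNth (α := fun _ => R3) 0 y)
    exact h0.congr_of_eventuallyEq (Filter.Eventually.of_forall hupd)
  refine ⟨?_, ?_, ?_⟩
  · refine hψ.comp ?_
    rw [funext hupd]
    exact (ContinuousLinearMap.contDiff _).add contDiff_const
  · refine HasCompactSupport.intro (hc.isCompact.image (continuous_apply k)) ?_
    intro x hx
    by_contra hne
    refine hx ⟨_, subset_tsupport ψ hne, ?_⟩
    simp
  · intro x v
    have h1 := ((hψ.differentiable (by simp)) (k.insertNth (α := fun _ => R3) x y)).hasFDerivAt
    have h2 := h1.comp x (hfd x)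
    have h3 : fderiv ℝ (fun x : R3 => ψ (k.insertNth (α := fun _ => R3) x y)) x = _ := h2.fderiv
    rw [h3]
    simp

theorem integral_slice {n : ℕ} (k : Fin (n + 1)) (G : Config (n + 1) → ℝ) (hG : Integrable G) :
    ∫ X, G X = ∫ y : Config n, ∫ x : R3, G (k.insertNth (α := fun _ => R3) x y) := by
  have mp := (volume_preserving_piFinSuccAbove (fun _ : Fin (n + 1) => R3) k).symm
  have h1 := mp.integral_comp' G
  have h2 := (mp.integrable_comp_emb (MeasurableEquiv.measurableEmbedding _)).2 hG
  rw [← h1]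
  exact integral_prod_symm _ h2

theorem HasWeakDeriv.tensor {N : ℕ} (f : Fin N → L2 R3) (k : Fin N) {w : L2 R3} {v : R3}
    (h : HasWeakDeriv (f k) w v) :
    HasWeakDeriv (tensor f) (CoupledCluster.tensor (Function.update f k w)) (Pi.single k v) := by
  intro ψ hψ hc
  obtain ⟨n, rfl⟩ : ∃ n, N = n + 1 := ⟨N - 1, by have := k.pos; omega⟩
  have i1 := integrable_mul_fderiv (CoupledCluster.tensor f) hψ hc (Pi.single k v)
  have i2 := integrable_mul_test (CoupledCluster.tensor (Function.update f k w)) hψ.continuous hc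
  have c1 : (fun X => CoupledCluster.tensor f X * fderiv ℝ ψ X (Pi.single k v)) =ᵐ[volume]
      fun X => (∏ j, f j (X j)) * fderiv ℝ ψ X (Pi.single k v) := by
    filter_upwards [tensor_coe f] with X hX
    rw [hX]
  have c2 : (fun X => CoupledCluster.tensor (Function.update f k w) X * ψ X) =ᵐ[volume]
      fun X => (∏ j, Function.update f k w j (X j)) * ψ X := by
    filter_upwards [tensor_coe (Function.update f k w)] with X hX
    rw [hX]
  rw [integral_congr_ae c1, integral_congr_ae c2,
    integral_slice k _ (i1.congr c1), integral_slice k _ (i2.congr c2), ← integral_neg]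
  congr 1
  funext y
  obtain ⟨s1, s2, s3⟩ := insertNth_slice k y hψ hc
  have := h _ s1 s2
  simp only [s3] at this
  simp only [Fin.prod_univ_succAbove _ k, Fin.insertNth_apply_same,
    Fin.insertNth_apply_succAbove, Function.update_self,
    Function.update_of_ne (Fin.succAbove_ne k _)]
  have e1 : ∀ x : R3, (f k x * ∏ i, f (k.succAbove i) (y i))
      * fderiv ℝ ψ (k.insertNth (α := fun _ => R3) x y) (Pi.single k v)
      = (∏ i, f (k.succAbove i) (y i))
        * (f k x * fderiv ℝ ψ (k.insertNth (α := fun _ => R3) x y) (Pi.single k v)) := by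
    intro x; ring
  have e2 : ∀ x : R3, (w x * ∏ i, f (k.succAbove i) (y i))
      * ψ (k.insertNth (α := fun _ => R3) x y)
      = (∏ i, f (k.succAbove i) (y i)) * (w x * ψ (k.insertNth (α := fun _ => R3) x y)) := by
    intro x; ring
  simp only [e1, e2, integral_const_mul]
  rw [this]
  ring

/-- The Slater determinant `N!^{-1/2} det (f_i(x_j))` as a function on `ℝ^{3N}`. -/
def slaterFun {N : ℕ} (f : Fin N → OneH1) (X : Config N) : ℝ :=
  (Real.sqrt (N.factorial : ℝ))⁻¹ * (Matrix.of fun i j : Fin N => (f i).fn (X j)).det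

theorem exists_slater {N : ℕ} (f : Fin N → OneH1) :
    ∃ U : FermiH1 N, FermiH1.toL2 N U =ᵐ[volume] slaterFun f := by
  have hT : ∀ g : Fin N → OneH1, ∃ U : sobolev (configAxis N),
      U.1 none = tensor (fun j => (g j).fn) := by
    intro g
    refine ⟨⟨WithLp.toLp 2 (fun o => match o with
      | none => tensor (fun j => (g j).fn)
      | some kc => tensor (Function.update (fun j => (g j).fn) kc.1 ((g kc.1).1 (some kc.2)))),
      ?_⟩, rfl⟩
    intro kc
    exact HasWeakDeriv.tensor (fun j => (g j).fn) kc.1 ((g kc.1).2 kc.2)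
  choose T hTs using hT
  let V : sobolev (configAxis N) := (Real.sqrt (N.factorial : ℝ))⁻¹ •
    ∑ σ : Equiv.Perm (Fin N), ((Equiv.Perm.sign σ : ℤ) : ℝ) • T (fun j => f (σ j))
  let P : sobolev (configAxis N) →ₗ[ℝ] L2 (Config N) :=
    (PiLp.proj 2 (fun _ : Option (Fin N × Fin 3) => L2 (Config N)) none).toLinearMap.comp
      (sobolev (configAxis N)).subtype
  have hP : ∀ U : sobolev (configAxis N), P U = U.1 none := fun _ => rfl
  have hV : (V.1 none : Config N → ℝ) =ᵐ[volume] slaterFun f := by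
    have e : V.1 none = (Real.sqrt (N.factorial : ℝ))⁻¹ •
        ∑ σ : Equiv.Perm (Fin N), ((Equiv.Perm.sign σ : ℤ) : ℝ) •
          tensor (fun j => (f (σ j)).fn) := by
      change P V = _
      simp only [V, map_smul, map_sum]
      simp only [hP, hTs]
    rw [e]
    have h1 : ∀ᵐ X : Config N, ∀ σ : Equiv.Perm (Fin N),
        (((Equiv.Perm.sign σ : ℤ) : ℝ) • tensor (fun j => (f (σ j)).fn)) X
          = ((Equiv.Perm.sign σ : ℤ) : ℝ) * ∏ j, (f (σ j)).fn (X j) := by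
      rw [ae_all_iff]
      intro σ
      filter_upwards [Lp.coeFn_smul ((Equiv.Perm.sign σ : ℤ) : ℝ) (tensor (fun j => (f (σ j)).fn)),
        tensor_coe (fun j => (f (σ j)).fn)] with X h1 h2
      rw [h1, Pi.smul_apply, h2, smul_eq_mul]
    filter_upwards [h1, Lp.coeFn_smul (Real.sqrt (N.factorial : ℝ))⁻¹
        (∑ σ : Equiv.Perm (Fin N), ((Equiv.Perm.sign σ : ℤ) : ℝ) •
          tensor (fun j => (f (σ j)).fn)),
      Lp.coeFn_finsetSum (Finset.univ : Finset (Equiv.Perm (Fin N)))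
        (fun σ => ((Equiv.Perm.sign σ : ℤ) : ℝ) • tensor (fun j => (f (σ j)).fn))]
      with X a1 a2 a3
    rw [a2, Pi.smul_apply, a3, slaterFun, Matrix.det_apply', smul_eq_mul]
    simp only [a1, Finset.sum_apply, Matrix.of_apply]
  refine ⟨⟨V.1, V.2, ?_⟩, hV⟩
  intro σ
  filter_upwards [hV, (quasiMeasurePreserving_perm σ).ae hV] with X h1 h2
  rw [h1, h2]
  have := Matrix.det_permute' σ (Matrix.of fun i j : Fin N => (f i).fn (X j))
  have e : (Matrix.of fun i j : Fin N => (f i).fn ((X ∘ σ) j))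
      = (Matrix.of fun i j : Fin N => (f i).fn (X j)).submatrix id σ := rfl
  rw [slaterFun, slaterFun, e, this]
  ring

/-- The Slater determinant as an element of `𝔥¹`; it is determined by its `L²` class, which is
given by `slaterFun` (see `slaterH1_spec`). -/
def slaterH1 {N : ℕ} (f : Fin N → OneH1) : FermiH1 N := (exists_slater f).choose

theorem slaterH1_spec {N : ℕ} (f : Fin N → OneH1) :
    FermiH1.toL2 N (slaterH1 f) =ᵐ[volume] slaterFun f := (exists_slater f).choose_spec

/-! ### Orbitals, states and the Galerkin space -/

/-- An `L²`-orthonormal family of orbitals `φ_p ∈ H¹(ℝ³)`, `p ∈ Λ`. -/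
structure OrbitalSet (Λ : Type*) where
  orb : Λ → OneH1
  orthonormal : Orthonormal ℝ (fun p => (orb p).fn)

/-- The `N`-particle states: the `N`-element subsets of `Λ`. -/
abbrev State (Λ : Type*) (N : ℕ) : Type _ := {α : Finset Λ // α.card = N}

variable {Λ : Type*} [LinearOrder Λ] {N : ℕ}

/-- The Slater determinant `Φ_α = N!^{-1/2} det (φ_{α_i}(x_j))`, where `α_1 < … < α_N` are the
elements of `α`. -/
def slater (φ : OrbitalSet Λ) (α : State Λ N) : FermiH1 N :=
  slaterH1 (fun i => φ.orb (α.1.orderEmbOfFin α.2 i))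

/-- The subspace of `𝔥¹` spanned by all Slater determinants: the `H¹`-closure of their linear
span, which is the linear span itself if `Λ` is finite. -/
def galerkin (φ : OrbitalSet Λ) (N : ℕ) : Submodule ℝ (FermiH1 N) :=
  (Submodule.span ℝ (Set.range (slater (N := N) φ))).topologicalClosure

/-- The space `𝔥¹_K` spanned by all Slater determinants. -/
def H1K (φ : OrbitalSet Λ) (N : ℕ) : Type := galerkin φ N

instance (φ : OrbitalSet Λ) (N : ℕ) : NormedAddCommGroup (H1K φ N) :=
  inferInstanceAs (NormedAddCommGroup (galerkin φ N))

/-- The inner product of `𝔥¹_K` is the `H¹` inner product. -/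
instance (φ : OrbitalSet Λ) (N : ℕ) : InnerProductSpace ℝ (H1K φ N) :=
  inferInstanceAs (InnerProductSpace ℝ (galerkin φ N))

/-- The Slater determinant `Φ_α` as an element of `𝔥¹_K`. -/
def det (φ : OrbitalSet Λ) (α : State Λ N) : H1K φ N :=
  ⟨slater φ α, Submodule.le_topologicalClosure _ (Submodule.subset_span ⟨α, rfl⟩)⟩

/-- The embedding of `𝔥¹_K` into `L²(ℝ^{3N})`. -/
def toL2 (φ : OrbitalSet Λ) (N : ℕ) : H1K φ N →L[ℝ] L2 (Config N) :=
  (FermiH1.toL2 N).comp (galerkin φ N).subtypeL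

/-- The `L²` inner product on `𝔥¹_K`. -/
def l2inner {φ : OrbitalSet Λ} (Ψ Φ : H1K φ N) : ℝ := inner ℝ (toL2 φ N Ψ) (toL2 φ N Φ)

/-- The continuous dual `(𝔥¹_K)*`. -/
abbrev DualH1K (φ : OrbitalSet Λ) (N : ℕ) : Type := H1K φ N →L[ℝ] ℝ

/-- The Gelfand embedding `𝔥¹_K → (𝔥¹_K)*`, `Ψ ↦ ⟨Ψ, ·⟩` with the `L²` inner product. -/
def gelfand (φ : OrbitalSet Λ) (N : ℕ) (Ψ : H1K φ N) : DualH1K φ N :=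
  (innerSL ℝ (toL2 φ N Ψ)).comp (toL2 φ N)

/-! ### Excitations with respect to a reference state -/

/-- The occupied part of `α` with respect to `r`. -/
def occ (r α : Finset Λ) : Finset Λ := α ∩ r

/-- The virtual part of `α` with respect to `r`. -/
def virt (r α : Finset Λ) : Finset Λ := α \ r

/-- The join `α ∨ β` of the excitation order with respect to `r`. -/
def joinSet (r α β : Finset Λ) : Finset Λ := (occ r α ∩ occ r β) ∪ (virt r α ∪ virt r β)

/-- The pairs `(α, β)` for which the excitation labelled by `α` can be applied to the state `β`:
the edges `(β, α ∨ β)`, with label `α ≠ r`, of the full excitation graph. -/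
def IsEdge (r α β : State Λ N) : Prop :=
  α ≠ r ∧ (occ r.1 α.1 ∪ occ r.1 β.1).card = N ∧ (virt r.1 α.1 ∩ virt r.1 β.1).card = 0

theorem joinSet_card {r α β : State Λ N} (h : IsEdge r α β) :
    (joinSet r.1 α.1 β.1).card = N := by
  obtain ⟨-, h1, h2⟩ := h
  have ha : (occ r.1 α.1).card + (virt r.1 α.1).card = N :=
    (Finset.card_inter_add_card_sdiff α.1 r.1).trans α.2
  have hb : (occ r.1 β.1).card + (virt r.1 β.1).card = N :=
    (Finset.card_inter_add_card_sdiff β.1 r.1).trans β.2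
  have ho := Finset.card_union_add_card_inter (occ r.1 α.1) (occ r.1 β.1)
  have hv := Finset.card_union_add_card_inter (virt r.1 α.1) (virt r.1 β.1)
  have hd : Disjoint (occ r.1 α.1 ∩ occ r.1 β.1) (virt r.1 α.1 ∪ virt r.1 β.1) := by
    rw [Finset.disjoint_left]
    intro p hp hq
    simp only [occ, virt, Finset.mem_inter, Finset.mem_union, Finset.mem_sdiff] at hp hq
    tauto
  rw [joinSet, Finset.card_union_of_disjoint hd]
  omega

/-- The state `α ∨ β`. -/
def join {r α β : State Λ N} (h : IsEdge r α β) : State Λ N :=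
  ⟨joinSet r.1 α.1 β.1, joinSet_card h⟩

/-- The sign of the permutation that sorts the tuple `(A^<, B^<)`, the elements of `A` in
increasing order followed by the elements of `B` in increasing order. -/
def sortSign (A B : Finset Λ) : ℤˣ :=
  Equiv.Perm.sign (Tuple.sort (Fin.append (A.orderEmbOfFin rfl) (B.orderEmbOfFin rfl)))

/-- The sign `σ(α, β)`. The sign of the virtual orbitals is explicit; `ε` fixes the convention for
the orbitals of `r` that are emptied: `ε = 1` if they contribute no sign, and
`ε I J = sortSign I J` for the excitation operators of second quantization, normalized to
`X_α Φ_r = Φ_α`. -/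
def excSign (ε : Finset Λ → Finset Λ → ℤˣ) (r α β : State Λ N) : ℤˣ :=
  sortSign (virt r.1 β.1) (virt r.1 α.1) * ε (r.1 \ α.1) (r.1 \ β.1)

open Classical in
/-- The vector `X_α Φ_β`. -/
def excited (φ : OrbitalSet Λ) (ε : Finset Λ → Finset Λ → ℤˣ) (r α β : State Λ N) : H1K φ N :=
  if h : IsEdge r α β then ((excSign ε r α β : ℤ) : ℝ) • det φ (join h) else 0

/-- `X` is the excitation operator `X_α`, the bounded linear operator on `𝔥¹_K` with the prescribed
values on the Slater determinants. -/
def IsExcitationOp (φ : OrbitalSet Λ) (ε : Finset Λ → Finset Λ → ℤˣ) (r α : State Λ N)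
    (X : H1K φ N →L[ℝ] H1K φ N) : Prop :=
  ∀ β : State Λ N, X (det φ β) = excited φ ε r α β

/-- The space of cluster operators: the closure, in the operator norm of bounded operators on
`𝔥¹_K`, of the linear span of the excitation operators `X_α`, `α ≠ r`. -/
def clusterOps (φ : OrbitalSet Λ) (ε : Finset Λ → Finset Λ → ℤˣ) (r : State Λ N) :
    Submodule ℝ (H1K φ N →L[ℝ] H1K φ N) :=
  (Submodule.span ℝ {X | ∃ α : State Λ N, α ≠ r ∧ IsExcitationOp φ ε r α X}).topologicalClosure

/-- The labels of the excitations: all states other than the reference `r`. -/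
abbrev Excitation (r : State Λ N) : Type _ := {α : State Λ N // α ≠ r}

/-- The amplitude space: the square summable families `t` for which the function
`T Φ_r = ∑_α t_α Φ_α` (convergent in `L²`) belongs to `𝔥¹_K`. -/
def amplitudes (φ : OrbitalSet Λ) (r : State Λ N) :
    Submodule ℝ (lp (fun _ : Excitation r => ℝ) 2) where
  carrier := {t | ∃ Θ : H1K φ N, HasSum (fun α => t α • toL2 φ N (det φ α.1)) (toL2 φ N Θ)}
  add_mem' := by
    rintro s t ⟨Θ, hs⟩ ⟨Θ', ht⟩
    refine ⟨Θ + Θ', ?_⟩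
    simpa [add_smul] using hs.add ht
  zero_mem' := ⟨0, by simp⟩
  smul_mem' := by
    rintro c t ⟨Θ, ht⟩
    refine ⟨c • Θ, ?_⟩
    simpa [mul_smul] using ht.const_smul c

/-- `T = ∑_α t_α X_α`: `T` is the cluster operator with the amplitudes `t`. The sum is evaluated
on the Slater determinants and converges in `L²`. -/
structure IsClusterOp (φ : OrbitalSet Λ) (ε : Finset Λ → Finset Λ → ℤˣ) (r : State Λ N)
    (t : lp (fun _ : Excitation r => ℝ) 2) (T : H1K φ N →L[ℝ] H1K φ N) : Prop where
  mem : T ∈ clusterOps φ ε r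
  hasSum : ∀ β : State Λ N,
    HasSum (fun α => t α • toL2 φ N (excited φ ε r α.1 β)) (toL2 φ N (T (det φ β)))

/-- `B` is the extension of `A : 𝔥¹_K → 𝔥¹_K` to a bounded operator on `(𝔥¹_K)*`, where `𝔥¹_K` is
regarded as a (dense) subspace of its dual by the Gelfand embedding. -/
def IsDualExtension {φ : OrbitalSet Λ} (A : H1K φ N →L[ℝ] H1K φ N)
    (B : DualH1K φ N →L[ℝ] DualH1K φ N) : Prop :=
  ∀ Ψ : H1K φ N, B (gelfand φ N Ψ) = gelfand φ N (A Ψ)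

/-! ### The equations -/

/-- `Ψ` and `E` satisfy the projected Schrödinger equation `⟨HΨ, Φ⟩ = E ⟨Ψ, Φ⟩` for all
`Φ ∈ 𝔥¹_K`. -/
def ProjectedSchrodinger {φ : OrbitalSet Λ} (H : H1K φ N →L[ℝ] DualH1K φ N) (Ψ : H1K φ N)
    (E : ℝ) : Prop :=
  ∀ Φ : H1K φ N, H Ψ Φ = E * l2inner Ψ Φ

/-- Full CC: `Ψ = e^T Φ_r` for some amplitudes `t`, with `⟨e^{-T} H e^T Φ_r, S Φ_r⟩ = 0` for all
amplitudes `s`, and `E = ⟨e^{-T} H e^T Φ_r, Φ_r⟩`. Here `T` and `S` are the cluster operators with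
the amplitudes `t` and `s`, and `B` is the extension of `e^{-T}` to the dual space; all of them are
uniquely determined, and their existence is part of the claim. The exponential series is a finite
sum, as cluster operators are nilpotent. -/
def FullCC {φ : OrbitalSet Λ} (ε : Finset Λ → Finset Λ → ℤˣ) (r : State Λ N)
    (H : H1K φ N →L[ℝ] DualH1K φ N) (Ψ : H1K φ N) (E : ℝ) : Prop :=
  ∃ t ∈ amplitudes φ r, ∃ (T : H1K φ N →L[ℝ] H1K φ N) (B : DualH1K φ N →L[ℝ] DualH1K φ N),
    IsClusterOp φ ε r t T ∧ IsDualExtension (NormedSpace.exp (-T)) B ∧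
    Ψ = NormedSpace.exp T (det φ r) ∧
    (∀ s ∈ amplitudes φ r, ∃ S : H1K φ N →L[ℝ] H1K φ N, IsClusterOp φ ε r s S ∧
      B (H (NormedSpace.exp T (det φ r))) (S (det φ r)) = 0) ∧
    E = B (H (NormedSpace.exp T (det φ r))) (det φ r)

/-- The CI energy `⟨H (I + C) Φ_r, Φ_r⟩`. -/
def ciEnergy {φ : OrbitalSet Λ} (r : State Λ N) (H : H1K φ N →L[ℝ] DualH1K φ N)
    (C : H1K φ N →L[ℝ] H1K φ N) : ℝ :=
  H ((1 + C) (det φ r)) (det φ r)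

/-- Full CI: `Ψ = (I + C) Φ_r` for some amplitudes `c`, with
`⟨H (I + C) Φ_r, S Φ_r⟩ = E_CI ⟨(I + C) Φ_r, S Φ_r⟩` for all amplitudes `s`, and `E = E_CI`. -/
def FullCI {φ : OrbitalSet Λ} (ε : Finset Λ → Finset Λ → ℤˣ) (r : State Λ N)
    (H : H1K φ N →L[ℝ] DualH1K φ N) (Ψ : H1K φ N) (E : ℝ) : Prop :=
  ∃ c ∈ amplitudes φ r, ∃ C : H1K φ N →L[ℝ] H1K φ N,
    IsClusterOp φ ε r c C ∧ Ψ = (1 + C) (det φ r) ∧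
    (∀ s ∈ amplitudes φ r, ∃ S : H1K φ N →L[ℝ] H1K φ N, IsClusterOp φ ε r s S ∧
      H ((1 + C) (det φ r)) (S (det φ r))
        = ciEnergy r H C * l2inner ((1 + C) (det φ r)) (S (det φ r))) ∧
    E = ciEnergy r H C

end CoupledCluster

end

open CoupledCluster

noncomputable section

namespace CoupledCluster

variable {Λ : Type*} [LinearOrder Λ] {N : ℕ}

set_option linter.unusedSectionVars false

/-! ### Inner products of Slater determinants -/

/-! The analytic core is that `T x`, the cluster operator with `T x Φ_r = x` for `x` orthogonal in
`L²` to `Φ_r`, is bounded on `H¹` together with its `L²` adjoint, with norms controlled by the `H¹`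
norm of `x`. On finite combinations of determinants the squared `H¹` norm is `∑ c_α²` plus the
squared norm of the gradient `∑ a_p c ⊗ ∇φ_p`, where `a_p` annihilates `p` (`inner_det`,
`norm_synth_sq`). Splitting a state into the orbitals vacated in `r` and its virtual orbitals gives
finitely many blocks. The occupied part of the gradient is controlled by the `L²` norm, because `r`
is finite, so the norm is equivalent to the sum of the Sobolev norms of the blocks
(`sum_density_block_bounds`).

On blocks, cluster operators act by exterior products (`block_bilCoeff`) and their adjoints by
contractions (`block_adjCoeff`). Annihilation is a graded derivation of the exterior product
(`ann_wedge`) and commutes with contraction up to sign (`ann_contract`). Since there are at most `N`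
virtual orbitals, Cauchy–Schwarz over the at most `2 ^ N` splittings of a virtual set gives bounds
independent of the number of orbitals (`energy_wedge_le`, `energy_contract_le`). The same argument
with zero gradients gives the `L²` bound. Density of the finite combinations yields the bilinear
maps of `exists_isClusterMap`.

The rest is algebra. Excitations strictly raise the number of virtual orbitals, which is at most
`N`. Hence the map `x ↦ Ψ - (exp (T x) Φ_r - T x Φ_r)` improves the agreement of two arguments by
one rank, and its iterates become stationary at a solution of `exp (T x) Φ_r = Ψ`
(`IsClusterMap.exists_exp_eq`); commutativity of the excitation operators plays no role. The
extension of `e^{-T}` to the dual is composition with the exponential of the negative adjoint, an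
invertible change of test function. So the Schrödinger equation says that `e^{-T} H e^T Φ_r` is the
functional `E ⟨Φ_r, ·⟩`, and full CC tests this on `Φ_r` and on its `L²` complement, which consists
of the functions `S Φ_r`. Full CI tests the untransformed equation in the same way, with `C = T (Ψ -
Φ_r)`. -/

theorem HasWeakDeriv.unique {u w w' : L2 (Config N)} {v : Config N} (h : HasWeakDeriv u w v)
    (h' : HasWeakDeriv u w' v) : w = w' := by
  have loc : ∀ z : L2 (Config N), LocallyIntegrable z volume := fun z =>
    (Lp.memLp z).locallyIntegrable (by norm_num)
  refine Lp.ext (ae_eq_of_integral_contDiff_smul_eq (loc w) (loc w') fun ψ hψ hc => ?_)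
  have h1 := h ψ hψ hc
  have h2 := h' ψ hψ hc
  simp only [smul_eq_mul, mul_comm (ψ _)]
  linarith

theorem sobolev_ext {U V : PiLp 2 (fun _ : Option (Fin N × Fin 3) => L2 (Config N))}
    (hU : U ∈ sobolev (configAxis N)) (hV : V ∈ sobolev (configAxis N))
    (h : U none = V none) : U = V := by
  ext1 o
  cases o with
  | none => exact h
  | some kc => exact (hU kc).unique (h ▸ hV kc)

/-- Weak derivatives are determined by the function, so identities in `𝔥¹` may be checked in `L²`.
-/
theorem FermiH1.toL2_injective : Function.Injective (FermiH1.toL2 N) := fun U V h =>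
  Subtype.ext (sobolev_ext U.2.1 V.2.1 h)

theorem inner_tensor (f g : Fin N → L2 R3) :
    inner ℝ (tensor f) (tensor g) = ∏ j, inner ℝ (f j) (g j) := by
  simp only [L2.inner_def]
  rw [← integral_fintype_prod_volume_eq_prod (fun j x => inner ℝ (f j x) (g j x))]
  refine integral_congr_ae ?_
  filter_upwards [tensor_coe f, tensor_coe g] with X h1 h2
  rw [h1, h2]
  simp [Finset.prod_mul_distrib]

/-- The antisymmetrized sum `N!^{-1/2} ∑ σ, sgn σ • a_σ(1) ⊗ ⋯ ⊗ a_σ(N)`. -/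
def antisymmSum (a : Equiv.Perm (Fin N) → Fin N → L2 R3) : L2 (Config N) :=
  (Real.sqrt (N.factorial : ℝ))⁻¹ •
    ∑ σ : Equiv.Perm (Fin N), ((Equiv.Perm.sign σ : ℤ) : ℝ) • tensor (a σ)

/-- The factors may depend on the permutation in an arbitrary way. This covers the weak derivatives
of a determinant, where the slot of the differentiated particle holds the derivative of whichever
orbital sits there. -/
theorem inner_antisymmSum (a b : Equiv.Perm (Fin N) → Fin N → L2 R3) :
    inner ℝ (antisymmSum a) (antisymmSum b) = (N.factorial : ℝ)⁻¹ *
      ∑ σ : Equiv.Perm (Fin N), ((Equiv.Perm.sign σ : ℤ) : ℝ) *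
        ∑ τ : Equiv.Perm (Fin N), ((Equiv.Perm.sign τ : ℤ) : ℝ) *
          ∏ j, inner ℝ (a σ j) (b τ j) := by
  have h : (Real.sqrt (N.factorial : ℝ))⁻¹ * (Real.sqrt (N.factorial : ℝ))⁻¹
      = (N.factorial : ℝ)⁻¹ := by
    rw [← mul_inv, Real.mul_self_sqrt (Nat.cast_nonneg _)]
  rw [antisymmSum, antisymmSum, real_inner_smul_left, real_inner_smul_right, ← mul_assoc, h]
  simp only [sum_inner, inner_sum, real_inner_smul_left, real_inner_smul_right, inner_tensor,
    Finset.mul_sum]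
  rw [Finset.sum_comm]
  refine Finset.sum_congr rfl fun σ _ => Finset.sum_congr rfl fun τ _ => ?_
  ring

/-- `slaterH1` is a choice of which only the `L²` class is known. The antisymmetrized product rule
gives a Sobolev element with the same function, and uniqueness of weak derivatives identifies the
two. -/
theorem slaterH1_fn_deriv (f : Fin N → OneH1) :
    (slaterH1 f).1 none = antisymmSum (fun σ j => (f (σ j)).fn) ∧
    ∀ k c, (slaterH1 f).1 (some (k, c)) = antisymmSum
      (fun σ => Function.update (fun j => (f (σ j)).fn) k ((f (σ k)).1 (some c))) := by
  have hT : ∀ g : Fin N → OneH1, (WithLp.toLp 2 (fun o : Option (Fin N × Fin 3) => match o with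
      | none => tensor (fun j => (g j).fn)
      | some kc => tensor (Function.update (fun j => (g j).fn) kc.1 ((g kc.1).1 (some kc.2))))
      : PiLp 2 (fun _ : Option (Fin N × Fin 3) => L2 (Config N))) ∈ sobolev (configAxis N) :=
    fun g kc => HasWeakDeriv.tensor (fun j => (g j).fn) kc.1 ((g kc.1).2 kc.2)
  have hV : ((Real.sqrt (N.factorial : ℝ))⁻¹ •
      ∑ σ : Equiv.Perm (Fin N), ((Equiv.Perm.sign σ : ℤ) : ℝ) •
        (WithLp.toLp 2 (fun o : Option (Fin N × Fin 3) => match o with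
      | none => tensor (fun j => (f (σ j)).fn)
      | some kc => tensor (Function.update (fun j => (f (σ j)).fn) kc.1
          ((f (σ kc.1)).1 (some kc.2))))
      : PiLp 2 (fun _ : Option (Fin N × Fin 3) => L2 (Config N)))) ∈ sobolev (configAxis N) :=
    Submodule.smul_mem _ _ (Submodule.sum_mem _ fun σ _ =>
      Submodule.smul_mem _ _ (hT fun j => f (σ j)))
  have h0 : (slaterH1 f).1 none = antisymmSum (fun σ j => (f (σ j)).fn) := by
    refine Lp.ext ((slaterH1_spec f).trans ?_)
    have h1 : ∀ᵐ X : Config N, ∀ σ : Equiv.Perm (Fin N),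
        (((Equiv.Perm.sign σ : ℤ) : ℝ) • tensor (fun j => (f (σ j)).fn)) X
          = ((Equiv.Perm.sign σ : ℤ) : ℝ) * ∏ j, (f (σ j)).fn (X j) := by
      rw [ae_all_iff]
      intro σ
      filter_upwards [Lp.coeFn_smul ((Equiv.Perm.sign σ : ℤ) : ℝ) (tensor (fun j => (f (σ j)).fn)),
        tensor_coe (fun j => (f (σ j)).fn)] with X h1 h2
      rw [h1, Pi.smul_apply, h2, smul_eq_mul]
    filter_upwards [h1, Lp.coeFn_smul (Real.sqrt (N.factorial : ℝ))⁻¹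
        (∑ σ : Equiv.Perm (Fin N), ((Equiv.Perm.sign σ : ℤ) : ℝ) •
          tensor (fun j => (f (σ j)).fn)),
      Lp.coeFn_finsetSum (Finset.univ : Finset (Equiv.Perm (Fin N)))
        (fun σ => ((Equiv.Perm.sign σ : ℤ) : ℝ) • tensor (fun j => (f (σ j)).fn))]
      with X a1 a2 a3
    rw [antisymmSum, a2, Pi.smul_apply, a3, slaterFun, Matrix.det_apply', smul_eq_mul]
    simp only [a1, Finset.sum_apply, Matrix.of_apply]
  have key := sobolev_ext (slaterH1 f).2.1 hV (by
    rw [h0, antisymmSum]; simp)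
  refine ⟨h0, fun k c => ?_⟩
  rw [key, antisymmSum]
  simp

theorem sum_sign_mul_prod (G : Matrix (Fin N) (Fin N) ℝ) :
    ∑ τ : Equiv.Perm (Fin N), ((Equiv.Perm.sign τ : ℤ) : ℝ) * ∏ j, G j (τ j) = G.det := by
  rw [← Matrix.det_transpose, Matrix.det_apply']
  rfl

/-- For each `σ` the sum over `τ` is the Gram determinant with permuted rows. The two signs of `σ`
cancel, so all `N!` terms agree. -/
theorem inner_slaterFn (f g : Fin N → OneH1) :
    inner ℝ ((slaterH1 f).1 none) ((slaterH1 g).1 none)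
      = (Matrix.of fun i j => inner ℝ (f i).fn (g j).fn).det := by
  rw [(slaterH1_fn_deriv f).1, (slaterH1_fn_deriv g).1, inner_antisymmSum]
  set G := Matrix.of fun i j => inner ℝ (f i).fn (g j).fn
  have h : ∀ σ : Equiv.Perm (Fin N), ((Equiv.Perm.sign σ : ℤ) : ℝ) *
        ∑ τ : Equiv.Perm (Fin N), ((Equiv.Perm.sign τ : ℤ) : ℝ) *
          ∏ j, inner ℝ ((f (σ j)).fn) ((g (τ j)).fn) = G.det := by
    intro σ
    have := sum_sign_mul_prod (G.submatrix σ id)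
    rw [Matrix.det_permute] at this
    refine (congrArg (((Equiv.Perm.sign σ : ℤ) : ℝ) * ·) this).trans ?_
    change ((Equiv.Perm.sign σ : ℤ) : ℝ) * (((Equiv.Perm.sign σ : ℤ) : ℝ) * G.det) = G.det
    rw [← mul_assoc, ← Int.cast_mul, Int.units_coe_mul_self, Int.cast_one, one_mul]
  simp only [h, Finset.sum_const, Finset.card_univ, Fintype.card_perm, Fintype.card_fin,
    nsmul_eq_mul]
  rw [← mul_assoc, inv_mul_cancel₀ (by positivity), one_mul]

/-- For fixed `σ`, differentiating particle `k` replaces row `σ k` of the Gram matrix. Summed over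
the particles, every row is replaced once, whatever `σ` is. -/
theorem sum_inner_slaterDeriv (f g : Fin N → OneH1) (c : Fin 3) :
    ∑ k, inner ℝ ((slaterH1 f).1 (some (k, c))) ((slaterH1 g).1 (some (k, c)))
      = ∑ i, ((Matrix.of fun i j => inner ℝ (f i).fn (g j).fn).updateRow i
          fun j => inner ℝ ((f i).1 (some c)) ((g j).1 (some c))).det := by
  simp only [(slaterH1_fn_deriv f).2, (slaterH1_fn_deriv g).2, inner_antisymmSum]
  set G := Matrix.of fun i j => inner ℝ (f i).fn (g j).fn with hG
  set D : Fin N → ℝ := fun i =>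
    (G.updateRow i fun j => inner ℝ ((f i).1 (some c)) ((g j).1 (some c))).det with hD
  have h : ∀ (k : Fin N) (σ : Equiv.Perm (Fin N)), ((Equiv.Perm.sign σ : ℤ) : ℝ) *
        ∑ τ : Equiv.Perm (Fin N), ((Equiv.Perm.sign τ : ℤ) : ℝ) *
          ∏ j, inner ℝ (Function.update (fun j => (f (σ j)).fn) k ((f (σ k)).1 (some c)) j)
            (Function.update (fun j => (g (τ j)).fn) k ((g (τ k)).1 (some c)) j)
        = D (σ k) := by
    intro k σ
    have := sum_sign_mul_prod ((G.updateRow (σ k)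
      fun j => inner ℝ ((f (σ k)).1 (some c)) ((g j).1 (some c))).submatrix σ id)
    rw [Matrix.det_permute] at this
    have e : ∀ τ : Equiv.Perm (Fin N),
        ∏ j, inner ℝ (Function.update (fun j => (f (σ j)).fn) k ((f (σ k)).1 (some c)) j)
            (Function.update (fun j => (g (τ j)).fn) k ((g (τ k)).1 (some c)) j)
        = ∏ j, ((G.updateRow (σ k)
      fun j => inner ℝ ((f (σ k)).1 (some c)) ((g j).1 (some c))).submatrix σ id) j (τ j) := by
      intro τ
      refine Finset.prod_congr rfl fun j _ => ?_
      by_cases hj : j = k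
      · subst hj
        simp
      · rw [Function.update_of_ne hj, Function.update_of_ne hj, Matrix.submatrix_apply,
          Matrix.updateRow_ne (fun h => hj (σ.injective h))]
        rfl
    simp only [e]
    refine (congrArg (((Equiv.Perm.sign σ : ℤ) : ℝ) * ·) this).trans ?_
    change ((Equiv.Perm.sign σ : ℤ) : ℝ) * (((Equiv.Perm.sign σ : ℤ) : ℝ) * D (σ k)) = D (σ k)
    rw [← mul_assoc, ← Int.cast_mul, Int.units_coe_mul_self, Int.cast_one, one_mul]
  simp only [h]
  rw [← Finset.mul_sum, Finset.sum_comm]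
  have h2 : ∀ σ : Equiv.Perm (Fin N), ∑ k, D (σ k) = ∑ i, D i := fun σ => Equiv.sum_comp σ D
  simp only [h2, Finset.sum_const, Finset.card_univ, Fintype.card_perm, Fintype.card_fin,
    nsmul_eq_mul]
  rw [← mul_assoc, inv_mul_cancel₀ (by positivity), one_mul]

/-- The weak gradient of an orbital. -/
def OrbitalSet.grad (φ : OrbitalSet Λ) (p : Λ) : PiLp 2 (fun _ : Fin 3 => L2 R3) :=
  WithLp.toLp 2 fun c => (φ.orb p).1 (some c)

/-- `∏ (a ∈ A) (b ∈ B), ±1` with a factor `-1` for each pair with `b < a`. -/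
def crossSign (A B : Finset Λ) : ℝ := ∏ a ∈ A, ∏ b ∈ B, if b < a then -1 else 1

/-- Increasing enumerations of the same set coincide, which gives the identity matrix. For different
sets, counting produces an `a i` that is no `b j`, hence a zero row. -/
theorem det_indicator {n : ℕ} {a b : Fin n → Λ} (ha : StrictMono a) (hb : StrictMono b) :
    (Matrix.of fun i j => if a i = b j then (1 : ℝ) else 0).det
      = if Set.range a = Set.range b then 1 else 0 := by
  split_ifs with h
  · have : a = b := (ha.range_inj hb).1 h
    subst this
    have : (Matrix.of fun i j => if a i = a j then (1 : ℝ) else 0) = 1 := by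
      ext i j
      simp [Matrix.one_apply, ha.injective.eq_iff]
    rw [this, Matrix.det_one]
  · have : ∃ i, ∀ j, a i ≠ b j := by
      by_contra! hc
      choose s hs using hc
      have hi : Function.Injective s := fun i j hij => ha.injective (by rw [hs, hs, hij])
      have hsurj := Finite.injective_iff_surjective.1 hi
      refine h (Set.Subset.antisymm ?_ ?_)
      · rintro _ ⟨i, rfl⟩
        exact ⟨s i, (hs i).symm⟩
      · rintro _ ⟨j, rfl⟩
        obtain ⟨i, rfl⟩ := hsurj j
        exact ⟨i, hs i⟩
    obtain ⟨i, hi⟩ := this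
    exact Matrix.det_eq_zero_of_row_eq_zero i fun j => by simp [hi j]

theorem range_orderEmb_succAbove {n : ℕ} (α : State Λ (n + 1)) (i : Fin (n + 1)) :
    Set.range (α.1.orderEmbOfFin α.2 ∘ i.succAbove)
      = (α.1.erase (α.1.orderEmbOfFin α.2 i) : Finset Λ) := by
  rw [Set.range_comp, Fin.range_succAbove, Set.image_compl_eq_range_sdiff_image
    (α.1.orderEmbOfFin α.2).injective, Finset.range_orderEmbOfFin, Set.image_singleton,
    Finset.coe_erase]

/-- Exactly `n - i` elements of an increasingly enumerated set of size `n + 1` lie above the one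
with index `i`. This turns cofactor signs into annihilation signs. -/
theorem crossSign_erase {n : ℕ} (α : State Λ (n + 1)) (i : Fin (n + 1)) :
    crossSign (α.1.erase (α.1.orderEmbOfFin α.2 i)) {α.1.orderEmbOfFin α.2 i}
      = (-1) ^ (n - i : ℕ) := by
  have h : α.1 = Finset.univ.map (α.1.orderEmbOfFin α.2).toEmbedding := by
    simp
  have h2 : crossSign (α.1.erase (α.1.orderEmbOfFin α.2 i)) {α.1.orderEmbOfFin α.2 i}
      = ∏ a ∈ α.1, if α.1.orderEmbOfFin α.2 i < a then (-1 : ℝ) else 1 := by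
    simp only [crossSign, Finset.prod_singleton]
    refine Finset.prod_erase _ (by simp)
  rw [h2]
  conv_lhs => enter [1]; rw [h]
  rw [Finset.prod_map]
  simp only [RelEmbedding.coe_toEmbedding, OrderEmbedding.lt_iff_lt]
  rw [Finset.prod_ite]
  simp only [Finset.prod_const, one_pow, mul_one]
  congr 1
  have : (Finset.univ.filter fun j => i < j) = Finset.Ioi i := by ext; simp
  rw [this, Fin.card_Ioi]
  omega

theorem l2inner_det (φ : OrbitalSet Λ) (α β : State Λ N) :
    l2inner (det φ α) (det φ β) = if α = β then 1 else 0 := by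
  refine (inner_slaterFn _ _).trans ?_
  have h := orthonormal_iff_ite.1 φ.orthonormal
  simp only [h]
  rw [det_indicator (α.1.orderEmbOfFin α.2).strictMono (β.1.orderEmbOfFin β.2).strictMono]
  simp [Finset.range_orderEmbOfFin, Subtype.ext_iff]

/-- Laplace expansion along the replaced row leaves minors that are overlaps of determinants with
one orbital removed. The gradient part is therefore `∑ ⟨∇φ_p, ∇φ_q⟩ ⟨a_p Φ_α, a_q Φ_β⟩`, the
second-quantized Laplacian. -/
theorem inner_det (φ : OrbitalSet Λ) (hN : 1 ≤ N) (α β : State Λ N) :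
    inner ℝ (det φ α) (det φ β) = (if α = β then 1 else 0) + ∑ p ∈ α.1, ∑ q ∈ β.1,
      if α.1.erase p = β.1.erase q then crossSign (α.1.erase p) {p} * crossSign (β.1.erase q) {q}
        * inner ℝ (φ.grad p) (φ.grad q) else 0 := by
  obtain ⟨n, rfl⟩ : ∃ n, N = n + 1 := ⟨N - 1, by omega⟩
  have h0 : inner ℝ (det φ α) (det φ β) = l2inner (det φ α) (det φ β) +
      ∑ c, ∑ k, inner ℝ ((slater φ α).1 (some (k, c))) ((slater φ β).1 (some (k, c))) := by
    have : inner ℝ (det φ α) (det φ β) = inner ℝ (slater φ α).1 (slater φ β).1 := rfl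
    rw [this, PiLp.inner_apply, Fintype.sum_option, Fintype.sum_prod_type, Finset.sum_comm]
    rfl
  rw [h0, l2inner_det]
  congr 1
  simp only [slater, sum_inner_slaterDeriv]
  have ho := orthonormal_iff_ite.1 φ.orthonormal
  simp only [ho]
  have hα : ∀ F : Λ → ℝ, ∑ p ∈ α.1, F p = ∑ i, F (α.1.orderEmbOfFin α.2 i) := by
    intro F
    conv_lhs => rw [← Finset.map_orderEmbOfFin_univ α.1 α.2]
    rw [Finset.sum_map]
    rfl
  have hβ : ∀ F : Λ → ℝ, ∑ p ∈ β.1, F p = ∑ i, F (β.1.orderEmbOfFin β.2 i) := by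
    intro F
    conv_lhs => rw [← Finset.map_orderEmbOfFin_univ β.1 β.2]
    rw [Finset.sum_map]
    rfl
  rw [hα, Finset.sum_comm]
  refine Finset.sum_congr rfl fun i _ => ?_
  rw [hβ]
  simp only [Matrix.det_succ_row _ i, Matrix.submatrix_updateRow_succAbove, Matrix.updateRow_self]
  rw [Finset.sum_comm]
  refine Finset.sum_congr rfl fun j _ => ?_
  have hd : ((Matrix.of fun i j => if (α.1.orderEmbOfFin α.2 i) = (β.1.orderEmbOfFin β.2 j)
      then (1 : ℝ) else 0).submatrix i.succAbove j.succAbove).det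
      = if α.1.erase (α.1.orderEmbOfFin α.2 i) = β.1.erase (β.1.orderEmbOfFin β.2 j)
        then 1 else 0 := by
    refine (det_indicator
      ((α.1.orderEmbOfFin α.2).strictMono.comp (Fin.strictMono_succAbove i))
      ((β.1.orderEmbOfFin β.2).strictMono.comp (Fin.strictMono_succAbove j))).trans ?_
    rw [range_orderEmb_succAbove, range_orderEmb_succAbove]
    simp only [Finset.coe_inj]
  rw [hd, crossSign_erase, crossSign_erase]
  -- The cofactor sign splits into the annihilation signs of the two states, since `(n - i) + (n -
  -- j)` and `i + j` have the same parity.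
  have hs : ((-1 : ℝ)) ^ (i + j : ℕ) = (-1) ^ (n - i : ℕ) * (-1) ^ (n - j : ℕ) := by
    have e : (n - i : ℕ) + (n - j : ℕ) + 2 * (i + j) = (i + j : ℕ) + 2 * n := by
      have := i.2; have := j.2; omega
    have := congrArg (fun m : ℕ => (-1 : ℝ) ^ m) e
    simp only [pow_add, pow_mul] at this
    norm_num at this
    rw [pow_add, this]
  rw [← hs]
  split_ifs
  · simp only [mul_one, OrbitalSet.grad, PiLp.inner_apply, Finset.mul_sum]
  · simp

/-! ### Signs -/

/-- The inverse of the sorting permutation ranks the entries by value, so its inversions are those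
of `f`. -/
theorem sign_sort_eq {n : ℕ} {f : Fin n → Λ} (hf : Function.Injective f) :
    ((Equiv.Perm.sign (Tuple.sort f) : ℤ) : ℝ)
      = ∏ i, ∏ j, if i < j ∧ f j < f i then (-1 : ℝ) else 1 := by
  have hm : StrictMono (f ∘ Tuple.sort f) :=
    (Tuple.monotone_sort f).strictMono_of_injective (hf.comp (Tuple.sort f).injective)
  have h : ∀ i j, (Tuple.sort f)⁻¹ i < (Tuple.sort f)⁻¹ j ↔ f i < f j := by
    intro i j
    rw [← hm.lt_iff_lt]
    simp
  rw [← Equiv.Perm.sign_inv, Equiv.Perm.sign_eq_prod_prod_Ioi]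
  push_cast
  simp only [h]
  refine Finset.prod_congr rfl fun i _ => ?_
  rw [← Finset.prod_subset (Finset.subset_univ (Finset.Ioi i))]
  · refine Finset.prod_congr rfl fun j hj => ?_
    have hij : i < j := Finset.mem_Ioi.1 hj
    rcases lt_or_gt_of_ne (hf.ne hij.ne) with h | h
    · simp [h, h.not_gt]
    · simp [h, h.not_gt, hij]
  · intro j _ hj
    rw [if_neg fun h => hj (Finset.mem_Ioi.2 h.1)]

/-- Both halves of the tuple are increasing, so inversions occur only between an element of `A` and
one of `B`. -/
theorem sortSign_eq_crossSign {A B : Finset Λ} (h : Disjoint A B) :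
    ((sortSign A B : ℤ) : ℝ) = crossSign A B := by
  have hinj : Function.Injective
      (Fin.append (A.orderEmbOfFin rfl) (B.orderEmbOfFin rfl)) := by
    rw [Fin.append_injective_iff]
    refine ⟨(A.orderEmbOfFin rfl).injective, (B.orderEmbOfFin rfl).injective, fun i j hij => ?_⟩
    exact Finset.disjoint_left.1 h (Finset.orderEmbOfFin_mem A rfl i)
      (hij ▸ Finset.orderEmbOfFin_mem B rfl j)
  rw [sortSign, sign_sort_eq hinj, Fin.prod_univ_add]
  have e1 : ∀ i : Fin A.card, (∏ j, if Fin.castAdd B.card i < j ∧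
      Fin.append (A.orderEmbOfFin rfl) (B.orderEmbOfFin rfl) j
        < Fin.append (A.orderEmbOfFin rfl) (B.orderEmbOfFin rfl) (Fin.castAdd B.card i)
      then (-1 : ℝ) else 1) = ∏ b ∈ B, if b < A.orderEmbOfFin rfl i then (-1 : ℝ) else 1 := by
    intro i
    rw [Fin.prod_univ_add, Finset.prod_eq_one, one_mul]
    · conv_rhs => rw [← Finset.map_orderEmbOfFin_univ B rfl]
      rw [Finset.prod_map]
      refine Finset.prod_congr rfl fun j _ => ?_
      have : Fin.castAdd B.card i < Fin.natAdd A.card j := by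
        simp only [Fin.lt_def, Fin.val_castAdd, Fin.val_natAdd]; omega
      simp [this]
    · intro j _
      rw [if_neg]
      rintro ⟨h1, h2⟩
      simp only [Fin.append_left, OrderEmbedding.lt_iff_lt] at h2
      simp only [Fin.lt_def, Fin.val_castAdd] at h1 h2
      omega
  have e2 : ∀ i : Fin B.card, (∏ j, if Fin.natAdd A.card i < j ∧
      Fin.append (A.orderEmbOfFin rfl) (B.orderEmbOfFin rfl) j
        < Fin.append (A.orderEmbOfFin rfl) (B.orderEmbOfFin rfl) (Fin.natAdd A.card i)
      then (-1 : ℝ) else 1) = 1 := by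
    intro i
    rw [Fin.prod_univ_add, Finset.prod_eq_one, Finset.prod_eq_one, one_mul]
    · intro j _
      rw [if_neg]
      rintro ⟨h1, h2⟩
      simp only [Fin.append_right, OrderEmbedding.lt_iff_lt] at h2
      simp only [Fin.lt_def, Fin.val_natAdd] at h1 h2
      omega
    · intro j _
      rw [if_neg]
      rintro ⟨h1, -⟩
      simp only [Fin.lt_def, Fin.val_natAdd, Fin.val_castAdd] at h1
      omega
  simp only [e1, e2, Finset.prod_const_one, mul_one, crossSign]
  conv_rhs => rw [← Finset.map_orderEmbOfFin_univ A rfl]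
  rw [Finset.prod_map]
  rfl

/-! ### Multiplicativity of the crossing sign. -/

@[simp] theorem crossSign_empty_left (B : Finset Λ) : crossSign ∅ B = 1 := by simp [crossSign]

@[simp] theorem crossSign_empty_right (B : Finset Λ) : crossSign B ∅ = 1 := by simp [crossSign]

theorem crossSign_union_left {A A' : Finset Λ} (B : Finset Λ) (h : Disjoint A A') :
    crossSign (A ∪ A') B = crossSign A B * crossSign A' B := Finset.prod_union h

theorem crossSign_union_right (A : Finset Λ) {B B' : Finset Λ} (h : Disjoint B B') :
    crossSign A (B ∪ B') = crossSign A B * crossSign A B' := by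
  simp only [crossSign, Finset.prod_union h, Finset.prod_mul_distrib]

theorem crossSign_insert_left {p : Λ} {A : Finset Λ} (B : Finset Λ) (h : p ∉ A) :
    crossSign (insert p A) B = crossSign {p} B * crossSign A B := by
  rw [Finset.insert_eq, crossSign_union_left _ (Finset.disjoint_singleton_left.2 h)]

theorem crossSign_insert_right {p : Λ} (A : Finset Λ) {B : Finset Λ} (h : p ∉ B) :
    crossSign A (insert p B) = crossSign A {p} * crossSign A B := by
  rw [Finset.insert_eq, crossSign_union_right _ (Finset.disjoint_singleton_left.2 h)]

theorem crossSign_mul_self (A B : Finset Λ) : crossSign A B * crossSign A B = 1 := by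
  simp only [crossSign, ← Finset.prod_mul_distrib]
  refine Finset.prod_eq_one fun a _ => Finset.prod_eq_one fun b _ => ?_
  split_ifs <;> norm_num

theorem crossSign_sq (A B : Finset Λ) : crossSign A B ^ 2 = 1 := by
  rw [sq, crossSign_mul_self]

/-- Each pair of `p` and an element of `B` contributes `-1` to exactly one of the two crossing
signs. -/
theorem crossSign_swap {p : Λ} {B : Finset Λ} (h : p ∉ B) :
    crossSign {p} B = (-1) ^ B.card * crossSign B {p} := by
  have : crossSign {p} B * crossSign B {p} = (-1) ^ B.card := by
    simp only [crossSign, Finset.prod_singleton, ← Finset.prod_mul_distrib]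
    rw [← Finset.prod_const]
    refine Finset.prod_congr rfl fun b hb => ?_
    have hne : b ≠ p := fun e => h (e ▸ hb)
    rcases lt_or_gt_of_ne hne with h | h <;> simp [h, h.not_gt]
  rw [← this, mul_assoc, crossSign_mul_self, mul_one]

theorem crossSign_eq_one {A B : Finset Λ} (h : ∀ a ∈ A, ∀ b ∈ B, a < b) : crossSign A B = 1 :=
  Finset.prod_eq_one fun a ha => Finset.prod_eq_one fun b hb => if_neg (h a ha b hb).not_gt

/-! ### Annihilation, exterior product and contraction of coefficient families -/

/-- The annihilation operator of the orbital `p`. -/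
def ann (p : Λ) (f : Finset Λ → ℝ) (V : Finset Λ) : ℝ :=
  if p ∈ V then 0 else crossSign V {p} * f (insert p V)

/-- The exterior product. -/
def wedge (f h : Finset Λ → ℝ) (V : Finset Λ) : ℝ :=
  ∑ A ∈ V.powerset, crossSign A (V \ A) * (f A * h (V \ A))

/-- The contraction of `χ` with `h`, the adjoint of the exterior multiplication by `h` on the
subsets of `U`. -/
def contract (U : Finset Λ) (h χ : Finset Λ → ℝ) (A : Finset Λ) : ℝ :=
  ∑ B ∈ (U \ A).powerset, crossSign A B * (h B * χ (A ∪ B))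

/-- Graded Leibniz rule. The sign in `ann` moves `p` to the right end of the set, so annihilation
meets the right factor freely and reaches the left factor after passing `V \ A`. -/
theorem ann_wedge (p : Λ) (f h : Finset Λ → ℝ) (V : Finset Λ) :
    ann p (wedge f h) V = ∑ A ∈ V.powerset, crossSign A (V \ A) *
      (f A * ann p h (V \ A) + (-1) ^ (V \ A).card * h (V \ A) * ann p f A) := by
  by_cases hp : p ∈ V
  · obtain ⟨W, hW, rfl⟩ : ∃ W, p ∉ W ∧ V = insert p W :=
      ⟨V.erase p, by simp, (Finset.insert_erase hp).symm⟩
    -- For `p ∈ V` the left side is zero. On the right, the splittings with `p` in the right factor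
    -- cancel those with `p` in the left factor.
    rw [ann, if_pos hp, Finset.sum_powerset_insert hW, ← Finset.sum_add_distrib]
    refine (Finset.sum_eq_zero fun A hA => ?_).symm
    have hA' := Finset.mem_powerset.1 hA
    have hpA : p ∉ A := fun h => hW (hA' h)
    have hpB : p ∉ W \ A := fun h => hW (Finset.mem_sdiff.1 h).1
    have e1 : insert p W \ A = insert p (W \ A) := Finset.insert_sdiff_of_notMem _ hpA
    have e2 : insert p W \ insert p A = W \ A := by
      rw [Finset.insert_sdiff_insert, Finset.sdiff_insert_of_notMem hW]
    rw [e1, e2]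
    simp only [ann, Finset.mem_insert_self, if_true, hpB, hpA, if_false,
      Finset.card_insert_of_notMem hpB, crossSign_insert_left _ hpA,
      crossSign_insert_right _ hpB, crossSign_swap hpB]
    have h1 := crossSign_mul_self A {p}
    have h2 := crossSign_mul_self (W \ A) {p}
    generalize crossSign A {p} = x at *
    generalize crossSign (W \ A) {p} = y at *
    rw [pow_succ]
    linear_combination (-(-1 : ℝ) ^ (W \ A).card * crossSign A (W \ A) * h (insert p (W \ A)) *
      f (insert p A)) * h1 + ((-1 : ℝ) ^ (W \ A).card * crossSign A (W \ A) *
      h (insert p (W \ A)) * f (insert p A)) * h2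
  · rw [ann, if_neg hp, wedge, Finset.sum_powerset_insert hp, ← Finset.sum_add_distrib,
      Finset.mul_sum]
    refine Finset.sum_congr rfl fun A hA => ?_
    have hA' := Finset.mem_powerset.1 hA
    have hpA : p ∉ A := fun h => hp (hA' h)
    have hpB : p ∉ V \ A := fun h => hp (Finset.mem_sdiff.1 h).1
    have e1 : insert p V \ A = insert p (V \ A) := Finset.insert_sdiff_of_notMem _ hpA
    have e2 : insert p V \ insert p A = V \ A := by
      rw [Finset.insert_sdiff_insert, Finset.sdiff_insert_of_notMem hp]
    have e3 : crossSign V {p} = crossSign A {p} * crossSign (V \ A) {p} := by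
      rw [← crossSign_union_left _ Finset.disjoint_sdiff, Finset.union_sdiff_of_subset hA']
    rw [e1, e2, e3]
    simp only [ann, hpB, hpA, if_false, crossSign_insert_left _ hpA,
      crossSign_insert_right _ hpB, crossSign_swap hpB]
    have h1 := crossSign_mul_self A {p}
    have h2 := crossSign_mul_self (V \ A) {p}
    generalize crossSign A {p} = x at *
    generalize crossSign (V \ A) {p} = y at *
    linear_combination (y * crossSign A (V \ A) * f A * h (insert p (V \ A))) * h1 +
      (x * (-1 : ℝ) ^ (V \ A).card * crossSign A (V \ A) * h (V \ A) * f (insert p A)) * h2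

/-- Annihilation passes the contracted elements `B`, at the cost of one sign for each, and acts on
`χ` only. Since `h` is never differentiated, only its `ℓ²` norm enters `energy_contract_le`. The
sets `B` containing `p` contribute zero on the right. -/
theorem ann_contract {U : Finset Λ} {p : Λ} (hpU : p ∈ U) (h χ : Finset Λ → ℝ) (A : Finset Λ) :
    ann p (contract U h χ) A = ∑ B ∈ (U \ A).powerset, crossSign A B *
      ((-1) ^ B.card * h B * ann p χ (A ∪ B)) := by
  by_cases hp : p ∈ A
  · rw [ann, if_pos hp]
    refine (Finset.sum_eq_zero fun B _ => ?_).symm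
    rw [ann, if_pos (Finset.mem_union_left _ hp), mul_zero, mul_zero]
  · have hpUA : p ∈ U \ A := Finset.mem_sdiff.2 ⟨hpU, hp⟩
    rw [ann, if_neg hp, contract, ← Finset.insert_erase hpUA,
      Finset.sum_powerset_insert (Finset.notMem_erase _ _), ← Finset.sdiff_insert, Finset.mul_sum]
    conv_lhs => rw [← add_zero (Finset.sum _ _)]
    congr 1
    · refine Finset.sum_congr rfl fun B hB => ?_
      have hB' := Finset.mem_powerset.1 hB
      have hpB : p ∉ B := fun h => by
        have := hB' h
        simp at this
      have hdis : Disjoint A B := Finset.disjoint_left.2 fun a ha hb => by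
        have := hB' hb
        simp [ha] at this
      rw [ann, if_neg (by simp [hp, hpB]), crossSign_insert_left _ hp, crossSign_swap hpB,
        crossSign_union_left _ hdis, Finset.insert_union]
      ring
    · refine (Finset.sum_eq_zero fun B _ => ?_).symm
      rw [ann, if_pos (by simp), mul_zero, mul_zero]

/-! ### Energy estimates for coefficient families -/

section Energy

variable {G : Type*} [NormedAddCommGroup G] [InnerProductSpace ℝ G]

theorem sum_comp_le_sum {ι κ : Type*} {s : Finset ι} {t : Finset κ} (e : ι → κ) {f : κ → ℝ}
    (hf : ∀ k ∈ t, 0 ≤ f k) (hmap : ∀ i ∈ s, e i ∈ t) (hinj : Set.InjOn e s) :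
    ∑ i ∈ s, f (e i) ≤ ∑ k ∈ t, f k := by
  classical
  rw [← Finset.sum_image hinj]
  exact Finset.sum_le_sum_of_subset_of_nonneg (Finset.image_subset_iff.2 hmap)
    fun k hk _ => hf k hk

theorem norm_sum_sq_le {ι : Type*} (s : Finset ι) (x : ι → G) :
    ‖∑ i ∈ s, x i‖ ^ 2 ≤ s.card * ∑ i ∈ s, ‖x i‖ ^ 2 :=
  (pow_le_pow_left₀ (norm_nonneg _) (norm_sum_le s x) 2).trans sq_sum_le_card_mul_sum_sq

theorem norm_sum_smul_sq_le {ι : Type*} (s : Finset ι) (a : ι → ℝ) (x : ι → G) :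
    ‖∑ i ∈ s, a i • x i‖ ^ 2 ≤ (∑ i ∈ s, a i ^ 2) * ∑ i ∈ s, ‖x i‖ ^ 2 := by
  refine (pow_le_pow_left₀ (norm_nonneg _) (norm_sum_le s _) 2).trans ?_
  simp only [norm_smul]
  refine (Finset.sum_mul_sq_le_sq_mul_sq s _ _).trans_eq ?_
  simp only [Real.norm_eq_abs, sq_abs]

/-- The gradient `∑ p, a_p f ⊗ g_p` of a coefficient family. -/
def grad (U : Finset Λ) (g : Λ → G) (f : Finset Λ → ℝ) (V : Finset Λ) : G :=
  ∑ p ∈ U, ann p f V • g p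

/-- The density of the Sobolev energy. -/
def density (U : Finset Λ) (g : Λ → G) (f : Finset Λ → ℝ) (V : Finset Λ) : ℝ :=
  f V ^ 2 + ‖grad U g f V‖ ^ 2

/-- The subsets of `U` with at most `n` elements. -/
def lowSets (U : Finset Λ) (n : ℕ) : Finset (Finset Λ) := U.powerset.filter fun V => V.card ≤ n

/-- The squared Sobolev norm of a coefficient family, restricted to at most `n` particles. -/
def energy (U : Finset Λ) (n : ℕ) (g : Λ → G) (f : Finset Λ → ℝ) : ℝ :=
  ∑ V ∈ lowSets U n, density U g f V

theorem mem_lowSets {U V : Finset Λ} {n : ℕ} : V ∈ lowSets U n ↔ V ⊆ U ∧ V.card ≤ n := by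
  simp [lowSets]

theorem density_nonneg (U : Finset Λ) (g : Λ → G) (f : Finset Λ → ℝ) (V : Finset Λ) :
    0 ≤ density U g f V := by unfold density; positivity

theorem energy_nonneg (U : Finset Λ) (n : ℕ) (g : Λ → G) (f : Finset Λ → ℝ) :
    0 ≤ energy U n g f := Finset.sum_nonneg fun V _ => density_nonneg U g f V

theorem grad_congr {U : Finset Λ} (g : Λ → G) {f f' : Finset Λ → ℝ}
    (h : ∀ V ⊆ U, f V = f' V) {V : Finset Λ} (hV : V ⊆ U) : grad U g f V = grad U g f' V := by
  refine Finset.sum_congr rfl fun p hp => ?_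
  rw [ann, ann, h _ (Finset.insert_subset hp hV)]

theorem energy_congr {U : Finset Λ} (n : ℕ) (g : Λ → G) {f f' : Finset Λ → ℝ}
    (h : ∀ V ⊆ U, f V = f' V) : energy U n g f = energy U n g f' := by
  refine Finset.sum_congr rfl fun V hV => ?_
  have hV' := (mem_lowSets.1 hV).1
  rw [density, density, h V hV', grad_congr g h hV']

theorem grad_sum {ι : Type*} (I : Finset ι) (U : Finset Λ) (g : Λ → G) (e : ι → ℝ)
    (F : ι → Finset Λ → ℝ) (V : Finset Λ) :
    grad U g (fun V => ∑ i ∈ I, e i * F i V) V = ∑ i ∈ I, e i • grad U g (F i) V := by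
  simp only [grad, Finset.smul_sum]
  rw [Finset.sum_comm]
  refine Finset.sum_congr rfl fun p _ => ?_
  simp only [← smul_assoc, ← Finset.sum_smul]
  congr 1
  simp only [ann]
  split_ifs
  · simp
  · rw [Finset.mul_sum]
    refine Finset.sum_congr rfl fun i _ => ?_
    rw [smul_eq_mul]
    ring

theorem energy_sum_le {ι : Type*} (I : Finset ι) (U : Finset Λ) (n : ℕ) (g : Λ → G) (e : ι → ℝ)
    (he : ∀ i ∈ I, e i ^ 2 ≤ 1) (F : ι → Finset Λ → ℝ) :
    energy U n g (fun V => ∑ i ∈ I, e i * F i V) ≤ I.card * ∑ i ∈ I, energy U n g (F i) := by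
  simp only [energy]
  rw [Finset.sum_comm, Finset.mul_sum]
  refine Finset.sum_le_sum fun V _ => ?_
  rw [density, grad_sum]
  have h1 : (∑ i ∈ I, e i * F i V) ^ 2 ≤ I.card * ∑ i ∈ I, (F i V) ^ 2 := by
    refine sq_sum_le_card_mul_sum_sq.trans ?_
    simp only [mul_pow]
    gcongr with i hi
    exact mul_le_of_le_one_left (sq_nonneg _) (he i hi)
  have h2 : ‖∑ i ∈ I, e i • grad U g (F i) V‖ ^ 2 ≤ I.card * ∑ i ∈ I, ‖grad U g (F i) V‖ ^ 2 := by
    refine (norm_sum_sq_le _ _).trans ?_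
    simp only [norm_smul, mul_pow, Real.norm_eq_abs, sq_abs]
    gcongr with i hi
    exact mul_le_of_le_one_left (sq_nonneg _) (he i hi)
  simp only [density, Finset.sum_add_distrib, mul_add]
  exact add_le_add h1 h2

theorem grad_wedge (U : Finset Λ) (g : Λ → G) (f h : Finset Λ → ℝ) (V : Finset Λ) :
    grad U g (wedge f h) V = ∑ A ∈ V.powerset, crossSign A (V \ A) •
      (f A • grad U g h (V \ A) + ((-1) ^ (V \ A).card * h (V \ A)) • grad U g f A) := by
  simp only [grad, ann_wedge, Finset.sum_smul, Finset.smul_sum, ← Finset.sum_add_distrib]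
  rw [Finset.sum_comm]
  refine Finset.sum_congr rfl fun A _ => Finset.sum_congr rfl fun p _ => ?_
  simp only [smul_smul, ← add_smul]

theorem grad_contract (U : Finset Λ) (g : Λ → G) (h χ : Finset Λ → ℝ) (A : Finset Λ) :
    grad U g (contract U h χ) A = ∑ B ∈ (U \ A).powerset,
      (crossSign A B * ((-1) ^ B.card * h B)) • grad U g χ (A ∪ B) := by
  simp only [grad, Finset.smul_sum]
  rw [Finset.sum_comm]
  refine Finset.sum_congr rfl fun p hp => ?_
  rw [ann_contract hp, Finset.sum_smul]
  refine Finset.sum_congr rfl fun B _ => ?_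
  simp only [smul_smul, mul_assoc]

/-- A set with a marked subset is determined by the marked part and its complement, so the left side
sums over a subset of the index pairs on the right. -/
theorem sum_powerset_sdiff_le (U : Finset Λ) (n : ℕ) {F H : Finset Λ → ℝ} (hF : ∀ A, 0 ≤ F A)
    (hH : ∀ A, 0 ≤ H A) : ∑ V ∈ lowSets U n, ∑ A ∈ V.powerset, F A * H (V \ A)
      ≤ (∑ A ∈ lowSets U n, F A) * ∑ B ∈ lowSets U n, H B := by
  rw [Finset.sum_mul_sum, ← Finset.sum_product', Finset.sum_sigma']
  refine sum_comp_le_sum (f := fun x : Finset Λ × Finset Λ => F x.1 * H x.2)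
    (fun x : (_ : Finset Λ) × Finset Λ => (x.2, x.1 \ x.2))
    (fun k _ => mul_nonneg (hF _) (hH _)) ?_ ?_
  · rintro ⟨V, A⟩ hx
    simp only [Finset.mem_sigma, Finset.mem_powerset, mem_lowSets] at hx
    obtain ⟨⟨hVU, hVn⟩, hA⟩ := hx
    simp only [Finset.mem_product, mem_lowSets]
    exact ⟨⟨hA.trans hVU, (Finset.card_le_card hA).trans hVn⟩, Finset.sdiff_subset.trans hVU,
      (Finset.card_le_card Finset.sdiff_subset).trans hVn⟩
  · rintro ⟨V, A⟩ hx ⟨V', A'⟩ hx' he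
    simp only [Finset.coe_sigma, Set.mem_sigma_iff, Finset.mem_coe, Finset.mem_powerset] at hx hx'
    simp only [Prod.mk.injEq] at he
    obtain ⟨rfl, he⟩ := he
    have : V = V' := by
      rw [← Finset.union_sdiff_of_subset hx.2, he, Finset.union_sdiff_of_subset hx'.2]
    rw [this]

/-- Cauchy–Schwarz over the splittings of `V` costs the factor `2 ^ n`; the two terms of the Leibniz
rule cost the remaining factor `2`. The restriction to at most `n` particles makes the bound
independent of `U`. -/
theorem energy_wedge_le (U : Finset Λ) (n : ℕ) (g : Λ → G) (f h : Finset Λ → ℝ) :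
    energy U n g (wedge f h) ≤ 2 ^ (n + 1) * (energy U n g f * energy U n g h) := by
  refine le_trans ?_ (mul_le_mul_of_nonneg_left
    (sum_powerset_sdiff_le U n (density_nonneg U g f) (density_nonneg U g h)) (by positivity))
  rw [energy, Finset.mul_sum]
  refine Finset.sum_le_sum fun V hV => ?_
  have hc : ((V.powerset.card : ℕ) : ℝ) ≤ 2 ^ n := by
    rw [Finset.card_powerset]
    exact_mod_cast Nat.pow_le_pow_right (by norm_num) (mem_lowSets.1 hV).2
  have h1 : wedge f h V ^ 2 ≤ 2 ^ n * ∑ A ∈ V.powerset, f A ^ 2 * h (V \ A) ^ 2 := by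
    refine sq_sum_le_card_mul_sum_sq.trans ?_
    simp only [mul_pow, crossSign_sq, one_mul]
    gcongr
  have h2 : ‖grad U g (wedge f h) V‖ ^ 2 ≤ 2 ^ n * ∑ A ∈ V.powerset,
      2 * (f A ^ 2 * ‖grad U g h (V \ A)‖ ^ 2 + h (V \ A) ^ 2 * ‖grad U g f A‖ ^ 2) := by
    rw [grad_wedge]
    refine (norm_sum_sq_le _ _).trans ?_
    gcongr with A hA
    rw [norm_smul, mul_pow, Real.norm_eq_abs, sq_abs, crossSign_sq, one_mul]
    have e1 : ‖f A • grad U g h (V \ A)‖ ^ 2 = f A ^ 2 * ‖grad U g h (V \ A)‖ ^ 2 := by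
      rw [norm_smul, mul_pow, Real.norm_eq_abs, sq_abs]
    have e2 : ‖((-1) ^ (V \ A).card * h (V \ A)) • grad U g f A‖ ^ 2
        = h (V \ A) ^ 2 * ‖grad U g f A‖ ^ 2 := by
      rw [norm_smul, mul_pow, norm_mul, norm_pow, norm_neg, norm_one, one_pow, one_mul,
        Real.norm_eq_abs, sq_abs]
    rw [← e1, ← e2]
    refine (pow_le_pow_left₀ (norm_nonneg _) (norm_add_le _ _) 2).trans ?_
    exact add_sq_le
  have h3 : 2 ^ n * ∑ A ∈ V.powerset, f A ^ 2 * h (V \ A) ^ 2 + 2 ^ n * ∑ A ∈ V.powerset,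
      2 * (f A ^ 2 * ‖grad U g h (V \ A)‖ ^ 2 + h (V \ A) ^ 2 * ‖grad U g f A‖ ^ 2)
      ≤ 2 ^ (n + 1) * ∑ A ∈ V.powerset, density U g f A * density U g h (V \ A) := by
    rw [pow_succ, mul_assoc, ← mul_add, ← Finset.sum_add_distrib, Finset.mul_sum (a := (2 : ℝ))]
    gcongr with A hA
    -- The product of the two densities contains all the terms on the left, and the additional
    -- product of both squared gradients is nonnegative.
    simp only [density]
    nlinarith [sq_nonneg (f A * h (V \ A)), sq_nonneg (‖grad U g h (V \ A)‖ * ‖grad U g f A‖)]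
  exact (add_le_add h1 h2).trans h3

/-- Cauchy–Schwarz in `B` separates the `ℓ²` norm of `h` from the densities of `χ` at `A ∪ B`. A set
`W` arises as such a union at most once for each `A ⊆ W`, hence at most `2 ^ n` times when `χ` has
no components beyond `n` particles. -/
theorem energy_contract_le (U : Finset Λ) (n : ℕ) (g : Λ → G) (h χ : Finset Λ → ℝ)
    (hχ : ∀ V, n < V.card → χ V = 0) :
    energy U n g (contract U h χ)
      ≤ 2 ^ n * ((∑ B ∈ U.powerset, h B ^ 2) * energy U n g χ) := by
  -- The gradient at `W` only sees `χ` on sets with one more element, so it vanishes above `n` as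
  -- well.
  have hd : ∀ W, n < W.card → density U g χ W = 0 := by
    intro W hW
    have : grad U g χ W = 0 := Finset.sum_eq_zero fun p _ => by
      rw [ann]
      split_ifs with hp
      · simp
      · rw [hχ _ (by rw [Finset.card_insert_of_notMem hp]; omega)]
        simp
    rw [density, this, hχ W hW]
    simp
  have h1 : ∀ A, density U g (contract U h χ) A ≤ (∑ B ∈ U.powerset, h B ^ 2) *
      ∑ B ∈ (U \ A).powerset, density U g χ (A ∪ B) := by
    intro A
    have hle : ∑ B ∈ (U \ A).powerset, h B ^ 2 ≤ ∑ B ∈ U.powerset, h B ^ 2 :=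
      Finset.sum_le_sum_of_subset_of_nonneg (Finset.powerset_mono.2 Finset.sdiff_subset)
        fun _ _ _ => sq_nonneg _
    have a1 : contract U h χ A ^ 2 ≤ (∑ B ∈ U.powerset, h B ^ 2) *
        ∑ B ∈ (U \ A).powerset, χ (A ∪ B) ^ 2 := by
      have := Finset.sum_mul_sq_le_sq_mul_sq (U \ A).powerset (fun B => crossSign A B * h B)
        fun B => χ (A ∪ B)
      simp only [mul_pow, crossSign_sq, one_mul, mul_assoc] at this
      refine this.trans ?_
      gcongr
    have a2 : ‖grad U g (contract U h χ) A‖ ^ 2 ≤ (∑ B ∈ U.powerset, h B ^ 2) *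
        ∑ B ∈ (U \ A).powerset, ‖grad U g χ (A ∪ B)‖ ^ 2 := by
      rw [grad_contract]
      refine (norm_sum_smul_sq_le _ _ _).trans ?_
      have : ∀ B, (crossSign A B * ((-1) ^ B.card * h B)) ^ 2 = h B ^ 2 := by
        intro B
        rw [mul_pow, crossSign_sq, one_mul, mul_pow, ← pow_mul, mul_comm _ 2, pow_mul]
        norm_num
      simp only [this]
      gcongr
    simp only [density, Finset.sum_add_distrib, mul_add]
    exact add_le_add a1 a2
  have h2 : ∑ A ∈ lowSets U n, ∑ B ∈ (U \ A).powerset, density U g χ (A ∪ B)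
      ≤ ∑ W ∈ U.powerset, ∑ A ∈ W.powerset, density U g χ W := by
    rw [Finset.sum_sigma', Finset.sum_sigma']
    refine sum_comp_le_sum (f := fun x : (_ : Finset Λ) × Finset Λ => density U g χ x.1)
      (fun x : (_ : Finset Λ) × Finset Λ => ⟨x.1 ∪ x.2, x.1⟩)
      (fun k _ => density_nonneg _ _ _ _) ?_ ?_
    · rintro ⟨A, B⟩ hx
      simp only [Finset.mem_sigma, Finset.mem_powerset, mem_lowSets] at hx ⊢
      exact ⟨Finset.union_subset hx.1.1 (hx.2.trans Finset.sdiff_subset),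
        Finset.subset_union_left⟩
    · rintro ⟨A, B⟩ hx ⟨A', B'⟩ hx' he
      simp only [Finset.coe_sigma, Set.mem_sigma_iff, Finset.mem_coe, Finset.mem_powerset] at hx hx'
      simp only [Sigma.mk.injEq, heq_eq_eq] at he
      obtain ⟨he, rfl⟩ := he
      have d1 : Disjoint A B := Finset.disjoint_of_subset_right hx.2 Finset.disjoint_sdiff
      have d2 : Disjoint A B' := Finset.disjoint_of_subset_right hx'.2 Finset.disjoint_sdiff
      have : B = B' := by
        rw [← Finset.union_sdiff_cancel_left d1, he, Finset.union_sdiff_cancel_left d2]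
      rw [this]
  have h3 : ∑ W ∈ U.powerset, ∑ A ∈ W.powerset, density U g χ W ≤ 2 ^ n * energy U n g χ := by
    rw [energy, lowSets, Finset.sum_filter, Finset.mul_sum]
    refine Finset.sum_le_sum fun W _ => ?_
    rw [Finset.sum_const, Finset.card_powerset, nsmul_eq_mul]
    split_ifs with hW
    · refine mul_le_mul_of_nonneg_right ?_ (density_nonneg _ _ _ _)
      exact_mod_cast Nat.pow_le_pow_right (by norm_num) hW
    · rw [hd W (by omega)]
      simp
  calc energy U n g (contract U h χ)
      ≤ ∑ A ∈ lowSets U n, (∑ B ∈ U.powerset, h B ^ 2) *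
        ∑ B ∈ (U \ A).powerset, density U g χ (A ∪ B) := Finset.sum_le_sum fun A _ => h1 A
    _ = (∑ B ∈ U.powerset, h B ^ 2) *
        ∑ A ∈ lowSets U n, ∑ B ∈ (U \ A).powerset, density U g χ (A ∪ B) := by
        rw [Finset.mul_sum]
    _ ≤ (∑ B ∈ U.powerset, h B ^ 2) * (2 ^ n * energy U n g χ) :=
        mul_le_mul_of_nonneg_left (h2.trans h3) (Finset.sum_nonneg fun _ _ => sq_nonneg _)
    _ = _ := by ring

end Energy

/-! ### Decomposition with respect to the vacated orbitals -/

/-- The component of `c` in which exactly the orbitals `J` of `r` are vacated, as a function of the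
virtual orbitals. -/
def block (r : Finset Λ) (c : Finset Λ → ℝ) (J V : Finset Λ) : ℝ := c ((r \ J) ∪ V)

theorem sdiff_block {r J V : Finset Λ} (hJ : J ⊆ r) (hV : Disjoint V r) :
    r \ ((r \ J) ∪ V) = J ∧ ((r \ J) ∪ V) \ r = V := by
  have h : ∀ x ∈ V, x ∉ r := fun x hx => Finset.disjoint_left.1 hV hx
  constructor
  · ext x
    have := h x
    have := @hJ x
    simp only [Finset.mem_sdiff, Finset.mem_union]
    tauto
  · ext x
    have := h x
    simp only [Finset.mem_sdiff, Finset.mem_union]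
    tauto

theorem block_sdiff (r α : Finset Λ) : (r \ (r \ α)) ∪ (α \ r) = α := by
  ext x
  simp only [Finset.mem_sdiff, Finset.mem_union]
  tauto

theorem block_eq_iff {r J V α : Finset Λ} (hJ : J ⊆ r) (hV : Disjoint V r) :
    (r \ J) ∪ V = α ↔ J = r \ α ∧ V = α \ r := by
  constructor
  · rintro rfl
    exact ⟨(sdiff_block hJ hV).1.symm, (sdiff_block hJ hV).2.symm⟩
  · rintro ⟨rfl, rfl⟩
    exact block_sdiff r α

/-- A subset of `U` is the same as the set `J` of vacated orbitals together with the set `V` of its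
elements outside `r`. -/
theorem sum_powerset_block {r U : Finset Λ} (hrU : r ⊆ U) (F : Finset Λ → ℝ) :
    ∑ α ∈ U.powerset, F α
      = ∑ J ∈ r.powerset, ∑ V ∈ (U \ r).powerset, F ((r \ J) ∪ V) := by
  rw [← Finset.sum_product']
  have hd : ∀ x : Finset Λ × Finset Λ, x ∈ r.powerset ×ˢ (U \ r).powerset →
      x.1 ⊆ r ∧ x.2 ⊆ U ∧ Disjoint x.2 r := by
    intro x hx
    simp only [Finset.mem_product, Finset.mem_powerset] at hx
    exact ⟨hx.1, hx.2.trans Finset.sdiff_subset,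
      Finset.disjoint_of_subset_left hx.2 Finset.sdiff_disjoint⟩
  refine Finset.sum_nbij' (fun α => (r \ α, α \ r)) (fun x => (r \ x.1) ∪ x.2) ?_ ?_ ?_ ?_ ?_
  · intro α hα
    simp only [Finset.mem_product, Finset.mem_powerset] at hα ⊢
    exact ⟨Finset.sdiff_subset, Finset.sdiff_subset_sdiff hα le_rfl⟩
  · intro x hx
    obtain ⟨-, h2, -⟩ := hd x hx
    exact Finset.mem_powerset.2 (Finset.union_subset (Finset.sdiff_subset.trans hrU) h2)
  · intro α _
    exact block_sdiff r α
  · intro x hx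
    obtain ⟨h1, -, h3⟩ := hd x hx
    exact Prod.ext (sdiff_block h1 h3).1 (sdiff_block h1 h3).2
  · intro α _
    rw [block_sdiff]

section Form

variable {G : Type*} [NormedAddCommGroup G] [InnerProductSpace ℝ G]

/-- The squared Sobolev norm of a coefficient family. -/
def form (U : Finset Λ) (g : Λ → G) (c : Finset Λ → ℝ) : ℝ := ∑ α ∈ U.powerset, density U g c α

/-- The constant in the comparison of the Sobolev norm with the norms of the blocks. -/
def blockConst (r : Finset Λ) (g : Λ → G) : ℝ := 2 + 2 * (r.card * ∑ p ∈ r, ‖g p‖ ^ 2)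

theorem blockConst_nonneg (r : Finset Λ) (g : Λ → G) : 0 ≤ blockConst r g := by
  unfold blockConst; positivity

theorem form_nonneg (U : Finset Λ) (g : Λ → G) (c : Finset Λ → ℝ) : 0 ≤ form U g c :=
  Finset.sum_nonneg fun α _ => density_nonneg U g c α

theorem sum_sq_le_form (U : Finset Λ) (g : Λ → G) (c : Finset Λ → ℝ) :
    ∑ α ∈ U.powerset, c α ^ 2 ≤ form U g c :=
  Finset.sum_le_sum fun _ _ => le_add_of_nonneg_right (sq_nonneg _)

/-- Each annihilation operator is a contraction in `ℓ²`. As `r` is finite, the occupied part of the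
gradient is a bounded perturbation in `L²`. -/
theorem sum_grad_occ_le {r U : Finset Λ} (hrU : r ⊆ U) (g : Λ → G) (c : Finset Λ → ℝ) :
    ∑ γ ∈ U.powerset, ‖∑ p ∈ r, ann p c γ • g p‖ ^ 2
      ≤ (r.card * ∑ p ∈ r, ‖g p‖ ^ 2) * ∑ α ∈ U.powerset, c α ^ 2 := by
  have h1 : ∀ p ∈ r, ∑ γ ∈ U.powerset, ann p c γ ^ 2 ≤ ∑ α ∈ U.powerset, c α ^ 2 := by
    intro p hp
    have : ∑ γ ∈ U.powerset, ann p c γ ^ 2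
        = ∑ γ ∈ U.powerset.filter fun γ => p ∉ γ, c (insert p γ) ^ 2 := by
      rw [Finset.sum_filter]
      refine Finset.sum_congr rfl fun γ _ => ?_
      by_cases h : p ∈ γ
      · simp [ann, h]
      · simp [ann, h, mul_pow, crossSign_sq]
    rw [this]
    refine sum_comp_le_sum (f := fun α => c α ^ 2) (fun γ => insert p γ)
      (fun _ _ => sq_nonneg _) ?_ ?_
    · intro γ hγ
      simp only [Finset.mem_filter, Finset.mem_powerset] at hγ ⊢
      exact Finset.insert_subset (hrU hp) hγ.1
    · intro γ hγ γ' hγ' h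
      have h1 := (Finset.mem_filter.1 hγ).2
      have h2 := (Finset.mem_filter.1 hγ').2
      exact (Finset.erase_insert h1).symm.trans
        ((congrArg (Finset.erase · p) h).trans (Finset.erase_insert h2))
  calc ∑ γ ∈ U.powerset, ‖∑ p ∈ r, ann p c γ • g p‖ ^ 2
      ≤ ∑ γ ∈ U.powerset, r.card * ∑ p ∈ r, ‖g p‖ ^ 2 * ann p c γ ^ 2 := by
        refine Finset.sum_le_sum fun γ _ => (norm_sum_sq_le _ _).trans_eq ?_
        simp only [norm_smul, mul_pow, Real.norm_eq_abs, sq_abs, mul_comm]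
    _ = r.card * ∑ p ∈ r, ‖g p‖ ^ 2 * ∑ γ ∈ U.powerset, ann p c γ ^ 2 := by
        rw [← Finset.mul_sum, Finset.sum_comm]
        simp only [Finset.mul_sum]
    _ ≤ r.card * ∑ p ∈ r, ‖g p‖ ^ 2 * ∑ α ∈ U.powerset, c α ^ 2 := by
        refine mul_le_mul_of_nonneg_left (Finset.sum_le_sum fun p hp => ?_) (by positivity)
        exact mul_le_mul_of_nonneg_left (h1 p hp) (sq_nonneg _)
    _ = _ := by rw [← Finset.sum_mul, mul_assoc]

/-- The reference orbitals precede all others, so a virtual orbital is annihilated without a sign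
from `r \ J`. Thus, apart from the occupied terms, the gradient acts inside each block as the
gradient of that block. This is the place where the order of `r` matters. -/
theorem grad_block {r U : Finset Λ} (hrU : r ⊆ U) (hr : ∀ i ∈ r, ∀ p ∉ r, i < p) (g : Λ → G)
    (c : Finset Λ → ℝ) {J V : Finset Λ} (hV : Disjoint V r) :
    grad U g c ((r \ J) ∪ V)
      = ∑ p ∈ r, ann p c ((r \ J) ∪ V) • g p + grad (U \ r) g (block r c J) V := by
  rw [grad, ← Finset.sum_sdiff hrU, add_comm]
  congr 1
  refine Finset.sum_congr rfl fun p hp => ?_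
  have hpr : p ∉ r := (Finset.mem_sdiff.1 hp).2
  congr 1
  have hmem : p ∈ (r \ J) ∪ V ↔ p ∈ V := by simp [hpr]
  have hd : Disjoint (r \ J) V :=
    Finset.disjoint_of_subset_left Finset.sdiff_subset hV.symm
  simp only [ann, hmem, block]
  rw [crossSign_union_left _ hd, crossSign_eq_one (A := r \ J), one_mul, Finset.union_insert]
  intro a ha b hb
  rw [Finset.mem_singleton.1 hb]
  exact hr a (Finset.mem_sdiff.1 ha).1 p hpr

/-- The gradient and the blockwise gradients differ by the occupied part, which is controlled by the
`ℓ²` norm; both directions follow from `(a + b)² ≤ 2 (a² + b²)`. -/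
theorem sum_density_block_bounds {r U : Finset Λ} (hrU : r ⊆ U) (hr : ∀ i ∈ r, ∀ p ∉ r, i < p)
    (g : Λ → G) (c : Finset Λ → ℝ) :
    form U g c ≤ blockConst r g *
      (∑ J ∈ r.powerset, ∑ V ∈ (U \ r).powerset, density (U \ r) g (block r c J) V) ∧
    ∑ J ∈ r.powerset, ∑ V ∈ (U \ r).powerset, density (U \ r) g (block r c J) V
      ≤ blockConst r g * form U g c := by
  set S := ∑ α ∈ U.powerset, c α ^ 2 with hS
  set D := ∑ α ∈ U.powerset, ‖grad U g c α‖ ^ 2 with hD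
  set X := ∑ α ∈ U.powerset, ‖∑ p ∈ r, ann p c α • g p‖ ^ 2 with hX
  set Y := ∑ J ∈ r.powerset, ∑ V ∈ (U \ r).powerset, ‖grad (U \ r) g (block r c J) V‖ ^ 2 with hY
  have hX' : X ≤ (r.card * ∑ p ∈ r, ‖g p‖ ^ 2) * S := sum_grad_occ_le hrU g c
  have hform : form U g c = S + D := Finset.sum_add_distrib
  have hblocks : ∑ J ∈ r.powerset, ∑ V ∈ (U \ r).powerset, density (U \ r) g (block r c J) V
      = S + Y := by
    rw [hS, sum_powerset_block hrU]
    simp only [density, Finset.sum_add_distrib, hY, block]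
  have hV : ∀ V ∈ (U \ r).powerset, Disjoint V r := fun V hV =>
    Finset.disjoint_of_subset_left (Finset.mem_powerset.1 hV) Finset.sdiff_disjoint
  have hDle : D ≤ 2 * (X + Y) := by
    rw [hD, hX, hY, sum_powerset_block hrU, sum_powerset_block hrU, ← Finset.sum_add_distrib,
      Finset.mul_sum]
    refine Finset.sum_le_sum fun J _ => ?_
    rw [← Finset.sum_add_distrib, Finset.mul_sum]
    refine Finset.sum_le_sum fun V hV' => ?_
    rw [grad_block hrU hr g c (hV V hV')]
    exact (pow_le_pow_left₀ (norm_nonneg _) (norm_add_le _ _) 2).trans add_sq_le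
  have hYle : Y ≤ 2 * (D + X) := by
    rw [hD, hX, hY, sum_powerset_block hrU, sum_powerset_block hrU, ← Finset.sum_add_distrib,
      Finset.mul_sum]
    refine Finset.sum_le_sum fun J _ => ?_
    rw [← Finset.sum_add_distrib, Finset.mul_sum]
    refine Finset.sum_le_sum fun V hV' => ?_
    rw [← add_sub_cancel_left (∑ p ∈ r, ann p c ((r \ J) ∪ V) • g p)
      (grad (U \ r) g (block r c J) V), ← grad_block hrU hr g c (hV V hV')]
    exact (pow_le_pow_left₀ (norm_nonneg _) (norm_sub_le _ _) 2).trans add_sq_le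
  have hS0 : 0 ≤ S := Finset.sum_nonneg fun _ _ => sq_nonneg _
  have hD0 : 0 ≤ D := Finset.sum_nonneg fun _ _ => sq_nonneg _
  have hY0 : 0 ≤ Y := Finset.sum_nonneg fun _ _ => Finset.sum_nonneg fun _ _ => sq_nonneg _
  have hR : 0 ≤ (r.card : ℝ) * ∑ p ∈ r, ‖g p‖ ^ 2 := by positivity
  rw [hform, hblocks, blockConst]
  generalize (r.card : ℝ) * ∑ p ∈ r, ‖g p‖ ^ 2 = R at *
  constructor <;> nlinarith [mul_nonneg hR hY0, mul_nonneg hR hD0]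

theorem sum_energy_block_le {r U : Finset Λ} (hrU : r ⊆ U) (hr : ∀ i ∈ r, ∀ p ∉ r, i < p) (n : ℕ)
    (g : Λ → G) (c : Finset Λ → ℝ) :
    ∑ J ∈ r.powerset, energy (U \ r) n g (block r c J) ≤ blockConst r g * form U g c := by
  refine le_trans ?_ (sum_density_block_bounds hrU hr g c).2
  exact Finset.sum_le_sum fun J _ => Finset.sum_le_sum_of_subset_of_nonneg
    (Finset.filter_subset _ _) fun _ _ _ => density_nonneg _ _ _ _

/-- The particle cutoff in `energy` loses nothing here, since a block of `c` and its gradient vanish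
beyond `n` virtual orbitals. -/
theorem form_le_sum_energy {r U : Finset Λ} (hrU : r ⊆ U) (hr : ∀ i ∈ r, ∀ p ∉ r, i < p) {n : ℕ}
    (g : Λ → G) {c : Finset Λ → ℝ} (hc : ∀ V, n < V.card → c V = 0) :
    form U g c ≤ blockConst r g * ∑ J ∈ r.powerset, energy (U \ r) n g (block r c J) := by
  refine (sum_density_block_bounds hrU hr g c).1.trans_eq ?_
  congr 1
  refine Finset.sum_congr rfl fun J _ => ?_
  rw [energy, lowSets, Finset.sum_filter]
  refine Finset.sum_congr rfl fun V _ => ?_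
  split_ifs with h
  · rfl
  · have h0 : ∀ W : Finset Λ, n < W.card → block r c J W = 0 := fun W hW =>
      hc _ (hW.trans_le (Finset.card_le_card Finset.subset_union_right))
    have : grad (U \ r) g (block r c J) V = 0 := Finset.sum_eq_zero fun p _ => by
      rw [ann]
      split_ifs with hp
      · simp
      · rw [h0 _ (by rw [Finset.card_insert_of_notMem hp]; omega)]
        simp
    rw [density, this, h0 V (by omega)]
    simp

/-- In the constant, one factor `2 ^ r.card` counts the blocks `J`; two more come from
Cauchy–Schwarz over `I ⊆ J` and from the number of its terms. One factor `blockConst` is spent on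
each of `θ` and `ψ` and one on reassembling `c`. -/
theorem form_le_of_block_wedge {r U : Finset Λ} (hrU : r ⊆ U) (hr : ∀ i ∈ r, ∀ p ∉ r, i < p)
    {n : ℕ} (g : Λ → G) {e : Finset Λ → Finset Λ → ℝ} (he : ∀ I J, e I J ^ 2 ≤ 1)
    {c θ ψ : Finset Λ → ℝ} (hc : ∀ V, n < V.card → c V = 0)
    (h : ∀ J ⊆ r, ∀ V ⊆ U \ r, block r c J V = ∑ I ∈ J.powerset,
      e I (J \ I) * wedge (block r ψ (J \ I)) (block r θ I) V) :
    form U g c ≤ (2 ^ r.card) ^ 3 * 2 ^ (n + 1) * blockConst r g ^ 3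
      * (form U g θ * form U g ψ) := by
  have hK := blockConst_nonneg r g
  have hpow : ∀ J ∈ r.powerset, ((J.powerset.card : ℕ) : ℝ) ≤ 2 ^ r.card := by
    intro J hJ
    rw [Finset.card_powerset]
    exact_mod_cast Nat.pow_le_pow_right (by norm_num)
      (Finset.card_le_card (Finset.mem_powerset.1 hJ))
  have hb : ∀ (d : Finset Λ → ℝ) (J : Finset Λ), J ⊆ r →
      energy (U \ r) n g (block r d J) ≤ blockConst r g * form U g d := fun d J hJ =>
    (Finset.single_le_sum (f := fun J => energy (U \ r) n g (block r d J))
      (fun _ _ => energy_nonneg _ _ _ _) (Finset.mem_powerset.2 hJ)).trans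
      (sum_energy_block_le hrU hr n g d)
  have h1 : ∀ J ∈ r.powerset, energy (U \ r) n g (block r c J) ≤ 2 ^ r.card * (2 ^ r.card *
      (2 ^ (n + 1) * ((blockConst r g * form U g ψ) * (blockConst r g * form U g θ)))) := by
    intro J hJ
    rw [energy_congr n g (h J (Finset.mem_powerset.1 hJ))]
    refine (energy_sum_le _ _ _ _ _ (fun I _ => he _ _) _).trans ?_
    refine mul_le_mul (hpow J hJ) ?_ (Finset.sum_nonneg fun _ _ => energy_nonneg _ _ _ _)
      (by positivity)
    refine (Finset.sum_le_card_nsmul _ _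
      (2 ^ (n + 1) * ((blockConst r g * form U g ψ) * (blockConst r g * form U g θ)))
      fun I hI => ?_).trans ?_
    · refine (energy_wedge_le _ _ _ _ _).trans ?_
      have hIr := (Finset.mem_powerset.1 hI).trans (Finset.mem_powerset.1 hJ)
      refine mul_le_mul_of_nonneg_left (mul_le_mul (hb _ _ ?_) (hb _ _ hIr)
        (energy_nonneg _ _ _ _) (mul_nonneg hK (form_nonneg _ _ _))) (by positivity)
      exact Finset.sdiff_subset.trans (Finset.mem_powerset.1 hJ)
    · rw [nsmul_eq_mul]
      refine mul_le_mul_of_nonneg_right (hpow J hJ) ?_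
      have := form_nonneg U g ψ
      have := form_nonneg U g θ
      positivity
  refine (form_le_sum_energy hrU hr g hc).trans ?_
  refine (mul_le_mul_of_nonneg_left (Finset.sum_le_card_nsmul _ _ _ h1) hK).trans_eq ?_
  rw [nsmul_eq_mul, Finset.card_powerset]
  push_cast
  ring

/-- The constants arise as for the exterior product, except that `θ` enters through its `ℓ²` norm
only and costs no factor `blockConst`. -/
theorem form_le_of_block_contract {r U : Finset Λ} (hrU : r ⊆ U) (hr : ∀ i ∈ r, ∀ p ∉ r, i < p)
    {n : ℕ} (g : Λ → G) {e : Finset Λ → Finset Λ → ℝ} (he : ∀ I J, e I J ^ 2 ≤ 1)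
    {c θ χ : Finset Λ → ℝ} (hc : ∀ V, n < V.card → c V = 0) (hχ : ∀ V, n < V.card → χ V = 0)
    (h : ∀ J ⊆ r, ∀ V ⊆ U \ r, block r c J V = ∑ I ∈ (r \ J).powerset,
      e I J * contract (U \ r) (block r θ I) (block r χ (I ∪ J)) V) :
    form U g c ≤ (2 ^ r.card) ^ 3 * 2 ^ n * blockConst r g ^ 2
      * (form U g θ * form U g χ) := by
  have hK := blockConst_nonneg r g
  have hpow : ∀ J ∈ r.powerset, (((r \ J).powerset.card : ℕ) : ℝ) ≤ 2 ^ r.card := by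
    intro J hJ
    rw [Finset.card_powerset]
    exact_mod_cast Nat.pow_le_pow_right (by norm_num) (Finset.card_le_card Finset.sdiff_subset)
  have hb : ∀ (d : Finset Λ → ℝ) (J : Finset Λ), J ⊆ r →
      energy (U \ r) n g (block r d J) ≤ blockConst r g * form U g d := fun d J hJ =>
    (Finset.single_le_sum (f := fun J => energy (U \ r) n g (block r d J))
      (fun _ _ => energy_nonneg _ _ _ _) (Finset.mem_powerset.2 hJ)).trans
      (sum_energy_block_le hrU hr n g d)
  have hs : ∀ I ⊆ r, ∑ B ∈ (U \ r).powerset, block r θ I B ^ 2 ≤ form U g θ := by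
    intro I hI
    refine le_trans ?_ (sum_sq_le_form U g θ)
    rw [sum_powerset_block hrU]
    exact Finset.single_le_sum (f := fun J => ∑ V ∈ (U \ r).powerset, θ ((r \ J) ∪ V) ^ 2)
      (fun _ _ => Finset.sum_nonneg fun _ _ => sq_nonneg _) (Finset.mem_powerset.2 hI)
  have h1 : ∀ J ∈ r.powerset, energy (U \ r) n g (block r c J) ≤ 2 ^ r.card * (2 ^ r.card *
      (2 ^ n * (form U g θ * (blockConst r g * form U g χ)))) := by
    intro J hJ
    rw [energy_congr n g (h J (Finset.mem_powerset.1 hJ))]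
    refine (energy_sum_le _ _ _ _ _ (fun I _ => he _ _) _).trans ?_
    refine mul_le_mul (hpow J hJ) ?_ (Finset.sum_nonneg fun _ _ => energy_nonneg _ _ _ _)
      (by positivity)
    refine (Finset.sum_le_card_nsmul _ _
      (2 ^ n * (form U g θ * (blockConst r g * form U g χ)))
      fun I hI => ?_).trans ?_
    · have hIr := (Finset.mem_powerset.1 hI).trans Finset.sdiff_subset
      refine (energy_contract_le _ _ _ _ _ fun V hV =>
        hχ _ (hV.trans_le (Finset.card_le_card Finset.subset_union_right))).trans ?_
      exact mul_le_mul_of_nonneg_left (mul_le_mul (hs I hIr)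
        (hb _ _ (Finset.union_subset hIr (Finset.mem_powerset.1 hJ)))
        (energy_nonneg _ _ _ _) (form_nonneg _ _ _)) (by positivity)
    · rw [nsmul_eq_mul]
      refine mul_le_mul_of_nonneg_right (hpow J hJ) ?_
      have := form_nonneg U g χ
      have := form_nonneg U g θ
      positivity
  refine (form_le_sum_energy hrU hr g hc).trans ?_
  refine (mul_le_mul_of_nonneg_left (Finset.sum_le_card_nsmul _ _ _ h1) hK).trans_eq ?_
  rw [nsmul_eq_mul, Finset.card_powerset]
  push_cast
  ring

end Form

/-! ### Finite linear combinations of Slater determinants -/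

/-- The coefficients `c`, extended by zero to subsets that are not states. -/
def ext (c : State Λ N →₀ ℝ) (V : Finset Λ) : ℝ := if h : V.card = N then c ⟨V, h⟩ else 0

theorem ext_eq_zero (c : State Λ N →₀ ℝ) {V : Finset Λ} (h : V.card ≠ N) : ext c V = 0 := dif_neg h

theorem ext_apply (c : State Λ N →₀ ℝ) (α : State Λ N) : ext c α.1 = c α := by
  simp [ext, α.2]

@[simp] theorem ext_zero (V : Finset Λ) : ext (0 : State Λ N →₀ ℝ) V = 0 := by simp [ext]

theorem ext_add (c d : State Λ N →₀ ℝ) (V : Finset Λ) : ext (c + d) V = ext c V + ext d V := by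
  unfold ext; split_ifs <;> simp

theorem ext_smul (a : ℝ) (c : State Λ N →₀ ℝ) (V : Finset Λ) : ext (a • c) V = a * ext c V := by
  unfold ext; split_ifs <;> simp

theorem ext_single (α : State Λ N) (a : ℝ) (V : Finset Λ) :
    ext (Finsupp.single α a) V = if V = α.1 then a else 0 := by
  unfold ext
  split_ifs with h h' h'
  · rw [Finsupp.single_apply, if_pos (Subtype.ext h'.symm)]
  · rw [Finsupp.single_apply, if_neg fun e => h' (congrArg Subtype.val e).symm]
  · exact absurd (h' ▸ α.2) h
  · rfl

theorem ext_eq_sum (c : State Λ N →₀ ℝ) (V : Finset Λ) :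
    ext c V = ∑ α ∈ c.support, c α * if V = α.1 then 1 else 0 := by
  have h : ∀ α : State Λ N, c α * (if V = α.1 then 1 else 0) = ext (Finsupp.single α (c α)) V := by
    intro α
    rw [ext_single, mul_ite, mul_one, mul_zero]
  simp only [h]
  unfold ext
  split_ifs with hV
  · rw [← Finsupp.finsetSum_apply]
    conv_lhs => rw [← Finsupp.sum_single c]
    rfl
  · simp

/-- This is the pairing of `a_p Φ_α` with `a_q Φ_β`: each is supported at a single set, the state
without the annihilated orbital. -/
theorem sum_inner_erase {G : Type*} [NormedAddCommGroup G] [InnerProductSpace ℝ G]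
    (g : Λ → G) {U α β : Finset Λ} (hα : α ⊆ U) :
    ∑ γ ∈ U.powerset, inner ℝ (∑ p ∈ α, if γ = α.erase p then crossSign (α.erase p) {p} • g p else 0)
        (∑ q ∈ β, if γ = β.erase q then crossSign (β.erase q) {q} • g q else 0)
      = ∑ p ∈ α, ∑ q ∈ β, if α.erase p = β.erase q then
        crossSign (α.erase p) {p} * crossSign (β.erase q) {q} * inner ℝ (g p) (g q) else 0 := by
  simp only [sum_inner]
  rw [Finset.sum_comm]
  refine Finset.sum_congr rfl fun p _ => ?_
  rw [Finset.sum_eq_single (α.erase p)]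
  · simp only [if_true, inner_sum]
    refine Finset.sum_congr rfl fun q _ => ?_
    split_ifs
    · rw [real_inner_smul_left, real_inner_smul_right, mul_assoc]
    · rw [inner_zero_right]
  · intro γ _ hγ
    rw [if_neg hγ, inner_zero_left]
  · intro h
    exact absurd (Finset.mem_powerset.2 ((Finset.erase_subset _ _).trans hα)) h

theorem grad_ext {G : Type*} [NormedAddCommGroup G] [InnerProductSpace ℝ G] (g : Λ → G)
    {U : Finset Λ} (c : State Λ N →₀ ℝ) (hU : ∀ α ∈ c.support, α.1 ⊆ U) (γ : Finset Λ) :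
    grad U g (ext c) γ = ∑ α ∈ c.support, c α • ∑ p ∈ α.1,
      if γ = α.1.erase p then crossSign (α.1.erase p) {p} • g p else 0 := by
  have h : ext c = fun V => ∑ α ∈ c.support, c α * (fun (α : State Λ N) (V : Finset Λ) =>
      if V = α.1 then (1 : ℝ) else 0) α V := funext (ext_eq_sum c)
  rw [h, grad_sum]
  refine Finset.sum_congr rfl fun α hα => ?_
  congr 1
  rw [grad, ← Finset.sum_subset (hU α hα)]
  · refine Finset.sum_congr rfl fun p hp => ?_
    split_ifs with h
    · subst h
      simp [ann, Finset.insert_erase hp]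
    · rw [ann]
      split_ifs with h1 h2
      · simp
      · exact absurd (by rw [← h2, Finset.erase_insert h1]) h
      · simp
  · intro p _ hp
    rw [ann]
    split_ifs with h1 h2
    · simp
    · exact absurd (h2 ▸ Finset.mem_insert_self p γ) hp
    · simp

/-- This matches `form` with the Gram matrix of `inner_det`. The vectors `g` stay arbitrary, so that
`g = 0` gives the `L²` norm. -/
theorem form_ext {G : Type*} [NormedAddCommGroup G] [InnerProductSpace ℝ G] (g : Λ → G)
    {U : Finset Λ} (c : State Λ N →₀ ℝ) (hU : ∀ α ∈ c.support, α.1 ⊆ U) :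
    form U g (ext c) = ∑ α ∈ c.support, ∑ β ∈ c.support, c α * (c β *
      ((if α = β then 1 else 0) + ∑ p ∈ α.1, ∑ q ∈ β.1, if α.1.erase p = β.1.erase q then
        crossSign (α.1.erase p) {p} * crossSign (β.1.erase q) {q} * inner ℝ (g p) (g q)
        else 0)) := by
  have h1 : ∑ V ∈ U.powerset, ext c V ^ 2 = ∑ α ∈ c.support, ∑ β ∈ c.support, c α * (c β *
      (if α = β then 1 else 0)) := by
    rw [← Finset.sum_subset (s₁ := c.support.map ⟨Subtype.val, Subtype.val_injective⟩)]
    · rw [Finset.sum_map]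
      refine Finset.sum_congr rfl fun α hα => ?_
      rw [← Finset.mul_sum]
      simp only [Function.Embedding.coeFn_mk, ext_apply, mul_ite, mul_one, mul_zero,
        Finset.sum_ite_eq, hα, if_true, sq]
    · intro V hV
      obtain ⟨α, hα, rfl⟩ := Finset.mem_map.1 hV
      exact Finset.mem_powerset.2 (hU α hα)
    · intro V _ hV
      rw [ext_eq_sum, Finset.sum_eq_zero, sq, mul_zero]
      intro α hα
      rw [if_neg, mul_zero]
      rintro rfl
      exact hV (Finset.mem_map_of_mem ⟨Subtype.val, Subtype.val_injective⟩ hα)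
  have h2 : ∑ γ ∈ U.powerset, ‖grad U g (ext c) γ‖ ^ 2
      = ∑ α ∈ c.support, ∑ β ∈ c.support, c α * (c β * ∑ p ∈ α.1, ∑ q ∈ β.1,
        if α.1.erase p = β.1.erase q then
        crossSign (α.1.erase p) {p} * crossSign (β.1.erase q) {q} * inner ℝ (g p) (g q)
        else 0) := by
    simp only [← real_inner_self_eq_norm_sq, grad_ext g c hU]
    have hv := fun (α : State Λ N) (hα : α ∈ c.support) (β : State Λ N) =>
      sum_inner_erase g (β := β.1) (hU α hα)
    -- The gradients of the single determinants are made opaque, so that the inner product expands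
    -- over `α` and `β` but not over the orbitals.
    generalize hw : (fun (α : State Λ N) (γ : Finset Λ) => ∑ p ∈ α.1,
      if γ = α.1.erase p then crossSign (α.1.erase p) {p} • g p else 0) = w
    have hw' : ∀ (α : State Λ N) (γ : Finset Λ), ∑ p ∈ α.1,
      (if γ = α.1.erase p then crossSign (α.1.erase p) {p} • g p else 0) = w α γ :=
      fun α γ => by rw [← hw]
    simp only [hw'] at hv ⊢
    simp only [sum_inner]
    rw [Finset.sum_comm]
    refine Finset.sum_congr rfl fun α hα => ?_
    simp only [inner_sum]
    rw [Finset.sum_comm]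
    refine Finset.sum_congr rfl fun β _ => ?_
    rw [← hv α hα β, Finset.mul_sum, Finset.mul_sum]
    refine Finset.sum_congr rfl fun γ _ => ?_
    rw [real_inner_smul_left, real_inner_smul_right]
  simp only [form, density, Finset.sum_add_distrib, mul_add]
  rw [h1, h2]

/-- The function with the given coefficients. -/
def synth (φ : OrbitalSet Λ) : (State Λ N →₀ ℝ) →ₗ[ℝ] H1K φ N :=
  Finsupp.linearCombination ℝ (det φ)

theorem synth_eq (φ : OrbitalSet Λ) (c : State Λ N →₀ ℝ) :
    synth φ c = ∑ α ∈ c.support, c α • det φ α := rfl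

@[simp] theorem synth_single (φ : OrbitalSet Λ) (α : State Λ N) (a : ℝ) :
    synth φ (Finsupp.single α a) = a • det φ α := by simp [synth]

theorem norm_synth_sq (φ : OrbitalSet Λ) (hN : 1 ≤ N) {U : Finset Λ} (c : State Λ N →₀ ℝ)
    (hU : ∀ α ∈ c.support, α.1 ⊆ U) : ‖synth φ c‖ ^ 2 = form U φ.grad (ext c) := by
  rw [← real_inner_self_eq_norm_sq, form_ext _ _ hU, synth_eq, sum_inner]
  refine Finset.sum_congr rfl fun α _ => ?_
  rw [inner_sum]
  refine Finset.sum_congr rfl fun β _ => ?_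
  rw [real_inner_smul_left, real_inner_smul_right, inner_det φ hN]

theorem norm_toL2_synth_sq (φ : OrbitalSet Λ) {U : Finset Λ} (c : State Λ N →₀ ℝ)
    (hU : ∀ α ∈ c.support, α.1 ⊆ U) :
    ‖toL2 φ N (synth φ c)‖ ^ 2 = form U (fun _ => (0 : ℝ)) (ext c) := by
  rw [← real_inner_self_eq_norm_sq, form_ext _ _ hU, synth_eq, map_sum, sum_inner]
  refine Finset.sum_congr rfl fun α _ => ?_
  rw [inner_sum]
  refine Finset.sum_congr rfl fun β _ => ?_
  rw [map_smul, map_smul, real_inner_smul_left, real_inner_smul_right]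
  have := l2inner_det φ α β
  rw [l2inner] at this
  rw [this]
  simp

/-- The topology of `𝔥¹_K` is induced from `𝔥¹`, so the closure defining the space can be taken
inside it. -/
theorem denseRange_synth (φ : OrbitalSet Λ) : DenseRange (synth (N := N) φ) := by
  intro x
  have hx : x.1 ∈ closure (Submodule.span ℝ (Set.range (slater (N := N) φ)) : Set (FermiH1 N)) :=
    x.2
  have hi : Topology.IsInducing (Subtype.val : galerkin φ N → FermiH1 N) :=
    Topology.IsInducing.subtypeVal
  have : x ∈ closure (Set.range (synth (N := N) φ)) := by
    refine (hi.closure_eq_preimage_closure_image _).ge ?_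
    refine closure_mono ?_ hx
    intro y hy
    obtain ⟨c, rfl⟩ := (Finsupp.mem_span_range_iff_exists_finsupp).1 hy
    refine ⟨synth φ c, ⟨c, rfl⟩, ?_⟩
    rw [synth_eq]
    exact map_sum (galerkin φ N).subtype _ _
  exact this

/-! ### The coefficients of excited states -/

/-- The factor of the excitation that empties `I`, applied to a state in which `J` is vacated. -/
def excCoeff (ε : Finset Λ → Finset Λ → ℤˣ) (I J : Finset Λ) : ℝ :=
  if I = ∅ then 0 else ((ε I J : ℤ) : ℝ)

theorem excCoeff_sq_le (ε : Finset Λ → Finset Λ → ℤˣ) (I J : Finset Λ) :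
    excCoeff ε I J ^ 2 ≤ 1 := by
  unfold excCoeff
  split_ifs
  · norm_num
  · rw [← Int.cast_pow, ← Units.val_pow_eq_pow_val, Int.units_sq]
    simp

open Classical in
/-- The coefficients of `X_α Φ_β`. -/
def excitedCoeff (ε : Finset Λ → Finset Λ → ℤˣ) (r α β : State Λ N) : State Λ N →₀ ℝ :=
  if h : IsEdge r α β then Finsupp.single (join h) ((excSign ε r α β : ℤ) : ℝ) else 0

theorem synth_excitedCoeff (φ : OrbitalSet Λ) (ε : Finset Λ → Finset Λ → ℤˣ) (r α β : State Λ N) :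
    synth φ (excitedCoeff ε r α β) = excited φ ε r α β := by
  unfold excitedCoeff excited
  split_ifs <;> simp

theorem sdiff_eq_empty_iff_eq {r α : State Λ N} : r.1 \ α.1 = ∅ ↔ α = r := by
  rw [Finset.sdiff_eq_empty_iff_subset]
  constructor
  · intro h
    exact Subtype.ext (Finset.eq_of_subset_of_card_le h (by rw [α.2, r.2])).symm
  · rintro rfl
    exact subset_rfl

/-- In terms of holes, the occupied parts cover `r` exactly when no orbital is vacated twice, and `α
≠ r` says that `α` vacates something. -/
theorem isEdge_iff {r α β : State Λ N} : IsEdge r α β ↔ r.1 \ α.1 ≠ ∅ ∧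
    Disjoint (r.1 \ α.1) (r.1 \ β.1) ∧ Disjoint (α.1 \ r.1) (β.1 \ r.1) := by
  rw [IsEdge, Ne, Ne, sdiff_eq_empty_iff_eq, Finset.card_eq_zero, ← Finset.disjoint_iff_inter_eq_empty]
  have : (occ r.1 α.1 ∪ occ r.1 β.1).card = N ↔ Disjoint (r.1 \ α.1) (r.1 \ β.1) := by
    have hsub : occ r.1 α.1 ∪ occ r.1 β.1 ⊆ r.1 :=
      Finset.union_subset Finset.inter_subset_right Finset.inter_subset_right
    have h1 : (occ r.1 α.1 ∪ occ r.1 β.1).card = N ↔ r.1 ⊆ occ r.1 α.1 ∪ occ r.1 β.1 := by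
      constructor
      · intro h
        exact (Finset.eq_of_subset_of_card_le hsub (by rw [h, r.2])).ge
      · intro h
        rw [hsub.antisymm h, r.2]
    rw [h1, Finset.disjoint_left]
    refine forall_congr' fun x => ?_
    simp only [occ, Finset.mem_union, Finset.mem_inter, Finset.mem_sdiff]
    tauto
  rw [this]
  rfl

theorem joinSet_eq (r α β : Finset Λ) :
    joinSet r α β = (r \ (r \ α ∪ r \ β)) ∪ (α \ r ∪ β \ r) := by
  ext x
  simp only [joinSet, occ, virt, Finset.mem_union, Finset.mem_inter, Finset.mem_sdiff]
  tauto

/-- The relation between the occupied and virtual parts of states that makes `X_α Φ_β` a multiple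
of a third determinant. -/
def Splits (I A J B K C : Finset Λ) : Prop := Disjoint I J ∧ K = I ∪ J ∧ Disjoint A B ∧ C = A ∪ B

open Classical in
-- An excitation unites the vacated sets and the virtual sets, both disjointly. The value `0` of
-- `excCoeff` at `I = ∅` absorbs the condition `α ≠ r`, so the formula needs no restriction on the
-- label.
theorem ext_excitedCoeff (ε : Finset Λ → Finset Λ → ℤˣ) (r α β : State Λ N) {J V : Finset Λ}
    (hJ : J ⊆ r.1) (hV : Disjoint V r.1) :
    ext (excitedCoeff ε r α β) ((r.1 \ J) ∪ V) =
      if Splits (r.1 \ α.1) (α.1 \ r.1) (r.1 \ β.1) (β.1 \ r.1) J V then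
        excCoeff ε (r.1 \ α.1) (r.1 \ β.1) * crossSign (β.1 \ r.1) (α.1 \ r.1) else 0 := by
  by_cases h : IsEdge r α β
  · have h' := isEdge_iff.1 h
    rw [excitedCoeff, dif_pos h, ext_single]
    have e1 : (r.1 \ J) ∪ V = (join h).1 ↔
        Splits (r.1 \ α.1) (α.1 \ r.1) (r.1 \ β.1) (β.1 \ r.1) J V := by
      have hd : Disjoint (α.1 \ r.1 ∪ β.1 \ r.1) r.1 :=
        Finset.disjoint_union_left.2 ⟨Finset.sdiff_disjoint, Finset.sdiff_disjoint⟩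
      have hs := sdiff_block (r := r.1) (J := r.1 \ α.1 ∪ r.1 \ β.1)
        (Finset.union_subset Finset.sdiff_subset Finset.sdiff_subset) hd
      rw [show (join h).1 = joinSet r.1 α.1 β.1 from rfl, joinSet_eq, block_eq_iff hJ hV, hs.1, hs.2]
      exact ⟨fun ⟨a, b⟩ => ⟨h'.2.1, a, h'.2.2, b⟩, fun ⟨_, a, _, b⟩ => ⟨a, b⟩⟩
    have e2 : ((excSign ε r α β : ℤ) : ℝ)
        = excCoeff ε (r.1 \ α.1) (r.1 \ β.1) * crossSign (β.1 \ r.1) (α.1 \ r.1) := by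
      rw [excSign, excCoeff, if_neg h'.1, Units.val_mul, Int.cast_mul,
        virt, virt, sortSign_eq_crossSign h'.2.2.symm, mul_comm]
    rw [e2]
    simp only [e1]
  · rw [excitedCoeff, dif_neg h, ext_zero]
    split_ifs with hs
    · have : r.1 \ α.1 = ∅ := by
        by_contra hne
        exact h (isEdge_iff.2 ⟨hne, hs.1, hs.2.2.1⟩)
      rw [excCoeff, if_pos this, zero_mul]
    · rfl

open Classical in
theorem excitedCoeff_apply (ε : Finset Λ → Finset Λ → ℤˣ) (r α β δ : State Λ N) :
    excitedCoeff ε r α β δ =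
      if Splits (r.1 \ α.1) (α.1 \ r.1) (r.1 \ β.1) (β.1 \ r.1) (r.1 \ δ.1) (δ.1 \ r.1) then
        excCoeff ε (r.1 \ α.1) (r.1 \ β.1) * crossSign (β.1 \ r.1) (α.1 \ r.1) else 0 := by
  rw [← ext_excitedCoeff ε r α β Finset.sdiff_subset Finset.sdiff_disjoint, block_sdiff]
  exact (ext_apply _ δ).symm

/-! ### The action of cluster operators on finite linear combinations -/

/-- The coefficients of `T ψ`, where `T` is the cluster operator with the amplitudes `θ`. -/
def bilCoeff (ε : Finset Λ → Finset Λ → ℤˣ) (r : State Λ N) :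
    (State Λ N →₀ ℝ) →ₗ[ℝ] (State Λ N →₀ ℝ) →ₗ[ℝ] (State Λ N →₀ ℝ) :=
  Finsupp.linearCombination ℝ fun α => Finsupp.linearCombination ℝ (excitedCoeff ε r α)

theorem bilCoeff_single (ε : Finset Λ → Finset Λ → ℤˣ) (r α β : State Λ N) (a b : ℝ) :
    bilCoeff ε r (Finsupp.single α a) (Finsupp.single β b) = (a * b) • excitedCoeff ε r α β := by
  simp [bilCoeff, smul_smul]

/-- A fixed target can be reached only from states and excitations built from its own virtual
orbitals and `r`. This finiteness makes the transpose act on finite combinations, also for infinite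
`Λ`. -/
theorem subset_of_excitedCoeff_ne_zero {ε : Finset Λ → Finset Λ → ℤˣ} {r α β δ : State Λ N}
    (h : excitedCoeff ε r α β δ ≠ 0) : α.1 ⊆ r.1 ∪ δ.1 ∧ β.1 ⊆ r.1 ∪ δ.1 := by
  classical
  rw [excitedCoeff_apply] at h
  have hs := (ite_ne_right_iff.1 h).1
  have h1 : α.1 \ r.1 ⊆ δ.1 \ r.1 := by rw [hs.2.2.2]; exact Finset.subset_union_left
  have h2 : β.1 \ r.1 ⊆ δ.1 \ r.1 := by rw [hs.2.2.2]; exact Finset.subset_union_right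
  exact ⟨sdiff_le_iff.1 (h1.trans Finset.sdiff_subset),
    sdiff_le_iff.1 (h2.trans Finset.sdiff_subset)⟩

/-- The states contained in `U`. -/
def statesIn (N : ℕ) (U : Finset Λ) : Finset (State Λ N) := Finset.subtype _ U.powerset

theorem mem_statesIn {U : Finset Λ} {α : State Λ N} : α ∈ statesIn N U ↔ α.1 ⊆ U := by
  simp [statesIn]

/-- The coefficients of the adjoint of `X_α`, applied to `Φ_δ`. -/
def deexcitedCoeff (ε : Finset Λ → Finset Λ → ℤˣ) (r α δ : State Λ N) : State Λ N →₀ ℝ :=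
  Finsupp.onFinset (statesIn N (r.1 ∪ δ.1)) (fun β => excitedCoeff ε r α β δ) fun _ h =>
    mem_statesIn.2 (subset_of_excitedCoeff_ne_zero h).2

/-- The coefficients of `T† χ`, where `T` is the cluster operator with the amplitudes `θ`. -/
def adjCoeff (ε : Finset Λ → Finset Λ → ℤˣ) (r : State Λ N) :
    (State Λ N →₀ ℝ) →ₗ[ℝ] (State Λ N →₀ ℝ) →ₗ[ℝ] (State Λ N →₀ ℝ) :=
  Finsupp.linearCombination ℝ fun α => Finsupp.linearCombination ℝ (deexcitedCoeff ε r α)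

theorem adjCoeff_single (ε : Finset Λ → Finset Λ → ℤˣ) (r α δ : State Λ N) (a d : ℝ) :
    adjCoeff ε r (Finsupp.single α a) (Finsupp.single δ d) = (a * d) • deexcitedCoeff ε r α δ := by
  simp [adjCoeff, smul_smul]

theorem block_add (r : Finset Λ) (c d : State Λ N →₀ ℝ) (J V : Finset Λ) :
    block r (ext (c + d)) J V = block r (ext c) J V + block r (ext d) J V := ext_add _ _ _

theorem block_zero (r : Finset Λ) (J V : Finset Λ) :
    block r (ext (0 : State Λ N →₀ ℝ)) J V = 0 := ext_zero _

theorem block_single {r J V : Finset Λ} (α : State Λ N) (a : ℝ) (hJ : J ⊆ r)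
    (hV : Disjoint V r) : block r (ext (Finsupp.single α a)) J V
      = if J = r \ α.1 ∧ V = α.1 \ r then a else 0 := by
  rw [block, ext_single]
  simp only [block_eq_iff hJ hV]

/-- For single determinants exactly one splitting of `J` and `V` survives. The factor of `ψ` stands
on the left because the virtual sign sorts `β \ r` before `α \ r`. -/
theorem block_bilCoeff (ε : Finset Λ → Finset Λ → ℤˣ) (r : State Λ N) (θ ψ : State Λ N →₀ ℝ)
    {J V : Finset Λ} (hJ : J ⊆ r.1) (hV : Disjoint V r.1) :
    block r.1 (ext (bilCoeff ε r θ ψ)) J V = ∑ I ∈ J.powerset, excCoeff ε I (J \ I) *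
      wedge (block r.1 (ext ψ) (J \ I)) (block r.1 (ext θ) I) V := by
  classical
  unfold wedge
  induction θ using Finsupp.induction_linear with
  | zero => simp [block_zero]
  | add θ θ' h h' =>
    rw [map_add, LinearMap.add_apply, block_add, h, h']
    simp only [block_add, mul_add, Finset.sum_add_distrib]
  | single α a =>
    induction ψ using Finsupp.induction_linear with
    | zero => simp [block_zero]
    | add ψ ψ' h h' =>
      rw [map_add, block_add, h, h']
      simp only [block_add, mul_add, add_mul, Finset.sum_add_distrib]
    | single β b =>
      have hsub : ∀ I ∈ J.powerset, I ⊆ r.1 := fun I hI => (Finset.mem_powerset.1 hI).trans hJ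
      have hdis : ∀ A ∈ V.powerset, Disjoint A r.1 := fun A hA =>
        Finset.disjoint_of_subset_left (Finset.mem_powerset.1 hA) hV
      have hterm : ∀ I ∈ J.powerset, ∀ A ∈ V.powerset,
          block r.1 (ext (Finsupp.single β b)) (J \ I) A *
            block r.1 (ext (Finsupp.single α a)) I (V \ A) =
          if (J \ I = r.1 \ β.1 ∧ A = β.1 \ r.1) ∧ I = r.1 \ α.1 ∧ V \ A = α.1 \ r.1
            then b * a else 0 := by
        intro I hI A hA
        rw [block_single _ _ (Finset.sdiff_subset.trans hJ) (hdis A hA),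
          block_single _ _ (hsub I hI) (Finset.disjoint_of_subset_left Finset.sdiff_subset hV)]
        simp only [ite_and, ite_mul, mul_ite, zero_mul, mul_zero]
        split_ifs <;> rfl
      rw [bilCoeff_single, block, ext_smul, ext_excitedCoeff ε r α β hJ hV]
      split_ifs with hs
      · obtain ⟨h1, rfl, h2, rfl⟩ := hs
        have e1 : (r.1 \ α.1 ∪ r.1 \ β.1) \ (r.1 \ α.1) = r.1 \ β.1 :=
          Finset.union_sdiff_cancel_left h1
        have e2 : (α.1 \ r.1 ∪ β.1 \ r.1) \ (β.1 \ r.1) = α.1 \ r.1 :=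
          Finset.union_sdiff_cancel_right h2
        have m1 : r.1 \ α.1 ∈ (r.1 \ α.1 ∪ r.1 \ β.1).powerset :=
          Finset.mem_powerset.2 Finset.subset_union_left
        have m2 : β.1 \ r.1 ∈ (α.1 \ r.1 ∪ β.1 \ r.1).powerset :=
          Finset.mem_powerset.2 Finset.subset_union_right
        rw [Finset.sum_eq_single_of_mem _ m1, Finset.sum_eq_single_of_mem _ m2, hterm _ m1 _ m2,
          if_pos ⟨⟨e1, rfl⟩, rfl, e2⟩, e1, e2]
        · ring
        · intro A hA hne
          rw [hterm _ m1 A hA, if_neg (fun h => hne h.1.2), mul_zero]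
        · intro I hI hne
          rw [Finset.sum_eq_zero, mul_zero]
          intro A hA
          rw [hterm I hI A hA, if_neg (fun h => hne h.2.1), mul_zero]
      · rw [mul_zero]
        refine (Finset.sum_eq_zero fun I hI => ?_).symm
        rw [Finset.sum_eq_zero, mul_zero]
        intro A hA
        rw [hterm I hI A hA, if_neg, mul_zero]
        rintro ⟨⟨h1, h2⟩, h3, h4⟩
        refine hs ⟨?_, ?_, ?_, ?_⟩
        · rw [← h1, ← h3]; exact Finset.disjoint_sdiff
        · rw [← h1, ← h3, Finset.union_sdiff_of_subset (Finset.mem_powerset.1 hI)]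
        · rw [← h2, ← h4]; exact Finset.sdiff_disjoint
        · rw [← h2, ← h4, Finset.sdiff_union_of_subset (Finset.mem_powerset.1 hA)]

/-- Removing as many virtual orbitals as holes preserves the particle number, so the transposed
formula never meets a set that is not a state. -/
theorem card_of_splits {r α δ : State Λ N} {J V : Finset Λ} (hJ : J ⊆ r.1) (hV : Disjoint V r.1)
    (hs : Splits (r.1 \ α.1) (α.1 \ r.1) J V (r.1 \ δ.1) (δ.1 \ r.1)) :
    ((r.1 \ J) ∪ V).card = N := by
  obtain ⟨h1, h2, h3, h4⟩ := hs
  have c2 := congrArg Finset.card h2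
  have c4 := congrArg Finset.card h4
  rw [Finset.card_union_of_disjoint h1] at c2
  rw [Finset.card_union_of_disjoint h3] at c4
  have hα := Finset.card_sdiff_add_card_inter r.1 α.1
  have hα' := Finset.card_sdiff_add_card_inter α.1 r.1
  have hδ := Finset.card_sdiff_add_card_inter r.1 δ.1
  have hδ' := Finset.card_sdiff_add_card_inter δ.1 r.1
  rw [Finset.inter_comm] at hα' hδ'
  have hJ' := Finset.card_sdiff_add_card_eq_card hJ
  rw [Finset.card_union_of_disjoint
    (Finset.disjoint_of_subset_left Finset.sdiff_subset hV.symm)]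
  have := r.2
  have := α.2
  have := δ.2
  omega

open Classical in
theorem ext_deexcitedCoeff (ε : Finset Λ → Finset Λ → ℤˣ) (r α δ : State Λ N) {J V : Finset Λ}
    (hJ : J ⊆ r.1) (hV : Disjoint V r.1) :
    ext (deexcitedCoeff ε r α δ) ((r.1 \ J) ∪ V) =
      if Splits (r.1 \ α.1) (α.1 \ r.1) J V (r.1 \ δ.1) (δ.1 \ r.1) then
        excCoeff ε (r.1 \ α.1) J * crossSign V (α.1 \ r.1) else 0 := by
  by_cases hc : ((r.1 \ J) ∪ V).card = N
  · have h := excitedCoeff_apply ε r α ⟨(r.1 \ J) ∪ V, hc⟩ δ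
    have hs := sdiff_block hJ hV
    simp only [hs.1, hs.2] at h
    rw [← h]
    exact ext_apply (deexcitedCoeff ε r α δ) ⟨(r.1 \ J) ∪ V, hc⟩
  · rw [ext_eq_zero _ hc, if_neg fun hs => hc (card_of_splits hJ hV hs)]

/-- The contraction sees only subsets of `U`, hence `U` has to contain the states occurring in `χ`.
-/
theorem block_adjCoeff (ε : Finset Λ → Finset Λ → ℤˣ) (r : State Λ N) (θ χ : State Λ N →₀ ℝ)
    {U : Finset Λ} (hU : ∀ δ ∈ χ.support, δ.1 ⊆ U) {J V : Finset Λ} (hJ : J ⊆ r.1)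
    (hV : V ⊆ U \ r.1) :
    block r.1 (ext (adjCoeff ε r θ χ)) J V = ∑ I ∈ (r.1 \ J).powerset, excCoeff ε I J *
      contract (U \ r.1) (block r.1 (ext θ) I) (block r.1 (ext χ) (I ∪ J)) V := by
  classical
  unfold contract
  have hVr : Disjoint V r.1 := Finset.disjoint_of_subset_left hV Finset.sdiff_disjoint
  induction θ using Finsupp.induction_linear with
  | zero => simp [block_zero]
  | add θ θ' h h' =>
    rw [map_add, LinearMap.add_apply, block_add, h, h']
    simp only [block_add, mul_add, add_mul, Finset.sum_add_distrib]
  | single α a =>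
    -- In this form of induction the supports are disjoint, so the inclusion in `U` passes to both
    -- summands.
    induction χ using Finsupp.induction with
    | zero => simp [block_zero]
    | single_add δ d χ hδ hd ih =>
      have hsupp : (Finsupp.single δ d + χ).support = insert δ χ.support :=
        by rw [Finsupp.support_single_add hδ hd, Finset.cons_eq_insert]
      rw [map_add, block_add, ih fun x hx => hU x (by rw [hsupp]; exact Finset.mem_insert_of_mem hx)]
      simp only [block_add, mul_add, Finset.sum_add_distrib, add_left_inj]
      have hδU : δ.1 ⊆ U := hU δ (by rw [hsupp]; exact Finset.mem_insert_self _ _)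
      have hterm : ∀ I ∈ (r.1 \ J).powerset, ∀ B ∈ ((U \ r.1) \ V).powerset,
          block r.1 (ext (Finsupp.single α a)) I B *
            block r.1 (ext (Finsupp.single δ d)) (I ∪ J) (V ∪ B) =
          if (I = r.1 \ α.1 ∧ B = α.1 \ r.1) ∧ I ∪ J = r.1 \ δ.1 ∧ V ∪ B = δ.1 \ r.1
            then a * d else 0 := by
        intro I hI B hB
        have hIr : I ⊆ r.1 := (Finset.mem_powerset.1 hI).trans Finset.sdiff_subset
        have hBr : Disjoint B r.1 := Finset.disjoint_of_subset_left
          ((Finset.mem_powerset.1 hB).trans Finset.sdiff_subset) Finset.sdiff_disjoint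
        rw [block_single _ _ hIr hBr, block_single _ _ (Finset.union_subset hIr hJ)
          (Finset.disjoint_union_left.2 ⟨hVr, hBr⟩)]
        simp only [ite_and, ite_mul, mul_ite, zero_mul, mul_zero]
        split_ifs <;> rfl
      rw [adjCoeff_single, block, ext_smul, ext_deexcitedCoeff ε r α δ hJ hVr]
      split_ifs with hs
      · obtain ⟨h1, h2, h3, h4⟩ := hs
        have m1 : r.1 \ α.1 ∈ (r.1 \ J).powerset := Finset.mem_powerset.2
          (Finset.subset_sdiff.2 ⟨Finset.sdiff_subset, h1⟩)
        have m2 : α.1 \ r.1 ∈ ((U \ r.1) \ V).powerset := by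
          refine Finset.mem_powerset.2 (Finset.subset_sdiff.2 ⟨?_, h3⟩)
          refine Finset.Subset.trans ?_ (Finset.sdiff_subset_sdiff hδU le_rfl)
          rw [h4]
          exact Finset.subset_union_left
        rw [Finset.sum_eq_single_of_mem _ m1, Finset.sum_eq_single_of_mem _ m2, hterm _ m1 _ m2,
          if_pos ⟨⟨rfl, rfl⟩, h2.symm, by rw [h4, Finset.union_comm]⟩]
        · ring
        · intro B hB hne
          rw [hterm _ m1 B hB, if_neg (fun h => hne h.1.2), mul_zero]
        · intro I hI hne
          rw [Finset.sum_eq_zero, mul_zero]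
          intro B hB
          rw [hterm I hI B hB, if_neg (fun h => hne h.1.1), mul_zero]
      · rw [mul_zero]
        refine (Finset.sum_eq_zero fun I hI => ?_).symm
        rw [Finset.sum_eq_zero, mul_zero]
        intro B hB
        rw [hterm I hI B hB, if_neg, mul_zero]
        rintro ⟨⟨h1, h2⟩, h3, h4⟩
        refine hs ⟨?_, ?_, ?_, ?_⟩
        · rw [← h1]
          exact Finset.disjoint_of_subset_left (Finset.mem_powerset.1 hI) Finset.sdiff_disjoint
        · rw [← h3, ← h1]
        · rw [← h2]
          exact Finset.disjoint_of_subset_left (Finset.mem_powerset.1 hB) Finset.sdiff_disjoint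
        · rw [← h4, ← h2, Finset.union_comm]

/-- A finite set of orbitals that contains the supports of finitely many states. -/
theorem exists_orbitals (r : State Λ N) (s : Finset (State Λ N)) :
    ∃ U : Finset Λ, r.1 ⊆ U ∧ ∀ α ∈ s, α.1 ⊆ U :=
  ⟨r.1 ∪ s.biUnion Subtype.val, Finset.subset_union_left, fun _ hα =>
    (Finset.subset_biUnion_of_mem Subtype.val hα).trans Finset.subset_union_right⟩

/-- A uniform constant for the estimates of cluster operators and their adjoints. -/
def opConst {G : Type*} [NormedAddCommGroup G] (r : State Λ N) (g : Λ → G) : ℝ :=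
  (2 ^ r.1.card) ^ 3 * 2 ^ (N + 1) * blockConst r.1 g ^ 3

theorem form_bilCoeff_le {G : Type*} [NormedAddCommGroup G] [InnerProductSpace ℝ G] (g : Λ → G)
    (ε : Finset Λ → Finset Λ → ℤˣ) (r : State Λ N) (hr : ∀ i ∈ r.1, ∀ p ∉ r.1, i < p)
    {U : Finset Λ} (hrU : r.1 ⊆ U) (θ ψ : State Λ N →₀ ℝ) :
    form U g (ext (bilCoeff ε r θ ψ))
      ≤ opConst r g * (form U g (ext θ) * form U g (ext ψ)) := by
  refine form_le_of_block_wedge hrU hr (n := N) g (excCoeff_sq_le ε)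
    (fun V hV => ext_eq_zero _ hV.ne') fun J hJ V hV => block_bilCoeff ε r θ ψ hJ
      (Finset.disjoint_of_subset_left hV Finset.sdiff_disjoint)

theorem form_adjCoeff_le {G : Type*} [NormedAddCommGroup G] [InnerProductSpace ℝ G] (g : Λ → G)
    (ε : Finset Λ → Finset Λ → ℤˣ) (r : State Λ N) (hr : ∀ i ∈ r.1, ∀ p ∉ r.1, i < p)
    {U : Finset Λ} (hrU : r.1 ⊆ U) (θ χ : State Λ N →₀ ℝ) (hU : ∀ δ ∈ χ.support, δ.1 ⊆ U) :
    form U g (ext (adjCoeff ε r θ χ))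
      ≤ ((2 ^ r.1.card) ^ 3 * 2 ^ N * blockConst r.1 g ^ 2)
        * (form U g (ext θ) * form U g (ext χ)) :=
  form_le_of_block_contract hrU hr (n := N) g (excCoeff_sq_le ε)
    (fun _ hV => ext_eq_zero _ hV.ne') (fun _ hV => ext_eq_zero _ hV.ne')
    fun _ hJ _ hV => block_adjCoeff ε r θ χ hU hJ hV

/-- The finite set `U` depends on the coefficients, but the constant of `form_bilCoeff_le` does not.
-/
theorem exists_norm_bilCoeff_le (φ : OrbitalSet Λ) (hN : 1 ≤ N) (ε : Finset Λ → Finset Λ → ℤˣ)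
    (r : State Λ N) (hr : ∀ i ∈ r.1, ∀ p ∉ r.1, i < p) :
    ∃ C, 0 ≤ C ∧ ∀ θ ψ, ‖synth φ (bilCoeff ε r θ ψ)‖ ≤ C * (‖synth φ θ‖ * ‖synth φ ψ‖) := by
  have hK := blockConst_nonneg r.1 φ.grad
  refine ⟨Real.sqrt (opConst r φ.grad), Real.sqrt_nonneg _, fun θ ψ => ?_⟩
  obtain ⟨U, hrU, hU⟩ := exists_orbitals r
    ((bilCoeff ε r θ ψ).support ∪ (θ.support ∪ ψ.support))
  simp only [Finset.mem_union] at hU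
  have h := form_bilCoeff_le φ.grad ε r hr hrU θ ψ
  rw [← norm_synth_sq φ hN _ fun α hα => hU α (Or.inl hα),
    ← norm_synth_sq φ hN _ fun α hα => hU α (Or.inr (Or.inl hα)),
    ← norm_synth_sq φ hN _ fun α hα => hU α (Or.inr (Or.inr hα))] at h
  refine (pow_le_pow_iff_left₀ (norm_nonneg _) (by positivity) two_ne_zero).1 ?_
  rw [mul_pow, mul_pow, Real.sq_sqrt (by unfold opConst; positivity)]
  exact h

theorem exists_norm_toL2_bilCoeff_le (φ : OrbitalSet Λ) (ε : Finset Λ → Finset Λ → ℤˣ)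
    (r : State Λ N) (hr : ∀ i ∈ r.1, ∀ p ∉ r.1, i < p) :
    ∃ C, 0 ≤ C ∧ ∀ θ ψ, ‖toL2 φ N (synth φ (bilCoeff ε r θ ψ))‖
      ≤ C * (‖toL2 φ N (synth φ θ)‖ * ‖toL2 φ N (synth φ ψ)‖) := by
  have hK := blockConst_nonneg r.1 (fun _ : Λ => (0 : ℝ))
  refine ⟨Real.sqrt (opConst r (fun _ : Λ => (0 : ℝ))), Real.sqrt_nonneg _, fun θ ψ => ?_⟩
  obtain ⟨U, hrU, hU⟩ := exists_orbitals r
    ((bilCoeff ε r θ ψ).support ∪ (θ.support ∪ ψ.support))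
  simp only [Finset.mem_union] at hU
  have h := form_bilCoeff_le (fun _ : Λ => (0 : ℝ)) ε r hr hrU θ ψ
  rw [← norm_toL2_synth_sq φ _ fun α hα => hU α (Or.inl hα),
    ← norm_toL2_synth_sq φ _ fun α hα => hU α (Or.inr (Or.inl hα)),
    ← norm_toL2_synth_sq φ _ fun α hα => hU α (Or.inr (Or.inr hα))] at h
  refine (pow_le_pow_iff_left₀ (norm_nonneg _) (by positivity) two_ne_zero).1 ?_
  rw [mul_pow, mul_pow, Real.sq_sqrt (by unfold opConst; positivity)]
  exact h

theorem exists_norm_adjCoeff_le (φ : OrbitalSet Λ) (hN : 1 ≤ N) (ε : Finset Λ → Finset Λ → ℤˣ)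
    (r : State Λ N) (hr : ∀ i ∈ r.1, ∀ p ∉ r.1, i < p) :
    ∃ C, 0 ≤ C ∧ ∀ θ χ, ‖synth φ (adjCoeff ε r θ χ)‖ ≤ C * (‖synth φ θ‖ * ‖synth φ χ‖) := by
  have hK := blockConst_nonneg r.1 φ.grad
  refine ⟨Real.sqrt ((2 ^ r.1.card) ^ 3 * 2 ^ N * blockConst r.1 φ.grad ^ 2), Real.sqrt_nonneg _,
    fun θ χ => ?_⟩
  obtain ⟨U, hrU, hU⟩ := exists_orbitals r
    ((adjCoeff ε r θ χ).support ∪ (θ.support ∪ χ.support))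
  simp only [Finset.mem_union] at hU
  have h := form_adjCoeff_le φ.grad ε r hr hrU θ χ fun α hα => hU α (Or.inr (Or.inr hα))
  rw [← norm_synth_sq φ hN _ fun α hα => hU α (Or.inl hα),
    ← norm_synth_sq φ hN _ fun α hα => hU α (Or.inr (Or.inl hα)),
    ← norm_synth_sq φ hN _ fun α hα => hU α (Or.inr (Or.inr hα))] at h
  refine (pow_le_pow_iff_left₀ (norm_nonneg _) (by positivity) two_ne_zero).1 ?_
  rw [mul_pow, mul_pow, Real.sq_sqrt (by positivity)]
  exact h

/-! ### Completeness -/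

/-- For each test function the condition equates two continuous functionals, both being `L²` inner
products with fixed functions. -/
theorem isClosed_hasWeakDeriv {X : Type*} [TopologicalSpace X] (f g : X → L2 (Config N))
    (hf : Continuous f) (hg : Continuous g) (v : Config N) :
    IsClosed {x | HasWeakDeriv (f x) (g x) v} := by
  have key : ∀ (χ : Config N → ℝ) (hχ : MemLp χ 2 volume) (u : L2 (Config N)),
      ∫ x, u x * χ x = inner ℝ (hχ.toLp χ) u := by
    intro χ hχ u
    rw [L2.inner_def]
    refine integral_congr_ae ?_
    filter_upwards [hχ.coeFn_toLp] with x hx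
    rw [hx]
    simp
  have hset : {x | HasWeakDeriv (f x) (g x) v} = ⋂ ψ : Config N → ℝ, ⋂ _ : ContDiff ℝ ∞ ψ,
      ⋂ _ : HasCompactSupport ψ,
      {x | ∫ y, f x y * fderiv ℝ ψ y v = - ∫ y, g x y * ψ y} := by
    ext x
    simp [HasWeakDeriv]
  rw [hset]
  refine isClosed_iInter fun ψ => isClosed_iInter fun hψ => isClosed_iInter fun hc => ?_
  have m1 : MemLp (fun y => fderiv ℝ ψ y v) 2 (volume : Measure (Config N)) :=
    Continuous.memLp_of_hasCompactSupport
      ((hψ.continuous_fderiv (by simp)).clm_apply continuous_const)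
      ((hc.fderiv (𝕜 := ℝ)).comp_left (g := fun L : Config N →L[ℝ] ℝ => L v) rfl)
  have m2 : MemLp ψ 2 (volume : Measure (Config N)) :=
    hψ.continuous.memLp_of_hasCompactSupport hc
  simp only [key _ m1, key _ m2]
  exact isClosed_eq (by fun_prop) (by fun_prop)

theorem measurePreserving_perm (σ : Equiv.Perm (Fin N)) :
    MeasurePreserving (fun X : Config N => X ∘ σ) volume volume := by
  have h := volume_measurePreserving_piCongrLeft (fun _ : Fin N => R3) σ⁻¹
  convert h using 1
  funext X
  funext i
  have := MeasurableEquiv.piCongrLeft_apply_apply (β := fun _ : Fin N => R3) σ⁻¹ X (σ i)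
  simpa using this.symm

theorem isClosed_isAntisymm : IsClosed {u : L2 (Config N) | IsAntisymm u} := by
  have hset : {u : L2 (Config N) | IsAntisymm u} = ⋂ σ : Equiv.Perm (Fin N),
      {u | Lp.compMeasurePreserving _ (measurePreserving_perm σ) u
        = ((Equiv.Perm.sign σ : ℤ) : ℝ) • u} := by
    ext u
    simp only [Set.mem_iInter]
    refine forall_congr' fun σ => ?_
    rw [Set.mem_ofPred_eq, Lp.ext_iff]
    have h1 := Lp.coeFn_compMeasurePreserving u (measurePreserving_perm σ)
    have h2 := Lp.coeFn_smul ((Equiv.Perm.sign σ : ℤ) : ℝ) u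
    constructor
    · intro h
      filter_upwards [h1, h2, h] with X a b c
      rw [a, b, Function.comp_apply, c]
      rfl
    · intro h
      filter_upwards [h1, h2, h] with X a b c
      rw [a, b] at c
      exact c
  rw [hset]
  refine isClosed_iInter fun σ => isClosed_eq ?_ (continuous_const_smul _)
  exact (Lp.isometry_compMeasurePreserving (measurePreserving_perm σ)).continuous

instance : CompleteSpace (FermiH1 N) := by
  have hcl : IsClosed (fermiSubmodule N : Set (PiLp 2 (fun _ : Option (Fin N × Fin 3) =>
      L2 (Config N)))) := by
    have : (fermiSubmodule N : Set (PiLp 2 (fun _ : Option (Fin N × Fin 3) => L2 (Config N))))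
        = (⋂ kc, {U | HasWeakDeriv (U none) (U (some kc)) (configAxis N kc)}) ∩
          {U | IsAntisymm (U none)} := by
      ext U
      simp only [Set.mem_inter_iff, Set.mem_iInter]
      rfl
    rw [this]
    refine (isClosed_iInter fun kc => isClosed_hasWeakDeriv _ _ ?_ ?_ _).inter
      (isClosed_isAntisymm.preimage ?_) <;> fun_prop
  exact hcl.completeSpace_coe

instance (φ : OrbitalSet Λ) : CompleteSpace (H1K φ N) :=
  (Submodule.isClosed_topologicalClosure _ : IsClosed (galerkin φ N : Set (FermiH1 N))).completeSpace_coe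

/-! ### Extension of bilinear maps by continuity -/

/-- The second variable is extended first. The resulting operators depend linearly on the first
variable by density, with operator norm at most `C * ‖e x‖`, so they extend in turn with values in
the space of bounded operators. -/
theorem exists_bilinear_extension {X E F : Type*} [AddCommGroup X] [Module ℝ X]
    [NormedAddCommGroup E] [NormedSpace ℝ E] [NormedAddCommGroup F] [NormedSpace ℝ F]
    [CompleteSpace F] (e : X →ₗ[ℝ] E) (he : DenseRange e) (B : X →ₗ[ℝ] X →ₗ[ℝ] F) {C : ℝ}
    (hC : 0 ≤ C) (hB : ∀ x y, ‖B x y‖ ≤ C * (‖e x‖ * ‖e y‖)) :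
    ∃ T : E →L[ℝ] E →L[ℝ] F, ∀ x y, T (e x) (e y) = B x y := by
  have hB' : ∀ x y, ‖B x y‖ ≤ (C * ‖e x‖) * ‖e y‖ := fun x y => by
    rw [mul_assoc]; exact hB x y
  have heq : ∀ x y, (B x).extendOfNorm e (e y) = B x y := fun x y =>
    LinearMap.extendOfNorm_eq he ⟨_, hB' x⟩ y
  have hext : ∀ S S' : E →L[ℝ] F, (∀ y, S (e y) = S' (e y)) → S = S' := fun S S' h =>
    ContinuousLinearMap.coeFn_injective (he.equalizer S.continuous S'.continuous (funext h))
  let T₁ : X →ₗ[ℝ] E →L[ℝ] F :=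
    { toFun := fun x => (B x).extendOfNorm e
      map_add' := fun x x' => hext _ _ fun y => by
        rw [add_apply, heq, heq, heq, map_add, LinearMap.add_apply]
      map_smul' := fun a x => hext _ _ fun y => by
        rw [RingHom.id_apply, smul_apply, heq, heq, map_smul,
          LinearMap.smul_apply] }
  have hT₁ : ∀ x, ‖T₁ x‖ ≤ C * ‖e x‖ := fun x =>
    LinearMap.opNorm_extendOfNorm_le he (by positivity) (hB' x)
  refine ⟨T₁.extendOfNorm e, fun x y => ?_⟩
  rw [LinearMap.extendOfNorm_eq he ⟨C, hT₁⟩]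
  exact heq x y

/-! ### Basic facts about `𝔥¹_K` -/

variable {φ : OrbitalSet Λ}

theorem toL2_injective : Function.Injective (toL2 φ N) := fun _ _ h =>
  Subtype.ext (FermiH1.toL2_injective h)

theorem H1K_hom_ext {F : Type*} [NormedAddCommGroup F] [NormedSpace ℝ F] {S S' : H1K φ N →L[ℝ] F}
    (h : ∀ α, S (det φ α) = S' (det φ α)) : S = S' := by
  refine ContinuousLinearMap.coeFn_injective
    ((denseRange_synth φ).equalizer S.continuous S'.continuous (funext fun c => ?_))
  simp only [Function.comp_apply, synth_eq, map_sum, map_smul, h]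

theorem l2inner_comm (x y : H1K φ N) : l2inner x y = l2inner y x := real_inner_comm _ _

theorem gelfand_apply (x y : H1K φ N) : gelfand φ N x y = l2inner x y := rfl

theorem l2inner_add_left (x y z : H1K φ N) : l2inner (x + y) z = l2inner x z + l2inner y z := by
  simp [l2inner, inner_add_left]

theorem l2inner_sub_left (x y z : H1K φ N) : l2inner (x - y) z = l2inner x z - l2inner y z := by
  simp [l2inner, inner_sub_left]

theorem l2inner_smul_left (a : ℝ) (x z : H1K φ N) : l2inner (a • x) z = a * l2inner x z := by
  simp [l2inner, real_inner_smul_left]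

theorem eq_zero_of_l2inner_self {x : H1K φ N} (h : l2inner x x = 0) : x = 0 :=
  toL2_injective (by rw [map_zero]; exact inner_self_eq_zero.1 h)

/-- The functional `⟨x, ·⟩` vanishes on a dense subspace, hence at `x` itself. -/
theorem eq_zero_of_l2inner_det {x : H1K φ N} (h : ∀ δ, l2inner x (det φ δ) = 0) : x = 0 := by
  refine eq_zero_of_l2inner_self ?_
  have : gelfand φ N x = 0 := H1K_hom_ext fun δ => by
    rw [gelfand_apply, h]; rfl
  rw [← gelfand_apply, this]
  rfl

theorem l2inner_synth_det (c : State Λ N →₀ ℝ) (δ : State Λ N) :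
    l2inner (synth φ c) (det φ δ) = c δ := by
  rw [l2inner_comm, ← gelfand_apply, synth_eq, map_sum]
  simp only [map_smul, gelfand_apply, l2inner_det, smul_eq_mul, mul_ite, mul_one, mul_zero]
  rw [Finset.sum_ite_eq]
  split_ifs with h
  · rfl
  · exact (Finsupp.notMem_support_iff.1 h).symm

/-! ### The cluster map -/

/-- `T` sends the function `T Φ_r` of a cluster operator to the operator, and `A` sends it to the
`L²` adjoint of the operator. -/
structure IsClusterMap (φ : OrbitalSet Λ) (ε : Finset Λ → Finset Λ → ℤˣ) (r : State Λ N)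
    (T A : H1K φ N →L[ℝ] H1K φ N →L[ℝ] H1K φ N) : Prop where
  det_det : ∀ α β, T (det φ α) (det φ β) = excited φ ε r α β
  adjoint : ∀ x y z, l2inner (T x y) z = l2inner y (A x z)
  bound : ∃ C, ∀ β x, ‖toL2 φ N (T x (det φ β))‖ ≤ C * ‖toL2 φ N x‖

theorem exists_isClusterMap (φ : OrbitalSet Λ) (hN : 1 ≤ N) (ε : Finset Λ → Finset Λ → ℤˣ)
    (r : State Λ N) (hr : ∀ i ∈ r.1, ∀ p ∉ r.1, i < p) : ∃ T A, IsClusterMap φ ε r T A := by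
  obtain ⟨C, hC, hT⟩ := exists_norm_bilCoeff_le φ hN ε r hr
  obtain ⟨C', hC', hA⟩ := exists_norm_adjCoeff_le φ hN ε r hr
  obtain ⟨C'', hC'', hL⟩ := exists_norm_toL2_bilCoeff_le φ ε r hr
  obtain ⟨T, hT⟩ := exists_bilinear_extension (synth φ) (denseRange_synth φ)
    ((bilCoeff ε r).compr₂ (synth φ)) hC hT
  obtain ⟨A, hA⟩ := exists_bilinear_extension (synth φ) (denseRange_synth φ)
    ((adjCoeff ε r).compr₂ (synth φ)) hC' hA
  have hdet : ∀ α : State Λ N, det φ α = synth φ (Finsupp.single α 1) := fun α => by simp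
  have hTd : ∀ α β, T (det φ α) (det φ β) = excited φ ε r α β := by
    intro α β
    rw [hdet, hdet, hT, LinearMap.compr₂_apply, bilCoeff_single, mul_one, one_smul,
      synth_excitedCoeff]
  refine ⟨T, A, hTd, ?_, C'', ?_⟩
  -- On determinants `A` is the transpose of `T` by construction. Continuity then frees the three
  -- arguments `z`, `y`, `x` in turn.
  · have hAd : ∀ α δ, A (det φ α) (det φ δ) = synth φ (deexcitedCoeff ε r α δ) := by
      intro α δ
      rw [hdet, hdet, hA, LinearMap.compr₂_apply, adjCoeff_single, mul_one, one_smul]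
    have h1 : ∀ α β δ : State Λ N, l2inner (T (det φ α) (det φ β)) (det φ δ)
        = l2inner (det φ β) (A (det φ α) (det φ δ)) := by
      intro α β δ
      rw [hTd, ← synth_excitedCoeff, l2inner_synth_det, hAd, l2inner_comm, l2inner_synth_det]
      rfl
    have h2 : ∀ (α β : State Λ N) z, l2inner (T (det φ α) (det φ β)) z
        = l2inner (det φ β) (A (det φ α) z) := by
      intro α β z
      have : gelfand φ N (T (det φ α) (det φ β)) = (gelfand φ N (det φ β)).comp (A (det φ α)) :=
        H1K_hom_ext fun δ => h1 α β δ
      exact congrArg (fun S => S z) this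
    have h3 : ∀ (α : State Λ N) y z, l2inner (T (det φ α) y) z = l2inner y (A (det φ α) z) := by
      intro α y z
      have : (gelfand φ N z).comp (T (det φ α)) = gelfand φ N (A (det φ α) z) :=
        H1K_hom_ext fun β => by
          rw [ContinuousLinearMap.comp_apply, gelfand_apply, gelfand_apply, l2inner_comm, h2,
            l2inner_comm]
      rw [l2inner_comm, l2inner_comm y]
      exact congrArg (fun S => S y) this
    intro x y z
    have : (gelfand φ N z).comp (T.flip y) = (gelfand φ N y).comp (A.flip z) :=
      H1K_hom_ext fun α => by
        simp only [ContinuousLinearMap.comp_apply, gelfand_apply, ContinuousLinearMap.flip_apply]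
        rw [l2inner_comm, h3]
    rw [l2inner_comm]
    exact congrArg (fun S => S x) this
  · intro β x
    -- The estimate is in `L²` norms, but both sides are `H¹`-continuous in `x`, so it passes to the
    -- `H¹` closure.
    refine (denseRange_synth φ).induction_on (p := fun x =>
      ‖toL2 φ N (T x (det φ β))‖ ≤ C'' * ‖toL2 φ N x‖) x ?_ fun θ => ?_
    · refine isClosed_le ?_ (by fun_prop)
      exact ((toL2 φ N).continuous.comp (T.flip (det φ β)).continuous).norm
    · have h := hL θ (Finsupp.single β 1)
      have h1 : ‖toL2 φ N (det φ β)‖ = 1 := by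
        have : ‖toL2 φ N (det φ β)‖ ^ 2 = 1 := by
          rw [← real_inner_self_eq_norm_sq]
          exact (l2inner_det φ β β).trans (if_pos rfl)
        exact (pow_eq_one_iff_of_nonneg (norm_nonneg _) two_ne_zero).1 this
      rw [← hdet, h1, mul_one] at h
      rw [hdet, hT]
      exact h

/-! ### Exponentials -/

theorem exp_neg_mul_exp {𝔸 : Type*} [NormedRing 𝔸] [NormedAlgebra ℝ 𝔸] [CompleteSpace 𝔸] (x : 𝔸) :
    NormedSpace.exp (-x) * NormedSpace.exp x = 1 := by
  let _ : NormedAlgebra ℚ 𝔸 := NormedAlgebra.restrictScalars ℚ ℝ 𝔸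
  rw [← NormedSpace.exp_add_of_commute (Commute.refl x).neg_left, neg_add_cancel,
    NormedSpace.exp_zero]

theorem hasSum_exp_apply {E : Type*} [NormedAddCommGroup E] [NormedSpace ℝ E] [CompleteSpace E]
    (A : E →L[ℝ] E) (v : E) :
    HasSum (fun n : ℕ => ((n.factorial : ℝ)⁻¹) • (A ^ n) v) (NormedSpace.exp A v) := by
  have h := NormedSpace.exp_series_hasSum_exp' (𝕂 := ℝ) A
  have h2 := (ContinuousLinearMap.apply ℝ E v).hasSum h
  simpa only [ContinuousLinearMap.apply_apply, smul_apply] using h2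

theorem l2inner_exp {S S' : H1K φ N →L[ℝ] H1K φ N}
    (h : ∀ x z, l2inner (S x) z = l2inner x (S' z)) (x z : H1K φ N) :
    l2inner (NormedSpace.exp S x) z = l2inner x (NormedSpace.exp S' z) := by
  have hp : ∀ (n : ℕ) (x z), l2inner ((S ^ n) x) z = l2inner x ((S' ^ n) z) := by
    intro n
    induction n with
    | zero => intro x z; rfl
    | succ n ih =>
      intro x z
      rw [pow_succ, pow_succ', mul_apply_eq_comp, mul_apply_eq_comp, ih, h]
  have h1 := (gelfand φ N z).hasSum (hasSum_exp_apply S x)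
  have h2 := (gelfand φ N x).hasSum (hasSum_exp_apply S' z)
  rw [← gelfand_apply x, l2inner_comm, ← gelfand_apply]
  refine h1.unique ?_
  convert h2 using 1
  funext n
  simp only [map_smul, gelfand_apply]
  rw [l2inner_comm, hp]

/-! ### Extension of operators to the dual space -/

/-- By Riesz, a vector orthogonal to the range is annihilated by all functionals `⟨x, ·⟩`; taking
`x` to be this vector shows that its `L²` norm is zero. -/
theorem denseRange_gelfand : DenseRange (gelfand φ N) := by
  let G : H1K φ N →ₗ[ℝ] H1K φ N :=
    { toFun := fun x => (InnerProductSpace.toDual ℝ (H1K φ N)).symm (gelfand φ N x)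
      map_add' := fun x y => by
        rw [← map_add]
        congr 1
        ext z
        simp [gelfand_apply, l2inner_add_left]
      map_smul' := fun a x => by
        rw [RingHom.id_apply, ← LinearIsometryEquiv.map_smul]
        congr 1
        ext z
        simp [gelfand_apply, l2inner_smul_left] }
  have htop : (LinearMap.range G).topologicalClosure = ⊤ := by
    rw [Submodule.topologicalClosure_eq_top_iff, Submodule.eq_bot_iff]
    intro x hx
    refine eq_zero_of_l2inner_self ?_
    have := (Submodule.mem_orthogonal _ x).1 hx (G x) ⟨x, rfl⟩
    rw [← gelfand_apply]
    simpa [G, InnerProductSpace.toDual_symm_apply] using this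
  have hd : DenseRange G := by
    intro x
    have : x ∈ (LinearMap.range G).topologicalClosure := htop ▸ Submodule.mem_top
    exact this
  have h2 := (InnerProductSpace.toDual ℝ (H1K φ N)).surjective.denseRange.comp hd
    (InnerProductSpace.toDual ℝ (H1K φ N)).continuous
  convert h2 using 1
  funext x
  simp [G]

/-- Composition with the adjoint agrees with `B` on the dense image of `gelfand`, so the extension
is unique. -/
theorem IsDualExtension.apply_eq {S S' : H1K φ N →L[ℝ] H1K φ N}
    {B : DualH1K φ N →L[ℝ] DualH1K φ N} (hB : IsDualExtension S B)
    (h : ∀ x z, l2inner (S x) z = l2inner x (S' z)) (f : DualH1K φ N) : B f = f.comp S' := by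
  have : ⇑B = ⇑((ContinuousLinearMap.compL ℝ (H1K φ N) (H1K φ N) ℝ).flip S') := by
    refine denseRange_gelfand.equalizer B.continuous (ContinuousLinearMap.continuous _)
      (funext fun x => ?_)
    rw [Function.comp_apply, hB]
    ext z
    exact h x z
  rw [this]
  rfl

theorem exists_isDualExtension {S S' : H1K φ N →L[ℝ] H1K φ N}
    (h : ∀ x z, l2inner (S x) z = l2inner x (S' z)) : ∃ B, IsDualExtension S B :=
  ⟨(ContinuousLinearMap.compL ℝ (H1K φ N) (H1K φ N) ℝ).flip S', fun x => by
    ext z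
    exact (h x z).symm⟩

/-! ### Amplitudes -/

theorem orthonormal_toL2_det (φ : OrbitalSet Λ) :
    Orthonormal ℝ fun α : State Λ N => toL2 φ N (det φ α) :=
  orthonormal_iff_ite.2 (l2inner_det φ)

/-- The determinants form a Hilbert basis of the `L²` closure of their span, which contains `𝔥¹_K`.
The expansion is in `L²`; convergence in `H¹` is not asserted. -/
theorem hasSum_l2inner_det (x : H1K φ N) :
    HasSum (fun α => l2inner (det φ α) x • toL2 φ N (det φ α)) (toL2 φ N x) := by
  set W := (Submodule.span ℝ (Set.range fun α : State Λ N => toL2 φ N (det φ α))).topologicalClosure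
    with hW
  have hWc : CompleteSpace W := (Submodule.isClosed_topologicalClosure _).completeSpace_coe
  have hmem : ∀ y : H1K φ N, toL2 φ N y ∈ W := by
    intro y
    refine (denseRange_synth φ).induction_on (p := fun y => toL2 φ N y ∈ W) y
      ((Submodule.isClosed_topologicalClosure _).preimage (toL2 φ N).continuous) fun c => ?_
    refine Submodule.le_topologicalClosure _ ?_
    rw [synth_eq, map_sum]
    refine Submodule.sum_mem _ fun α _ => ?_
    rw [map_smul]
    exact Submodule.smul_mem _ _ (Submodule.subset_span ⟨α, rfl⟩)
  let v : State Λ N → W := fun α => ⟨toL2 φ N (det φ α), hmem _⟩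
  have hv : Orthonormal ℝ v := orthonormal_iff_ite.2 (l2inner_det φ)
  have hsp : ⊤ ≤ (Submodule.span ℝ (Set.range v)).topologicalClosure := by
    rintro ⟨y, hy⟩ -
    have hi : Topology.IsInducing (Subtype.val : W → L2 (Config N)) :=
      Topology.IsInducing.subtypeVal
    change _ ∈ closure (_ : Set W)
    refine (hi.closure_eq_preimage_closure_image _).ge ?_
    refine closure_mono ?_ hy
    have : Submodule.span ℝ (Set.range fun α : State Λ N => toL2 φ N (det φ α))
        = (Submodule.span ℝ (Set.range v)).map W.subtype := by
      rw [Submodule.map_span, ← Set.range_comp]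
      rfl
    rw [this]
    exact subset_rfl
  have h := (HilbertBasis.mk hv hsp).hasSum_repr ⟨toL2 φ N x, hmem x⟩
  have h2 := W.subtypeL.hasSum h
  simp only [HilbertBasis.repr_apply_apply, HilbertBasis.coe_mk] at h2
  exact h2

/-- The amplitudes are the expansion coefficients: the term of `r` is zero and Bessel's inequality
gives square summability. -/
theorem exists_amplitudes {r : State Λ N} {x : H1K φ N} (hx : l2inner (det φ r) x = 0) :
    ∃ t ∈ amplitudes φ r, HasSum (fun α => t α • toL2 φ N (det φ α.1)) (toL2 φ N x) := by
  have hsum : HasSum (fun α : Excitation r => l2inner (det φ α.1) x • toL2 φ N (det φ α.1))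
      (toL2 φ N x) := by
    have h := hasSum_l2inner_det x
    rwa [← hasSum_subtype_iff_of_support_subset (s := {α | α ≠ r})] at h
    rintro α hα rfl
    exact hα (by simp only [hx, zero_smul])
  have hmem : Memℓp (fun α : Excitation r => l2inner (det φ α.1) x) 2 := by
    refine memℓp_gen ?_
    have h := ((orthonormal_toL2_det (N := N) φ).comp (Subtype.val : Excitation r → State Λ N)
      Subtype.val_injective).inner_products_summable (toL2 φ N x)
    simpa [l2inner] using h
  exact ⟨⟨_, hmem⟩, ⟨x, hsum⟩, hsum⟩

theorem l2inner_det_eq_zero_of_hasSum {r : State Λ N} {t : Excitation r → ℝ} {x : H1K φ N}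
    (h : HasSum (fun α => t α • toL2 φ N (det φ α.1)) (toL2 φ N x)) : l2inner (det φ r) x = 0 := by
  have h1 := (innerSL ℝ (toL2 φ N (det φ r))).hasSum h
  refine h1.unique ?_
  convert hasSum_zero with α
  have := l2inner_det φ r α.1
  rw [if_neg (Ne.symm α.2)] at this
  simp only [innerSL_apply_apply, inner_smul_right]
  rw [l2inner] at this
  rw [this, mul_zero]

/-! ### Cluster operators -/

/-- The reference has neither holes nor virtual orbitals, so the union adds nothing, no orbital is
crossed, and `ε I ∅ = 1` removes the remaining sign. -/
theorem excited_reference {ε : Finset Λ → Finset Λ → ℤˣ} (hε : ∀ I, ε I ∅ = 1) {r α : State Λ N}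
    (hα : α ≠ r) : excited φ ε r α r = det φ α := by
  have h : IsEdge r α r := isEdge_iff.2
    ⟨fun h => hα (sdiff_eq_empty_iff_eq.1 h), by simp, by simp⟩
  have hj : join h = α := Subtype.ext (by
    change joinSet r.1 α.1 r.1 = α.1
    rw [joinSet_eq, Finset.sdiff_self, Finset.union_empty, Finset.union_empty, block_sdiff])
  have hs : ((excSign ε r α r : ℤ) : ℝ) = 1 := by
    rw [excSign, Finset.sdiff_self, hε, mul_one, virt, virt,
      sortSign_eq_crossSign (by simp)]
    simp
  rw [excited, dif_pos h, hj, hs, one_smul]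

theorem excited_of_eq (ε : Finset Λ → Finset Λ → ℤˣ) (r β : State Λ N) :
    excited φ ε r r β = 0 := dif_neg fun h => h.1 rfl

namespace IsClusterMap

variable {ε : Finset Λ → Finset Λ → ℤˣ} {r : State Λ N}
  {T A : H1K φ N →L[ℝ] H1K φ N →L[ℝ] H1K φ N}

theorem mem_clusterOps (hT : IsClusterMap φ ε r T A) (x : H1K φ N) : T x ∈ clusterOps φ ε r := by
  refine (denseRange_synth φ).induction_on (p := fun x => T x ∈ clusterOps φ ε r) x
    ((Submodule.isClosed_topologicalClosure _).preimage T.continuous) fun c => ?_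
  refine Submodule.le_topologicalClosure _ ?_
  rw [synth_eq, map_sum]
  refine Submodule.sum_mem _ fun α _ => ?_
  rw [map_smul]
  refine Submodule.smul_mem _ _ ?_
  by_cases h : α = r
  · have : T (det φ α) = 0 := H1K_hom_ext fun β => by
      rw [hT.det_det, h, excited_of_eq]
      rfl
    rw [this]
    exact Submodule.zero_mem _
  · exact Submodule.subset_span ⟨α, h, fun β => hT.det_det α β⟩

/-- On a fixed determinant `T` is bounded in its first argument for the `L²` norms. This carries the
`L²` convergence of `∑ t_α Φ_α` over to `∑ t_α X_α Φ_β`. -/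
theorem isClusterOp (hT : IsClusterMap φ ε r T A) {t : lp (fun _ : Excitation r => ℝ) 2}
    {x : H1K φ N} (h : HasSum (fun α => t α • toL2 φ N (det φ α.1)) (toL2 φ N x)) :
    IsClusterOp φ ε r t (T x) := by
  refine ⟨hT.mem_clusterOps x, fun β => ?_⟩
  obtain ⟨C, hC⟩ := hT.bound
  rw [HasSum, tendsto_iff_norm_sub_tendsto_zero] at h ⊢
  have h' := h.const_mul C
  rw [mul_zero] at h'
  refine squeeze_zero (fun _ => norm_nonneg _) (fun s => ?_) h'
  have e1 : ∑ α ∈ s, t α • toL2 φ N (excited φ ε r α.1 β) - toL2 φ N (T x (det φ β))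
      = toL2 φ N (T (∑ α ∈ s, t α • det φ α.1 - x) (det φ β)) := by
    simp only [map_sub, map_sum, map_smul, sub_apply, sum_apply, smul_apply, hT.det_det]
  have e2 : ∑ α ∈ s, t α • toL2 φ N (det φ α.1) - toL2 φ N x
      = toL2 φ N (∑ α ∈ s, t α • det φ α.1 - x) := by
    simp only [map_sub, map_sum, map_smul]
  rw [e1, e2]
  exact hC β _

theorem eq_of_isClusterOp (hT : IsClusterMap φ ε r T A) {t : lp (fun _ : Excitation r => ℝ) 2}
    {x : H1K φ N} (h : HasSum (fun α => t α • toL2 φ N (det φ α.1)) (toL2 φ N x))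
    {T' : H1K φ N →L[ℝ] H1K φ N} (h' : IsClusterOp φ ε r t T') : T' = T x :=
  H1K_hom_ext fun β => toL2_injective ((h'.hasSum β).unique ((hT.isClusterOp h).hasSum β))

theorem apply_reference (hT : IsClusterMap φ ε r T A) (hε : ∀ I, ε I ∅ = 1) {x : H1K φ N}
    (hx : l2inner (det φ r) x = 0) : T x (det φ r) = x := by
  obtain ⟨t, -, ht⟩ := exists_amplitudes hx
  have h := (hT.isClusterOp ht).hasSum r
  refine toL2_injective (h.unique ?_)
  convert ht using 3 with α
  rw [excited_reference hε α.2]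

/-- Each coefficient of `T x y` is a finite bilinear expression in those of `x` and `y`; rank
statements about infinite expansions thereby reduce to single excitations. -/
theorem l2inner_apply_det (hT : IsClusterMap φ ε r T A) (x y : H1K φ N) (δ : State Λ N) :
    l2inner (det φ δ) (T x y) = ∑ α ∈ statesIn N (r.1 ∪ δ.1), ∑ β ∈ statesIn N (r.1 ∪ δ.1),
      l2inner (det φ α) x * l2inner (det φ β) y * excitedCoeff ε r α β δ := by
  have hdet : ∀ α β : State Λ N, l2inner (det φ δ) (T (det φ α) (det φ β))
      = excitedCoeff ε r α β δ := by
    intro α β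
    rw [hT.det_det, ← synth_excitedCoeff, l2inner_comm, l2inner_synth_det]
  have h1 : ∀ α' y, l2inner (det φ δ) (T (det φ α') y) = ∑ α ∈ statesIn N (r.1 ∪ δ.1),
      ∑ β ∈ statesIn N (r.1 ∪ δ.1),
      l2inner (det φ α) (det φ α') * l2inner (det φ β) y * excitedCoeff ε r α β δ := by
    intro α' y
    have : (gelfand φ N (det φ δ)).comp (T (det φ α')) = ∑ α ∈ statesIn N (r.1 ∪ δ.1),
      ∑ β ∈ statesIn N (r.1 ∪ δ.1),
      (l2inner (det φ α) (det φ α') * excitedCoeff ε r α β δ) • gelfand φ N (det φ β) := by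
      refine H1K_hom_ext fun β' => ?_
      simp only [ContinuousLinearMap.comp_apply, gelfand_apply, hdet, sum_apply, smul_apply,
        smul_eq_mul, l2inner_det, ite_mul, mul_ite, one_mul, mul_one, mul_zero, zero_mul,
        Finset.sum_ite_eq']
      by_cases h : excitedCoeff ε r α' β' δ = 0
      · simp [h]
      · have := subset_of_excitedCoeff_ne_zero h
        simp [mem_statesIn, this.1, this.2]
    refine (congrArg (fun S => S y) this).trans ?_
    simp only [sum_apply, smul_apply, smul_eq_mul, gelfand_apply]
    refine Finset.sum_congr rfl fun α _ => Finset.sum_congr rfl fun β _ => ?_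
    ring
  have : (gelfand φ N (det φ δ)).comp (T.flip y) = ∑ α ∈ statesIn N (r.1 ∪ δ.1),
      ∑ β ∈ statesIn N (r.1 ∪ δ.1),
      (l2inner (det φ β) y * excitedCoeff ε r α β δ) • gelfand φ N (det φ α) := by
    refine H1K_hom_ext fun α' => ?_
    refine (h1 α' y).trans ?_
    simp only [sum_apply, smul_apply, smul_eq_mul, gelfand_apply]
    refine Finset.sum_congr rfl fun α _ => Finset.sum_congr rfl fun β _ => ?_
    ring
  refine (congrArg (fun S => S x) this).trans ?_
  simp only [sum_apply, smul_apply, smul_eq_mul, gelfand_apply]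
  refine Finset.sum_congr rfl fun α _ => Finset.sum_congr rfl fun β _ => ?_
  ring

end IsClusterMap

/-! ### The filtration by excitation rank -/

/-- The functions without components of excitation rank less than `m`. -/
def rankGE (φ : OrbitalSet Λ) (r : State Λ N) (m : ℕ) : Submodule ℝ (H1K φ N) :=
  ⨅ δ : {δ : State Λ N // (δ.1 \ r.1).card < m}, (gelfand φ N (det φ δ.1)).ker

theorem mem_rankGE {r : State Λ N} {m : ℕ} {x : H1K φ N} : x ∈ rankGE φ r m ↔
    ∀ δ : State Λ N, (δ.1 \ r.1).card < m → l2inner (det φ δ) x = 0 := by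
  simp only [rankGE, Submodule.mem_iInf, Subtype.forall]
  rfl

theorem isClosed_rankGE (r : State Λ N) (m : ℕ) :
    IsClosed (rankGE φ r m : Set (H1K φ N)) := by
  have : (rankGE φ r m : Set (H1K φ N))
      = ⋂ δ : {δ : State Λ N // (δ.1 \ r.1).card < m}, {x | gelfand φ N (det φ δ.1) x = 0} := by
    ext x
    simp only [Set.mem_iInter, SetLike.mem_coe, mem_rankGE, Subtype.forall]
    rfl
  rw [this]
  exact isClosed_iInter fun δ => isClosed_eq (gelfand φ N (det φ δ.1)).continuous continuous_const

theorem mem_rankGE_zero (r : State Λ N) (x : H1K φ N) : x ∈ rankGE φ r 0 :=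
  mem_rankGE.2 fun _ h => absurd h (Nat.not_lt_zero _)

theorem rankGE_antitone (r : State Λ N) {m n : ℕ} (h : m ≤ n) : rankGE φ r n ≤ rankGE φ r m :=
  fun _ hx => mem_rankGE.2 fun δ hδ => mem_rankGE.1 hx δ (hδ.trans_le h)

theorem card_sdiff_reference {r α : State Λ N} : (α.1 \ r.1).card = (r.1 \ α.1).card := by
  have h1 := Finset.card_sdiff_add_card_inter r.1 α.1
  have h2 := Finset.card_sdiff_add_card_inter α.1 r.1
  rw [Finset.inter_comm] at h2
  have := r.2
  have := α.2
  omega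

theorem mem_rankGE_one {r : State Λ N} {x : H1K φ N} :
    x ∈ rankGE φ r 1 ↔ l2inner (det φ r) x = 0 := by
  rw [mem_rankGE]
  constructor
  · intro h
    exact h r (by simp)
  · intro h δ hδ
    rw [card_sdiff_reference, Nat.lt_one_iff, Finset.card_eq_zero, sdiff_eq_empty_iff_eq] at hδ
    rw [hδ, h]

/-- A state of `N` particles has at most `N` virtual orbitals. -/
theorem eq_zero_of_mem_rankGE {r : State Λ N} {x : H1K φ N} (h : x ∈ rankGE φ r (N + 1)) :
    x = 0 := by
  refine eq_zero_of_l2inner_det fun δ => ?_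
  rw [l2inner_comm]
  refine mem_rankGE.1 h δ (Nat.lt_succ_of_le ?_)
  exact (Finset.card_le_card Finset.sdiff_subset).trans_eq δ.2

theorem mem_of_hasSum {E ι : Type*} [NormedAddCommGroup E] [NormedSpace ℝ E] {K : Submodule ℝ E}
    (hK : IsClosed (K : Set E)) {f : ι → E} {x : E} (hf : ∀ i, f i ∈ K) (h : HasSum f x) :
    x ∈ K :=
  hK.mem_of_tendsto h (Filter.Eventually.of_forall fun _ => K.sum_mem fun i _ => hf i)

namespace IsClusterMap

variable {ε : Finset Λ → Finset Λ → ℤˣ} {r : State Λ N}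
  {T A : H1K φ N →L[ℝ] H1K φ N →L[ℝ] H1K φ N}

/-- Virtual parts are united disjointly, so excitation ranks add. -/
theorem apply_mem_rankGE (hT : IsClusterMap φ ε r T A) {x y : H1K φ N} {m n : ℕ}
    (hx : x ∈ rankGE φ r m) (hy : y ∈ rankGE φ r n) : T x y ∈ rankGE φ r (m + n) := by
  classical
  rw [mem_rankGE] at *
  intro δ hδ
  rw [hT.l2inner_apply_det]
  refine Finset.sum_eq_zero fun α _ => Finset.sum_eq_zero fun β _ => ?_
  rw [excitedCoeff_apply]
  split_ifs with hs
  · have hc := congrArg Finset.card hs.2.2.2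
    rw [Finset.card_union_of_disjoint hs.2.2.1] at hc
    rcases lt_or_ge (α.1 \ r.1).card m with h | h
    · rw [hx α h, zero_mul, zero_mul]
    · rw [hy β (by omega), mul_zero, zero_mul]
  · rw [mul_zero]

/-- The gain holds for every `x`, because its component along `Φ_r` contributes the zero operator
and any other label has rank at least one. -/
theorem apply_mem_rankGE_succ (hT : IsClusterMap φ ε r T A) (x : H1K φ N) {y : H1K φ N} {n : ℕ}
    (hy : y ∈ rankGE φ r n) : T x y ∈ rankGE φ r (n + 1) := by
  classical
  rw [mem_rankGE] at *
  intro δ hδ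
  rw [hT.l2inner_apply_det]
  refine Finset.sum_eq_zero fun α _ => Finset.sum_eq_zero fun β _ => ?_
  rw [excitedCoeff_apply]
  split_ifs with hs
  · have hc := congrArg Finset.card hs.2.2.2
    rw [Finset.card_union_of_disjoint hs.2.2.1, card_sdiff_reference (α := α)] at hc
    rcases Nat.eq_zero_or_pos (r.1 \ α.1).card with h | h
    · rw [excCoeff, if_pos (Finset.card_eq_zero.1 h), zero_mul, mul_zero]
    · rw [hy β (by omega), mul_zero, zero_mul]
  · rw [mul_zero]

theorem pow_apply_mem_rankGE (hT : IsClusterMap φ ε r T A) (x y : H1K φ N) (k : ℕ) :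
    (T x ^ k) y ∈ rankGE φ r k := by
  induction k with
  | zero => exact mem_rankGE_zero r _
  | succ k ih =>
    rw [pow_succ', mul_apply_eq_comp]
    exact hT.apply_mem_rankGE_succ x ih

/-- In the telescoped difference one factor is `T (x - x')`, of rank at least `m`, and each of the
`k` others gains at least one. -/
theorem pow_sub_pow_mem_rankGE (hT : IsClusterMap φ ε r T A) {x x' : H1K φ N} (y : H1K φ N)
    {m : ℕ} (h : x - x' ∈ rankGE φ r m) (k : ℕ) :
    (T x ^ (k + 1)) y - (T x' ^ (k + 1)) y ∈ rankGE φ r (m + k) := by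
  induction k with
  | zero =>
    rw [zero_add, pow_one, pow_one, ← sub_apply, ← map_sub]
    exact hT.apply_mem_rankGE h (mem_rankGE_zero r y)
  | succ k ih =>
    have e : (T x ^ (k + 1 + 1)) y - (T x' ^ (k + 1 + 1)) y
        = T x ((T x ^ (k + 1)) y - (T x' ^ (k + 1)) y) + T (x - x') ((T x' ^ (k + 1)) y) := by
      rw [pow_succ' _ (k + 1), pow_succ' _ (k + 1), mul_apply_eq_comp, mul_apply_eq_comp, map_sub,
        map_sub, sub_apply]
      abel
    rw [e]
    exact Submodule.add_mem _ (hT.apply_mem_rankGE_succ x ih)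
      (hT.apply_mem_rankGE h (hT.pow_apply_mem_rankGE x' y (k + 1)))

/-- Without the constant and linear terms, every term of the difference contains at least one more
factor beside `T (x - x')`, so one rank is gained. -/
theorem exp_sub_exp_mem_rankGE (hT : IsClusterMap φ ε r T A) {x x' : H1K φ N} (y : H1K φ N)
    {m : ℕ} (h : x - x' ∈ rankGE φ r m) :
    (NormedSpace.exp (T x) y - T x y) - (NormedSpace.exp (T x') y - T x' y)
      ∈ rankGE φ r (m + 1) := by
  have h1 := ((hasSum_exp_apply (T x) y).sub (hasSum_exp_apply (T x') y)).sub
    (hasSum_ite_eq 1 (T x y - T x' y))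
  have e : (NormedSpace.exp (T x) y - T x y) - (NormedSpace.exp (T x') y - T x' y)
      = NormedSpace.exp (T x) y - NormedSpace.exp (T x') y - (T x y - T x' y) := by abel
  rw [e]
  refine mem_of_hasSum (isClosed_rankGE r _) (fun k => ?_) h1
  match k with
  | 0 => simp
  | 1 => simp
  | k + 2 =>
    simp only [Nat.reduceEqDiff, if_false, sub_zero, ← smul_sub]
    exact Submodule.smul_mem _ _
      (rankGE_antitone r (by omega) (hT.pow_sub_pow_mem_rankGE y h (k + 1)))

theorem exp_sub_mem_rankGE_one (hT : IsClusterMap φ ε r T A) (x y : H1K φ N) :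
    NormedSpace.exp (T x) y - y ∈ rankGE φ r 1 := by
  have h1 := (hasSum_exp_apply (T x) y).sub (hasSum_ite_eq 0 y)
  refine mem_of_hasSum (isClosed_rankGE r _) (fun k => ?_) h1
  match k with
  | 0 => simp
  | k + 1 =>
    rw [if_neg (by omega), sub_zero]
    exact Submodule.smul_mem _ _
      (rankGE_antitone r (by omega) (hT.pow_apply_mem_rankGE x y (k + 1)))

theorem exists_exp_eq (hT : IsClusterMap φ ε r T A) (hε : ∀ I, ε I ∅ = 1) {Ψ : H1K φ N}
    (hΨ : l2inner (det φ r) Ψ = 1) :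
    ∃ x, l2inner (det φ r) x = 0 ∧ Ψ = NormedSpace.exp (T x) (det φ r) := by
  -- Since `T x Φ_r = x` for `x` orthogonal to `Φ_r`, the equation `exp (T x) Φ_r = Ψ` is the fixed
  -- point equation of `F`.
  let F : H1K φ N → H1K φ N := fun x =>
    Ψ - (NormedSpace.exp (T x) (det φ r) - T x (det φ r))
  have hF1 : ∀ x, F x ∈ rankGE φ r 1 := by
    intro x
    have e : F x = (Ψ - det φ r) - (NormedSpace.exp (T x) (det φ r) - det φ r)
        + T x (det φ r) := by simp only [F]; abel
    rw [e]
    refine Submodule.add_mem _ (Submodule.sub_mem _ ?_ (hT.exp_sub_mem_rankGE_one x _))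
      (hT.apply_mem_rankGE_succ x (mem_rankGE_zero r _))
    rw [mem_rankGE_one, l2inner_comm, l2inner_sub_left, l2inner_comm, hΨ, l2inner_det, if_pos rfl,
      sub_self]
  have hFsub : ∀ x x' m, x - x' ∈ rankGE φ r m → F x - F x' ∈ rankGE φ r (m + 1) := by
    intro x x' m h
    have := Submodule.neg_mem _ (hT.exp_sub_exp_mem_rankGE (det φ r) h)
    convert this using 1
    simp only [F]
    abel
  have hiter : ∀ n, F^[n + 1] 0 - F^[n] 0 ∈ rankGE φ r n := by
    intro n
    induction n with
    | zero => exact mem_rankGE_zero r _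
    | succ n ih =>
      rw [Function.iterate_succ_apply' F (n + 1), Function.iterate_succ_apply' F n]
      exact hFsub _ _ n (by rw [← Function.iterate_succ_apply' F n]; exact ih)
  -- Consecutive iterates differ by rank at least `n` after `n` steps, so the sequence is constant
  -- from `n = N + 1` on.
  set x := F^[N + 1] 0 with hx
  have hfix : F x = x := by
    have := eq_zero_of_mem_rankGE (hiter (N + 1))
    rw [Function.iterate_succ_apply'] at this
    exact sub_eq_zero.1 this
  have hx0 : l2inner (det φ r) x = 0 := by
    rw [← mem_rankGE_one, ← hfix]
    exact hF1 x
  refine ⟨x, hx0, ?_⟩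
  have h := hT.apply_reference hε hx0
  have h2 : Ψ - (NormedSpace.exp (T x) (det φ r) - T x (det φ r)) = x := hfix
  rw [h] at h2
  rw [sub_eq_iff_eq_add] at h2
  rw [h2]
  abel

/-! ### Equivalence of the equations -/

theorem adjoint_neg (hT : IsClusterMap φ ε r T A) (x y z : H1K φ N) :
    l2inner ((-T x) y) z = l2inner y ((-A x) z) := by
  have h := hT.adjoint x y z
  simp only [l2inner, neg_apply, map_neg, inner_neg_left, inner_neg_right] at h ⊢
  rw [h]

theorem fullCC_of_projectedSchrodinger (hT : IsClusterMap φ ε r T A) (hε : ∀ I, ε I ∅ = 1)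
    {H : H1K φ N →L[ℝ] DualH1K φ N} {Ψ : H1K φ N} (hΨ : l2inner (det φ r) Ψ = 1) {E : ℝ}
    (h : ProjectedSchrodinger H Ψ E) : FullCC ε r H Ψ E := by
  obtain ⟨x, hx, hexp⟩ := hT.exists_exp_eq hε hΨ
  obtain ⟨t, ht, hsum⟩ := exists_amplitudes hx
  have hadj := l2inner_exp (hT.adjoint_neg x)
  obtain ⟨B, hB⟩ := exists_isDualExtension hadj
  -- The equation is tested with the image of `z` under the exponential of `-A x`; back on the left
  -- factor, this exponential turns `Ψ` into `Φ_r`.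
  have key : ∀ z, B (H Ψ) z = E * l2inner (det φ r) z := by
    intro z
    rw [hB.apply_eq hadj, ContinuousLinearMap.comp_apply, h, ← hadj, hexp, ← mul_apply_eq_comp,
      exp_neg_mul_exp]
    rfl
  refine ⟨t, ht, T x, B, hT.isClusterOp hsum, hB, hexp, ?_, ?_⟩
  · rintro s ⟨y, hy⟩
    refine ⟨T y, hT.isClusterOp hy, ?_⟩
    have hy0 := l2inner_det_eq_zero_of_hasSum hy
    rw [← hexp, key, hT.apply_reference hε hy0, hy0, mul_zero]
  · rw [← hexp, key, l2inner_det, if_pos rfl, mul_one]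

theorem projectedSchrodinger_of_fullCC (hT : IsClusterMap φ ε r T A) (hε : ∀ I, ε I ∅ = 1)
    {H : H1K φ N →L[ℝ] DualH1K φ N} {Ψ : H1K φ N} {E : ℝ}
    (h : FullCC ε r H Ψ E) : ProjectedSchrodinger H Ψ E := by
  obtain ⟨t, ⟨x, hx⟩, T', B, hT', hB, hexp, hS, hE⟩ := h
  obtain rfl := hT.eq_of_isClusterOp hx hT'
  rw [← hexp] at hS hE
  have hadj := l2inner_exp (hT.adjoint_neg x)
  have hadj' := l2inner_exp (hT.adjoint x)
  -- Every `z` is a multiple of `Φ_r`, where the energy equation applies, plus some `S Φ_r`, where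
  -- the amplitude equations apply. Uniqueness of cluster operators identifies the given `S`.
  have key : ∀ z, B (H Ψ) z = E * l2inner (det φ r) z := by
    intro z
    set a := l2inner (det φ r) z with ha
    have hz0 : l2inner (det φ r) (z - a • det φ r) = 0 := by
      rw [l2inner_comm, l2inner_sub_left, l2inner_smul_left, l2inner_det, if_pos rfl, mul_one,
        l2inner_comm, ← ha, sub_self]
    obtain ⟨s, hs, hsum⟩ := exists_amplitudes hz0
    obtain ⟨S, hS', hzero⟩ := hS s hs
    rw [hT.eq_of_isClusterOp hsum hS', hT.apply_reference hε hz0, map_sub, map_smul, ← hE,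
      sub_eq_zero] at hzero
    rw [hzero, smul_eq_mul, mul_comm]
  intro Φ
  -- This test function undoes the adjoint exponential hidden in `B`.
  have h1 := key (NormedSpace.exp (A x) Φ)
  rw [hB.apply_eq hadj, ContinuousLinearMap.comp_apply, ← mul_apply_eq_comp, exp_neg_mul_exp,
    ← hadj', ← hexp] at h1
  exact h1

theorem fullCI_of_projectedSchrodinger (hT : IsClusterMap φ ε r T A) (hε : ∀ I, ε I ∅ = 1)
    {H : H1K φ N →L[ℝ] DualH1K φ N} {Ψ : H1K φ N} (hΨ : l2inner (det φ r) Ψ = 1) {E : ℝ}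
    (h : ProjectedSchrodinger H Ψ E) : FullCI ε r H Ψ E := by
  have hx : l2inner (det φ r) (Ψ - det φ r) = 0 := by
    rw [l2inner_comm, l2inner_sub_left, l2inner_comm, hΨ, l2inner_det, if_pos rfl, sub_self]
  obtain ⟨c, hc, hsum⟩ := exists_amplitudes hx
  have hexp : Ψ = (1 + T (Ψ - det φ r)) (det φ r) := by
    rw [add_apply, hT.apply_reference hε hx, one_apply_eq_self]
    abel
  have hE : E = ciEnergy r H (T (Ψ - det φ r)) := by
    rw [ciEnergy, ← hexp, h, l2inner_comm, hΨ, mul_one]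
  refine ⟨c, hc, T (Ψ - det φ r), hT.isClusterOp hsum, hexp, ?_, hE⟩
  rintro s ⟨y, hy⟩
  refine ⟨T y, hT.isClusterOp hy, ?_⟩
  rw [← hexp, ← hE, h]

theorem projectedSchrodinger_of_fullCI (hT : IsClusterMap φ ε r T A) (hε : ∀ I, ε I ∅ = 1)
    {H : H1K φ N →L[ℝ] DualH1K φ N} {Ψ : H1K φ N} (hΨ : l2inner (det φ r) Ψ = 1) {E : ℝ}
    (h : FullCI ε r H Ψ E) : ProjectedSchrodinger H Ψ E := by
  obtain ⟨c, -, C, -, hexp, hS, hE⟩ := h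
  rw [← hE, ← hexp] at hS
  have hE' : H Ψ (det φ r) = E := by rw [hE, ciEnergy, ← hexp]
  intro Φ
  set a := l2inner (det φ r) Φ with ha
  -- The part of `Φ` orthogonal to `Φ_r` is of the form `S Φ_r`; along `Φ_r` the equation is the
  -- definition of the CI energy.
  have hz0 : l2inner (det φ r) (Φ - a • det φ r) = 0 := by
    rw [l2inner_comm, l2inner_sub_left, l2inner_smul_left, l2inner_det, if_pos rfl, mul_one,
      l2inner_comm, ← ha, sub_self]
  obtain ⟨s, hs, hsum⟩ := exists_amplitudes hz0
  obtain ⟨S, hS', hzero⟩ := hS s hs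
  rw [hT.eq_of_isClusterOp hsum hS', hT.apply_reference hε hz0, map_sub, map_smul, hE',
    l2inner_comm, l2inner_sub_left, l2inner_smul_left, hΨ, l2inner_comm, smul_eq_mul] at hzero
  linarith

end IsClusterMap

end CoupledCluster

end

open CoupledCluster
theorem mainTheorem2 {Λ : Type*} [LinearOrder Λ] [Countable Λ] {N : ℕ} (hN : 1 ≤ N)
    (φ : OrbitalSet Λ) (r : State Λ N) (hr : ∀ i ∈ r.1, ∀ p ∉ r.1, i < p)
    (ε : Finset Λ → Finset Λ → ℤˣ) (hε : ∀ I, ε I ∅ = 1)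
    (H : H1K φ N →L[ℝ] DualH1K φ N) (Ψ : H1K φ N) (hΨ : l2inner Ψ (det φ r) = 1) (E : ℝ) :
    List.TFAE [ProjectedSchrodinger H Ψ E, FullCC ε r H Ψ E, FullCI ε r H Ψ E] := by
  obtain ⟨T, A, hT⟩ := exists_isClusterMap φ hN ε r hr
  have hΨ' : l2inner (det φ r) Ψ = 1 := by rw [l2inner_comm, hΨ]
  tfae_have 1 → 2 := hT.fullCC_of_projectedSchrodinger hε hΨ'
  tfae_have 2 → 1 := hT.projectedSchrodinger_of_fullCC hε
  tfae_have 1 → 3 := hT.fullCI_of_projectedSchrodinger hε hΨ'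
  tfae_have 3 → 1 := hT.projectedSchrodinger_of_fullCI hε hΨ'
  tfae_finish
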